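/- Work over $\mathbb{C}$. Let $W=\mathrm{Fl}(1,2,3)=\{(x,y)\in\mathbb{P}^2\times\mathbb{P}^2 : x_0y_0+x_1y_1+x_2y_2=0\}$ be the variety of complete flags in $\mathbb{P}^2$. Let $C\subset W$ be an integral closed curve of bidegree $(2,2)$ (its intersection number with every divisor of bidegree $(1,0)$, and with every divisor of bidegree $(0,1)$, on $\mathbb{P}^2\times\mathbb{P}^2$ is $2$) such that both projections $W\to\mathbb{P}^2$ restrict to closed embeddings of $C$. Then the blow-up $Y_{30}$ of $W$ along $C$ exists and is isomorphic over $\mathbb{C}$ to a complete intersection $D_1\cap D_2\cap D_3$ in $\mathbb{P}^2\times\mathbb{P}^2\times\mathbb{P}^2$, where $D_1,D_2,D_3$ are numerically effective divisors of tridegrees $(1,1,0)$, $(1,0,1)$ and $(0,1,1)$ respectively. -/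

import Mathlib

open CategoryTheory CategoryTheory.Limits AlgebraicGeometry

noncomputable section

namespace FlagBlowup

attribute [local instance] MvPolynomial.gradedAlgebra

/-! ## Cartier divisors, blow-ups, complete intersections -/

/-- The closed subscheme defined by `I` is an effective Cartier divisor: locally `I` is generated
by one nonzerodivisor. -/
def IsEffectiveCartier {X : Scheme.{0}} (I : X.IdealSheafData) : Prop :=
  ∀ x : X, ∃ U : X.affineOpens, x ∈ U.1 ∧
    ∃ f ∈ nonZeroDivisors Γ(X, U.1), I.ideal U = Ideal.span {f}

/-- `π : Y ⟶ X` is the blow-up of `X` along the closed subscheme defined by `I`: the inverse image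
ideal sheaf `I.comap π` of `I` is invertible, and `π` is universal with this property. -/
def IsBlowup {X Y : Scheme.{0}} (π : Y ⟶ X) (I : X.IdealSheafData) : Prop :=
  IsEffectiveCartier (I.comap π) ∧
    ∀ (T : Scheme.{0}) (g : T ⟶ X), IsEffectiveCartier (I.comap g) →
      ∃! h : T ⟶ Y, h ≫ π = g

/-- `D₁ ∩ D₂ ∩ D₃` is a complete intersection: `D₁` is a Cartier divisor in `X`, the scheme
`D₁ ∩ D₂` is a Cartier divisor in `D₁`, and `D₁ ∩ D₂ ∩ D₃` is a Cartier divisor in `D₁ ∩ D₂`;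
that is, local equations of `D₁, D₂, D₃` form a regular sequence. -/
def IsCompleteIntersection {X : Scheme.{0}} (D₁ D₂ D₃ : X.IdealSheafData) : Prop :=
  IsEffectiveCartier D₁ ∧
    IsEffectiveCartier (D₂.comap D₁.subschemeι) ∧
    IsEffectiveCartier (D₃.comap (D₁ ⊔ D₂).subschemeι)

/-! ## Curves and the degree of a divisor on a curve -/

/-- An integral curve: an integral locally Noetherian scheme of dimension one. -/
class IsIntegralCurve (C : Scheme.{0}) : Prop where
  isIntegral : IsIntegral C
  isLocallyNoetherian : IsLocallyNoetherian C
  dim_eq_one : topologicalKrullDim C = 1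

attribute [instance] IsIntegralCurve.isIntegral IsIntegralCurve.isLocallyNoetherian

/-- An open set containing the image of some point contains the image of the generic point. -/
theorem map_genericPoint_mem {C X : Scheme.{0}} [IsIntegral C] (i : C ⟶ X) {U : X.Opens} {p : C}
    (h : i p ∈ U) : i (genericPoint C) ∈ U :=
  ((genericPoint_specializes p).map i.continuous).mem_open U.isOpen h

/-- A nonzero rational section of the line bundle `i^* 𝒪_X(D)` on `C`, where `D` is the effective
Cartier divisor with ideal sheaf `I` and `i : C ⟶ X` is a morphism from an integral scheme.
Near `p` it is `h p • (f p)⁻¹`, where `f p` is a local equation of `D` near `i p` (so that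
`(f p)⁻¹` is a local generator of `𝒪_X(D)`) and `h p` is a nonzero rational function on `C`;
`compat` says that these local expressions agree at the generic point of `C`:
if `f p = u • f q` in the local ring of `X` at the image of that point, then `h p = i^*(u) • h q`. -/
structure RationalSection {C X : Scheme.{0}} [IsIntegral C] (I : X.IdealSheafData)
    (i : C ⟶ X) where
  U : C → X.affineOpens
  mem : ∀ p, i p ∈ (U p).1
  f : ∀ p, Γ(X, (U p).1)
  f_mem : ∀ p, f p ∈ nonZeroDivisors Γ(X, (U p).1)
  ideal_eq : ∀ p, I.ideal (U p) = Ideal.span {f p}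
  h : C → C.functionField
  h_ne_zero : ∀ p, h p ≠ 0
  compat : ∀ p q, ∃ u : X.presheaf.stalk (i (genericPoint C)),
    X.presheaf.germ (U p).1 (i (genericPoint C)) (map_genericPoint_mem i (mem p)) (f p) =
        u * X.presheaf.germ (U q).1 (i (genericPoint C)) (map_genericPoint_mem i (mem q)) (f q) ∧
      h p = (show C.functionField from (i.stalkMap (genericPoint C)).hom u) * h q

/-- The degree of a rational section of a line bundle on an integral curve `C` over an
algebraically closed field: the sum of its orders of vanishing at the closed points of `C`. -/
def RationalSection.degree {C X : Scheme.{0}} [IsIntegralCurve C] {I : X.IdealSheafData}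
    {i : C ⟶ X} (s : RationalSection I i) : ℤ :=
  ∑ᶠ p : C, C.ord (s.h p) p

/-- `deg i^* 𝒪_X(D) = d`, that is `D · C = d`. (For `C` proper over an algebraically closed field
all rational sections have the same degree.) -/
def HasDegree {C X : Scheme.{0}} [IsIntegralCurve C] (I : X.IdealSheafData) (i : C ⟶ X)
    (d : ℤ) : Prop :=
  Nonempty (RationalSection I i) ∧ ∀ s : RationalSection I i, s.degree = d

/-- An effective Cartier divisor `D` on a proper scheme over an algebraically closed field is
numerically effective: `D · C ≥ 0` for every integral closed curve `C`, where `D · C` is the degree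
of any rational section of `𝒪_X(D)` restricted to `C`. -/
def IsNef {X : Scheme.{0}} (I : X.IdealSheafData) : Prop :=
  IsEffectiveCartier I ∧
    ∀ (C : Scheme.{0}) [IsIntegralCurve C] (i : C ⟶ X) [IsClosedImmersion i],
      ∃ s : RationalSection I i, 0 ≤ s.degree

/-! ## Products of projective planes and multihomogeneous forms -/

/-- `Spec ℂ`. -/
abbrev SpecC : Scheme.{0} := Spec (CommRingCat.of ℂ)

/-- The standard grading of `ℂ[x₀, x₁, x₂]`. -/
abbrev grading : ℕ → Submodule ℂ (MvPolynomial (Fin 3) ℂ) :=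
  MvPolynomial.homogeneousSubmodule (Fin 3) ℂ

/-- The complex projective plane. -/
def P2 : Scheme.{0} := Proj grading

/-- The structure morphism of the projective plane. -/
def P2.str : P2 ⟶ SpecC :=
  Proj.toSpecZero grading ≫ Spec.map (CommRingCat.ofHom (algebraMap ℂ (grading 0)))

/-- The standard open subset `x_j ≠ 0` of the projective plane. -/
def P2.chart (j : Fin 3) : P2.Opens := Proj.basicOpen grading (MvPolynomial.X j)

/-- The regular function `x_l / x_j` on the open subset `x_j ≠ 0`. -/
def P2.coord (j l : Fin 3) : Γ(P2, P2.chart j) :=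
  (Proj.awayToSection grading (MvPolynomial.X j)).hom
    (HomogeneousLocalization.Away.mk grading (MvPolynomial.isHomogeneous_X ℂ j) 1
      (MvPolynomial.X l) (MvPolynomial.isHomogeneous_X ℂ l))

section Forms

variable {T : Scheme.{0}} {k : ℕ} (s : T ⟶ SpecC) (q : Fin k → (T ⟶ P2))

/-- The open subset of `T` where the `j a`-th coordinate of the `a`-th map `q a : T ⟶ P2` is
nonzero, for all `a`. -/
def chart (j : Fin k → Fin 3) : T.Opens := ⨅ a, (q a) ⁻¹ᵁ (P2.chart (j a))

/-- The `ℂ`-algebra structure of the functions on `T`. -/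
def scalars (U : T.Opens) : ℂ →+* Γ(T, U) :=
  (T.presheaf.map (homOfLE le_top).op).hom.comp
    (s.appTop.hom.comp (Scheme.ΓSpecIso (CommRingCat.of ℂ)).inv.hom)

theorem chart_le (j : Fin k → Fin 3) (a : Fin k) :
    chart q j ≤ (q a) ⁻¹ᵁ (P2.chart (j a)) :=
  iInf_le (fun a => (q a) ⁻¹ᵁ (P2.chart (j a))) a

/-- The regular function `x_{a,l} / x_{a, j a}` on `chart q j`. -/
def coordinate (j : Fin k → Fin 3) (a : Fin k) (l : Fin 3) : Γ(T, chart q j) :=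
  (T.presheaf.map (homOfLE (chart_le q j a)).op).hom
    (((q a).app (P2.chart (j a))).hom (P2.coord (j a) l))

/-- For a polynomial `F` in `k` groups of three variables, the regular function
`F(x_{a,l} / x_{a, j a})` on `chart q j`. -/
def dehomogenize (F : MvPolynomial (Fin k × Fin 3) ℂ) (j : Fin k → Fin 3) : Γ(T, chart q j) :=
  MvPolynomial.eval₂ (scalars s (chart q j)) (fun v => coordinate q j v.1 v.2) F

/-- The ideal sheaf of the closed subscheme `F = 0` of `T`: the smallest quasi-coherent ideal sheaf
containing the local equation `dehomogenize s q F j` on each chart. -/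
def zeroIdeal (F : MvPolynomial (Fin k × Fin 3) ℂ) : T.IdealSheafData :=
  sInf {I | ∀ (j : Fin k → Fin 3) (V : T.affineOpens) (hV : V.1 ≤ chart q j),
    (T.presheaf.map (homOfLE hV).op).hom (dehomogenize s q F j) ∈ I.ideal V}

/-- `D` is a divisor of multidegree `d` (on the product `T` of `k` projective planes, with
projections `q`): the zero scheme of a nonzero multihomogeneous form of multidegree `d`. -/
def IsDivisorOfMultidegree (d : Fin k → ℕ) (D : T.IdealSheafData) : Prop :=
  ∃ F : MvPolynomial (Fin k × Fin 3) ℂ, F ≠ 0 ∧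
    MvPolynomial.IsWeightedHomogeneous
      (fun v : Fin k × Fin 3 => (Pi.single v.1 1 : Fin k → ℕ)) F d ∧
    D = zeroIdeal s q F

end Forms

/-- The product of two projective planes. -/
abbrev P2xP2 : Scheme.{0} := pullback P2.str P2.str

/-- The structure morphism of `P2xP2`. -/
def P2xP2.str : P2xP2 ⟶ SpecC := pullback.fst P2.str P2.str ≫ P2.str

/-- The projections of `P2xP2`. -/
def P2xP2.proj : Fin 2 → (P2xP2 ⟶ P2) :=
  ![pullback.fst P2.str P2.str, pullback.snd P2.str P2.str]

/-- The product of three projective planes. -/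
abbrev P2xP2xP2 : Scheme.{0} := pullback P2xP2.str P2.str

/-- The structure morphism of `P2xP2xP2`. -/
def P2xP2xP2.str : P2xP2xP2 ⟶ SpecC := pullback.fst P2xP2.str P2.str ≫ P2xP2.str

/-- The projections of `P2xP2xP2`. -/
def P2xP2xP2.proj : Fin 3 → (P2xP2xP2 ⟶ P2) :=
  ![pullback.fst P2xP2.str P2.str ≫ P2xP2.proj 0,
    pullback.fst P2xP2.str P2.str ≫ P2xP2.proj 1,
    pullback.snd P2xP2.str P2.str]

/-! ## The flag variety -/

/-- The ideal sheaf of the incidence divisor `x₀ y₀ + x₁ y₁ + x₂ y₂ = 0`. -/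
def flagIdeal : P2xP2.IdealSheafData :=
  zeroIdeal P2xP2.str P2xP2.proj
    (∑ l : Fin 3, MvPolynomial.X ((0 : Fin 2), l) * MvPolynomial.X ((1 : Fin 2), l))

/-- The variety `W = Fl(1, 2, 3)` of complete flags (point `x` on line `y`) in the projective
plane. -/
def W : Scheme.{0} := flagIdeal.subscheme

/-- The embedding of `W` in `P2xP2`. -/
def W.ι : W ⟶ P2xP2 := flagIdeal.subschemeι

end FlagBlowup

end

open CategoryTheory CategoryTheory.Limits AlgebraicGeometry

noncomputable section

namespace FlagBlowup

attribute [local instance] MvPolynomial.gradedAlgebra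

/-! Write `x` and `y` for the two embeddings of `C` in the plane. Both images are conics that lie on
no line: if a linear form vanished on `C`, a second linear form through a point of `C` would cut out
that reduced point alone, and the degree would be one (`IsConic.eq_zero`). The two line bundles have
degree two, so a form of bidegree (1,1) that is not zero on `C` has at most four zeros there
(`card_le_four`). Interpolation at five points then yields an invertible matrix `B` with `x = B y`
on `C`, up to a scalar (`exists_collineation`).

Consequently `C` is the locus in `W` where `x` is proportional to `B y`. This holds
scheme-theoretically: modulo the components of the cross product `x × B y` the coordinates of `x`
can be eliminated, the incidence equation turns into `y · B y = 0`, and this equation generates the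
ideal of the conic (`ker_eq_of_conic`).

The ideal of `C` in `W` is thus generated by the three components of `x × B y`, and the blow-up
should record the direction `z` of this vector, which is orthogonal to `x` and to `B y`. The
candidate is therefore `x · y = 0`, `x · z = 0`, `z · B y = 0` in the triple product. Over any `T`
on which the ideal becomes invertible, the components of `x × B y` are multiples `w l` of one
nonzerodivisor, and `z = w` is the only solution. This is the universal property
(`blowup_exists_local`, `blowup_unique`, `isBlowup_blowupMap`).

It remains to see that the ideal is invertible on the candidate and that the three equations form a
regular sequence. The charts `x_i = y_j = z_k = 1` with `j ≠ i` and `k ≠ i` cover the candidate. On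
such a chart the first two equations eliminate `y_i` and `z_i`, and the third becomes `M + N z_p`,
where `M` and `N` are components of `x × B y` up to sign. They are coprime: a common divisor would
divide `x · A x` with `A` inverse to `B`, a nonzero form that involves neither `y` nor `z`
(`isUnit_of_dvd_dvd`). So `N` is a nonzerodivisor modulo `M + N z_p` (`IsProd.blowup_regular_aux`).
Nefness holds because on any curve some monomial gives a regular nonzero section (`IsProd.isNef`).
-/

/-! ### Coordinates on the projective plane and morphisms to it -/

theorem eval₂_homogeneous {R : Type*} [CommRing R] {n : ℕ} {F : MvPolynomial (Fin 3) ℂ}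
    (hF : F.IsHomogeneous n) (σ : ℂ →+* R) (c : R) (v : Fin 3 → R) :
    F.eval₂ σ (fun l => c * v l) = c ^ n * F.eval₂ σ v := by
  rw [MvPolynomial.eval₂_eq', MvPolynomial.eval₂_eq', Finset.mul_sum]
  refine Finset.sum_congr rfl fun m hm => ?_
  have h := hF (MvPolynomial.mem_support_iff.1 hm)
  rw [show (Finsupp.weight 1) m = ∑ l, m l by simp [Finsupp.weight_apply, Finsupp.sum_fintype]] at h
  simp only [mul_pow, Finset.prod_mul_distrib, Finset.prod_pow_eq_pow_sum]
  rw [← h]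
  ring

theorem eval₂_multihomogeneous {R : Type*} [CommRing R] {k : ℕ} {d : Fin k → ℕ}
    {F : MvPolynomial (Fin k × Fin 3) ℂ} (hF : MvPolynomial.IsWeightedHomogeneous
      (fun v : Fin k × Fin 3 => (Pi.single v.1 1 : Fin k → ℕ)) F d)
    (σ : ℂ →+* R) (c : Fin k → R) (v : Fin k × Fin 3 → R) :
    F.eval₂ σ (fun x => c x.1 * v x) = (∏ a, c a ^ d a) * F.eval₂ σ v := by
  rw [MvPolynomial.eval₂_eq', MvPolynomial.eval₂_eq', Finset.mul_sum]
  refine Finset.sum_congr rfl fun m hm => ?_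
  have h := hF (MvPolynomial.mem_support_iff.1 hm)
  rw [Finsupp.weight_apply, Finsupp.sum_fintype _ _ (fun i => zero_smul ℕ (Pi.single i.1 1 : Fin k → ℕ))] at h
  have h1 : ∏ a, c a ^ d a = ∏ x : Fin k × Fin 3, c x.1 ^ m x := by
    rw [Fintype.prod_prod_type]
    refine Finset.prod_congr rfl fun a _ => ?_
    dsimp only
    rw [Finset.prod_pow_eq_pow_sum, ← h, Finset.sum_apply, Fintype.sum_prod_type,
      Finset.sum_eq_single a]
    · simp
    · intro b _ hb
      simp [Pi.single_eq_of_ne' hb]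
    · simp
  simp only [mul_pow, Finset.prod_mul_distrib]
  rw [h1]
  ring

theorem X_mem_grading (l : Fin 3) : (MvPolynomial.X l : MvPolynomial (Fin 3) ℂ) ∈ grading 1 :=
  MvPolynomial.isHomogeneous_X ℂ l

/-- The element `x_l / x_j` of the degree zero localization. -/
def awayCoord (j l : Fin 3) : HomogeneousLocalization.Away grading (MvPolynomial.X j) :=
  HomogeneousLocalization.Away.mk grading (X_mem_grading j) 1 (MvPolynomial.X l)
    (by simpa using X_mem_grading l)

theorem P2.coord_eq (j l : Fin 3) : P2.coord j l =
    (Proj.awayToSection grading (MvPolynomial.X j)).hom (awayCoord j l) := rfl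

theorem val_awayCoord (j l : Fin 3) : (awayCoord j l).val =
    IsLocalization.mk' (Localization.Away (MvPolynomial.X j : MvPolynomial (Fin 3) ℂ))
      (MvPolynomial.X l : MvPolynomial (Fin 3) ℂ) ⟨MvPolynomial.X j, Submonoid.mem_powers _⟩ := by
  rw [awayCoord, HomogeneousLocalization.Away.val_mk, Localization.mk_eq_mk']
  exact congrArg _ (Subtype.ext (pow_one (MvPolynomial.X j)))

theorem P2.coord_self (j : Fin 3) : P2.coord j j = 1 := by
  have : awayCoord j j = 1 := by
    apply HomogeneousLocalization.val_injective
    rw [val_awayCoord, HomogeneousLocalization.val_one]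
    exact IsLocalization.mk'_self _ _
  rw [P2.coord_eq, this]
  exact map_one _

theorem P2.coord_trans (j m l : Fin 3) :
    (P2.presheaf.map (homOfLE (inf_le_left : P2.chart j ⊓ P2.chart m ≤ _)).op).hom (P2.coord j l) =
    (P2.presheaf.map (homOfLE (inf_le_left : P2.chart j ⊓ P2.chart m ≤ _)).op).hom (P2.coord j m) *
    (P2.presheaf.map (homOfLE (inf_le_right : P2.chart j ⊓ P2.chart m ≤ _)).op).hom (P2.coord m l) := by
  apply Subtype.ext
  funext x
  apply HomogeneousLocalization.val_injective
  refine (ProjectiveSpectrum.Proj.awayToSection_apply grading _ (awayCoord j l) ⟨x.1, x.2.1⟩).trans ?_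
  refine Eq.trans ?_ (HomogeneousLocalization.val_mul _ _).symm
  refine Eq.trans ?_ (congrArg₂ (· * ·)
    (ProjectiveSpectrum.Proj.awayToSection_apply grading _ (awayCoord j m) ⟨x.1, x.2.1⟩).symm
    (ProjectiveSpectrum.Proj.awayToSection_apply grading _ (awayCoord m l) ⟨x.1, x.2.2⟩).symm)
  rw [val_awayCoord, val_awayCoord, val_awayCoord, IsLocalization.map_mk', IsLocalization.map_mk',
    IsLocalization.map_mk', ← IsLocalization.mk'_mul, IsLocalization.mk'_eq_iff_eq]
  simp only [RingHom.id_apply, Submonoid.coe_mul, map_mul]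
  ring

theorem P2.iSup_chart : ⨆ j, P2.chart j = ⊤ := by
  -- The criterion asks for algebra generators over the degree zero part; the variables generate
  -- already over `ℂ`.
  refine Proj.iSup_basicOpen_eq_top' grading (fun j => MvPolynomial.X j) (fun j => ⟨1, X_mem_grading j⟩) ?_
  rw [eq_top_iff]
  have := MvPolynomial.adjoin_range_X (R := ℂ) (σ := Fin 3)
  intro x _
  have hx : x ∈ Algebra.adjoin ℂ (Set.range (MvPolynomial.X : Fin 3 → MvPolynomial (Fin 3) ℂ)) := this ▸ trivial
  induction hx using Algebra.adjoin_induction with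
  | mem x hx => exact Algebra.subset_adjoin hx
  | algebraMap r => exact Subalgebra.algebraMap_mem _ (⟨MvPolynomial.C r, MvPolynomial.isHomogeneous_C _ r⟩ : grading 0)
  | add x y _ _ h1 h2 => exact add_mem (h1 trivial) (h2 trivial)
  | mul x y _ _ h1 h2 => exact mul_mem (h1 trivial) (h2 trivial)

theorem P2.isAffineOpen_chart (j : Fin 3) : IsAffineOpen (P2.chart j) :=
  Proj.isAffineOpen_basicOpen grading _ (X_mem_grading j) one_pos

/-- The inclusion of the complex numbers in the degree zero localization. -/
def awayScalars (j : Fin 3) : ℂ →+* HomogeneousLocalization.Away grading (MvPolynomial.X j) :=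
  (HomogeneousLocalization.fromZeroRingHom grading _).comp (algebraMap ℂ (grading 0))

theorem val_awayScalars (j : Fin 3) (r : ℂ) : (awayScalars j r).val =
    algebraMap _ (Localization.Away (MvPolynomial.X j : MvPolynomial (Fin 3) ℂ))
      (MvPolynomial.C r : MvPolynomial (Fin 3) ℂ) :=
  Localization.mk_one_eq_algebraMap _

/-- The functions on the standard chart. -/
def chartIso (j : Fin 3) : CommRingCat.of (HomogeneousLocalization.Away grading (MvPolynomial.X j)) ≅
    Γ(P2, P2.chart j) := Proj.basicOpenIsoAway grading _ (X_mem_grading j) one_pos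

theorem chartIso_awayCoord (j l) : (chartIso j).hom.hom (awayCoord j l) = P2.coord j l := rfl

theorem ofHom_scalars {T : Scheme.{0}} (s : T ⟶ SpecC) (U : T.Opens) :
    CommRingCat.ofHom (scalars s U) = (Scheme.ΓSpecIso (CommRingCat.of ℂ)).inv ≫ s.appTop ≫
      T.presheaf.map (homOfLE le_top).op := rfl

theorem ι_comp_eq {T : Scheme.{0}} (s : T ⟶ SpecC) (U : T.Opens) :
    U.ι ≫ s = U.toSpecΓ ≫ Spec.map (CommRingCat.ofHom (scalars s U)) := by
  rw [ofHom_scalars, Spec.map_comp, Spec.map_comp, Category.assoc,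
    Scheme.Opens.toSpecΓ_SpecMap_presheaf_map_top_assoc, ← Scheme.toSpecΓ_naturality_assoc]
  simp

/-- Global sections recover the ring homomorphism. Identities between ring homomorphisms into `Γ(T,
U)` can therefore be checked on morphisms of schemes. -/
theorem toSpecΓ_comp_injective {T : Scheme.{0}} (U : T.Opens) {R : CommRingCat.{0}}
    {a b : R ⟶ Γ(T, U)} (h : U.toSpecΓ ≫ Spec.map a = U.toSpecΓ ≫ Spec.map b) : a = b := by
  have := congrArg Scheme.Hom.appTop h
  rw [Scheme.Hom.comp_appTop, Scheme.Hom.comp_appTop, Scheme.Opens.toSpecΓ_appTop,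
    Scheme.ΓSpecIso_naturality_assoc, Scheme.ΓSpecIso_naturality_assoc,
    cancel_epi, cancel_mono] at this
  exact this

/-- Reconciles the two `ℂ`-algebra structures on the functions of a chart: through the structure
morphism and through the degree zero localization. -/
theorem scalars_chart (j : Fin 3) (r : ℂ) :
    scalars P2.str (P2.chart j) r = (chartIso j).hom.hom (awayScalars j r) := by
  have h : (P2.chart j).ι ≫ P2.str = (P2.chart j).toSpecΓ ≫ Spec.map
      (CommRingCat.ofHom (algebraMap ℂ (grading 0)) ≫ CommRingCat.ofHom
      (HomogeneousLocalization.fromZeroRingHom grading (Submonoid.powers (MvPolynomial.X j))) ≫ (chartIso j).hom) := by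
    have h1 : (P2.chart j).ι = (P2.chart j).toSpecΓ ≫ Spec.map (chartIso j).hom ≫
        Proj.awayι grading _ (X_mem_grading j) one_pos := by
      rw [← Proj.basicOpenIsoSpec_inv_ι, ← Category.assoc, ← Category.assoc]
      exact ((Iso.hom_inv_id_assoc (Proj.basicOpenIsoSpec grading _ (X_mem_grading j) one_pos) _)).symm
    rw [h1, Spec.map_comp, Spec.map_comp, ← Proj.awayι_toSpecZero grading _ (X_mem_grading j) one_pos]
    simp only [Category.assoc]
    rfl
  rw [ι_comp_eq] at h
  exact congrArg (fun f => f.hom r) (toSpecΓ_comp_injective _ h)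

/-- The regular function `x_l / x_j` pulled back along `q`. -/
def co {T : Scheme.{0}} (q : T ⟶ P2) (j : Fin 3) (U : T.Opens) (h : U ≤ q ⁻¹ᵁ P2.chart j)
    (l : Fin 3) : Γ(T, U) := (q.appLE (P2.chart j) U h).hom (P2.coord j l)

section co
variable {T T' : Scheme.{0}} (f : T' ⟶ T) (s : T ⟶ SpecC) (q : T ⟶ P2)

theorem coordinate_eq_co {k : ℕ} (q : Fin k → (T ⟶ P2)) (j : Fin k → Fin 3) (a : Fin k) (l : Fin 3) :
    coordinate q j a l = co (q a) (j a) (chart q j) (chart_le q j a) l := rfl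

theorem map_co {j : Fin 3} {U V : T.Opens} (h : U ≤ q ⁻¹ᵁ P2.chart j) (e : V ≤ U) (l : Fin 3) :
    (T.presheaf.map (homOfLE e).op).hom (co q j U h l) = co q j V (e.trans h) l :=
  congrArg (fun g => g.hom (P2.coord j l)) (Scheme.Hom.appLE_map q h (homOfLE e).op)

theorem appLE_co {j : Fin 3} {U : T.Opens} {V : T'.Opens} (h : U ≤ q ⁻¹ᵁ P2.chart j)
    (e : V ≤ f ⁻¹ᵁ U) (l : Fin 3) : (f.appLE U V e).hom (co q j U h l) =
      co (f ≫ q) j V (e.trans (f.preimage_mono h)) l :=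
  congrArg (fun g => g.hom (P2.coord j l)) (Scheme.Hom.appLE_comp_appLE f q _ _ _ h e)

theorem co_self {j : Fin 3} {U : T.Opens} (h : U ≤ q ⁻¹ᵁ P2.chart j) : co q j U h j = 1 := by
  rw [co, P2.coord_self]
  exact map_one _

theorem co_trans {j m : Fin 3} {U : T.Opens} (h : U ≤ q ⁻¹ᵁ P2.chart j)
    (h' : U ≤ q ⁻¹ᵁ P2.chart m) (l : Fin 3) :
    co q j U h l = co q j U h m * co q m U h' l := by
  have e : U ≤ q ⁻¹ᵁ (P2.chart j ⊓ P2.chart m) := le_inf h h'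
  have := congrArg (q.appLE _ U e).hom (P2.coord_trans j m l)
  rw [map_mul] at this
  simp only [← CommRingCat.comp_apply, Scheme.Hom.map_appLE] at this
  exact this

theorem map_scalars {U V : T.Opens} (e : V ≤ U) (r : ℂ) :
    (T.presheaf.map (homOfLE e).op).hom (scalars s U r) = scalars s V r :=
  congrArg (fun g => g.hom ((Scheme.ΓSpecIso (CommRingCat.of ℂ)).inv.hom r))
    (Scheme.Hom.appLE_map s le_top (homOfLE e).op)

theorem appLE_scalars {U : T.Opens} {V : T'.Opens} (e : V ≤ f ⁻¹ᵁ U) (r : ℂ) :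
    (f.appLE U V e).hom (scalars s U r) = scalars (f ≫ s) V r :=
  congrArg (fun g => g.hom ((Scheme.ΓSpecIso (CommRingCat.of ℂ)).inv.hom r))
    (Scheme.Hom.appLE_comp_appLE f s ⊤ U V le_top e)

/-- A morphism landing in an affine open subset is determined by its action on functions. -/
theorem eq_of_appLE_eq {X : Scheme.{0}} {V : X.Opens} (hV : IsAffineOpen V) {g g' : T ⟶ X}
    (h : ⊤ ≤ g ⁻¹ᵁ V) (h' : ⊤ ≤ g' ⁻¹ᵁ V) (e : g.appLE V ⊤ h = g'.appLE V ⊤ h') : g = g' := by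
  have key : ∀ (g : T ⟶ X) (h : ⊤ ≤ g ⁻¹ᵁ V),
      (⊤ : T.Opens).ι ≫ g = (⊤ : T.Opens).toSpecΓ ≫ Spec.map (g.appLE V ⊤ h) ≫ hV.fromSpec := by
    intro g h
    rw [Scheme.Opens.toSpecΓ_SpecMap_appLE_assoc, IsAffineOpen.toSpecΓ_fromSpec,
      Scheme.Hom.resLE_comp_ι]
  rw [← cancel_epi T.topIso.hom, Scheme.topIso_hom, key g h, key g' h', e]

/-- A ring homomorphism from the functions on an affine open subset defines a morphism. -/
theorem exists_hom_of_ringHom {X : Scheme.{0}} {V : X.Opens} (hV : IsAffineOpen V)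
    (φ : Γ(X, V) ⟶ Γ(T, ⊤)) : ∃ (g : T ⟶ X) (h : ⊤ ≤ g ⁻¹ᵁ V), g.appLE V ⊤ h = φ := by
  have h : ⊤ ≤ (T.toSpecΓ ≫ Spec.map φ ≫ hV.fromSpec) ⁻¹ᵁ V := by
    intro t _
    have : hV.fromSpec (Spec.map φ (T.toSpecΓ t)) ∈ Set.range hV.fromSpec := ⟨_, rfl⟩
    rwa [hV.range_fromSpec] at this
  refine ⟨_, h, ?_⟩
  apply toSpecΓ_comp_injective
  rw [← cancel_mono hV.fromSpec, Category.assoc, Scheme.Opens.toSpecΓ_SpecMap_appLE_assoc,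
    IsAffineOpen.toSpecΓ_fromSpec, Scheme.Hom.resLE_comp_ι, Scheme.Opens.toSpecΓ_top]
  simp

theorem str_eq_of_scalars {s s' : T ⟶ SpecC} (h : ∀ r, scalars s ⊤ r = scalars s' ⊤ r) : s = s' := by
  rw [← cancel_epi T.topIso.hom, Scheme.topIso_hom, ι_comp_eq, ι_comp_eq, show scalars s ⊤ = scalars s' ⊤ from
    RingHom.ext h]

theorem P2.ringHom_ext {j : Fin 3} {R : CommRingCat.{0}} {φ ψ : Γ(P2, P2.chart j) ⟶ R}
    (h : ∀ r, φ.hom (scalars P2.str _ r) = ψ.hom (scalars P2.str _ r))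
    (h' : ∀ l, φ.hom (P2.coord j l) = ψ.hom (P2.coord j l)) : φ = ψ := by
  rw [← cancel_epi (chartIso j).hom]
  ext x
  obtain ⟨n, F, hF, rfl⟩ := HomogeneousLocalization.Away.mk_surjective grading (X_mem_grading j) x
  have hsc : ∀ r, (chartIso j).hom.hom (awayScalars j r) = scalars P2.str _ r :=
    fun r => (scalars_chart j r).symm
  -- By homogeneity `F / X_j ^ n` is the value of `F` at the fractions `x_l / x_j`, so constants and
  -- coordinates generate.
  have key : HomogeneousLocalization.Away.mk grading (X_mem_grading j) n F hF =
      MvPolynomial.eval₂ (awayScalars j) (awayCoord j) F := by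
    apply HomogeneousLocalization.val_injective
    refine Eq.trans ?_ (MvPolynomial.hom_eval₂ F (awayScalars j) (algebraMap _ (Localization.Away
      (MvPolynomial.X j : MvPolynomial (Fin 3) ℂ))) (awayCoord j)).symm
    rw [HomogeneousLocalization.Away.val_mk, Localization.mk_eq_mk', IsLocalization.mk'_eq_iff_eq_mul]
    have h1 := eval₂_homogeneous (n := n) (F := F) (by simpa using hF)
      ((algebraMap (MvPolynomial (Fin 3) ℂ) (Localization.Away
      (MvPolynomial.X j : MvPolynomial (Fin 3) ℂ))).comp MvPolynomial.C)
      (algebraMap _ _ (MvPolynomial.X j : MvPolynomial (Fin 3) ℂ)) (fun l => (awayCoord j l).val)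
    have h2 : (fun l => (algebraMap _ (Localization.Away (MvPolynomial.X j : MvPolynomial (Fin 3) ℂ)))
        (MvPolynomial.X j : MvPolynomial (Fin 3) ℂ) * (awayCoord j l).val) =
        fun l => algebraMap _ _ (MvPolynomial.X l : MvPolynomial (Fin 3) ℂ) := by
      funext l
      rw [val_awayCoord, mul_comm]
      exact IsLocalization.mk'_spec _ _ _
    have h3 : (algebraMap _ (Localization.Away (MvPolynomial.X j : MvPolynomial (Fin 3) ℂ))).comp
        (awayScalars j) = (algebraMap (MvPolynomial (Fin 3) ℂ) (Localization.Away
      (MvPolynomial.X j : MvPolynomial (Fin 3) ℂ))).comp MvPolynomial.C :=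
      RingHom.ext (val_awayScalars j)
    have h4 := MvPolynomial.eval₂_comp_left (algebraMap (MvPolynomial (Fin 3) ℂ) (Localization.Away
      (MvPolynomial.X j : MvPolynomial (Fin 3) ℂ))) MvPolynomial.C MvPolynomial.X F
    rw [MvPolynomial.eval₂_eta] at h4
    rw [h3, h4, map_pow, mul_comm]
    rw [h2] at h1
    exact h1
  rw [key]
  have e1 : ∀ (φ : Γ(P2, P2.chart j) ⟶ R), ((chartIso j).hom ≫ φ).hom (MvPolynomial.eval₂ (awayScalars j) (awayCoord j) F) =
      MvPolynomial.eval₂ (φ.hom.comp (scalars P2.str _)) (fun l => φ.hom (P2.coord j l)) F := by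
    intro φ
    rw [MvPolynomial.hom_eval₂]
    congr 1
    ext r
    exact congrArg φ.hom (hsc r)
  rw [e1, e1, funext h', show φ.hom.comp (scalars P2.str _) = ψ.hom.comp (scalars P2.str _) from RingHom.ext h]

theorem P2.exists_ringHom {j : Fin 3} {R : CommRingCat.{0}} (σ : ℂ →+* R) (v : Fin 3 → R)
    (hv : v j = 1) : ∃ φ : Γ(P2, P2.chart j) ⟶ R, (∀ r, φ.hom (scalars P2.str _ r) = σ r) ∧
      ∀ l, φ.hom (P2.coord j l) = v l := by
  have hu : IsUnit (MvPolynomial.eval₂Hom σ v (MvPolynomial.X j)) := by simp [hv]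
  obtain ⟨ψ, hψ⟩ : ∃ ψ : Localization.Away (MvPolynomial.X j : MvPolynomial (Fin 3) ℂ) →+* R,
      ∀ F, ψ (algebraMap _ _ F) = MvPolynomial.eval₂Hom σ v F :=
    ⟨IsLocalization.Away.lift (MvPolynomial.X j) hu, IsLocalization.Away.lift_eq _ hu⟩
  have hinv : ∀ x, (chartIso j).inv.hom ((chartIso j).hom.hom x) = x := fun x => by
    rw [← CommRingCat.comp_apply, Iso.hom_inv_id, CommRingCat.id_apply]
  refine ⟨(chartIso j).inv ≫ CommRingCat.ofHom (ψ.comp (algebraMap _ _)), fun r => ?_, fun l => ?_⟩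
  · rw [scalars_chart]
    refine (congrArg (fun z => ψ z.val) (hinv _)).trans ?_
    simp only [val_awayScalars]
    rw [hψ, MvPolynomial.eval₂Hom_C]
  · rw [← chartIso_awayCoord]
    refine (congrArg (fun z => ψ z.val) (hinv _)).trans ?_
    have h1 := IsLocalization.mk'_spec (Localization.Away (MvPolynomial.X j : MvPolynomial (Fin 3) ℂ))
      (MvPolynomial.X l : MvPolynomial (Fin 3) ℂ)
      (⟨MvPolynomial.X j, Submonoid.mem_powers _⟩ : Submonoid.powers _)
    have h2 := congrArg ψ h1
    rw [map_mul, hψ, hψ, MvPolynomial.eval₂Hom_X', MvPolynomial.eval₂Hom_X', hv, mul_one] at h2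
    simp only [val_awayCoord]
    exact h2

theorem exists_hom_P2 (j : Fin 3) (v : Fin 3 → Γ(T, ⊤)) (hv : v j = 1) :
    ∃ (q : T ⟶ P2) (h : ⊤ ≤ q ⁻¹ᵁ P2.chart j), q ≫ P2.str = s ∧ ∀ l, co q j ⊤ h l = v l := by
  obtain ⟨φ, h1, h2⟩ := P2.exists_ringHom (scalars s ⊤) v hv
  obtain ⟨q, h, hq⟩ := exists_hom_of_ringHom (P2.isAffineOpen_chart j) φ
  refine ⟨q, h, str_eq_of_scalars fun r => ?_, fun l => ?_⟩
  · rw [← appLE_scalars q P2.str h, hq]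
    exact h1 r
  · rw [co, hq]
    exact h2 l

theorem hom_P2_ext {q q' : T ⟶ P2} (hs : q ≫ P2.str = q' ≫ P2.str) (j : Fin 3)
    (h : ⊤ ≤ q ⁻¹ᵁ P2.chart j) (h' : ⊤ ≤ q' ⁻¹ᵁ P2.chart j)
    (e : ∀ l, co q j ⊤ h l = co q' j ⊤ h' l) : q = q' := by
  refine eq_of_appLE_eq (P2.isAffineOpen_chart j) h h' (P2.ringHom_ext (fun r => ?_) e)
  rw [appLE_scalars, appLE_scalars, hs]

/-- If `x_m / x_j` is a unit in the local ring, then `X m` lies outside the homogeneous prime of the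
point. Conversely, on the overlap of the charts `x_j / x_m` is an inverse. -/
theorem P2.chart_inf (j m : Fin 3) : P2.basicOpen (P2.coord j m) = P2.chart j ⊓ P2.chart m := by
  ext x
  refine ⟨fun hx => ⟨P2.basicOpen_le _ hx, ?_⟩, fun hx => ?_⟩
  · have hj : x ∈ P2.chart j := P2.basicOpen_le _ hx
    have : x.asHomogeneousIdeal.toIdeal.IsPrime := x.isPrime
    have h1 := (P2.mem_basicOpen (P2.coord j m) x hj).1 hx
    have h2 := (h1.map (Proj.stalkIso' grading x).toRingHom).map
      (algebraMap _ (Localization x.asHomogeneousIdeal.toIdeal.primeCompl))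
    have h3 := Proj.stalkIso'_germ grading (P2.chart j) x hj (P2.coord j m)
    have h4 := ProjectiveSpectrum.Proj.awayToSection_apply grading _ (awayCoord j m) ⟨x, hj⟩
    rw [val_awayCoord, IsLocalization.map_mk'] at h4
    have h5 : IsUnit (IsLocalization.mk' (Localization x.asHomogeneousIdeal.toIdeal.primeCompl)
      (MvPolynomial.X m : MvPolynomial (Fin 3) ℂ) (⟨MvPolynomial.X j, hj⟩ : x.asHomogeneousIdeal.toIdeal.primeCompl)) := by
      refine h4 ▸ ?_
      refine (congrArg (fun z => IsUnit (HomogeneousLocalization.val z)) h3).mp ?_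
      exact h2
    exact (IsLocalization.AtPrime.isUnit_mk'_iff _ x.asHomogeneousIdeal.toIdeal _ _).1 h5
  · have h := P2.coord_trans j m j
    rw [P2.coord_self, map_one] at h
    have h1 : IsUnit ((P2.presheaf.map (homOfLE (inf_le_left : P2.chart j ⊓ P2.chart m ≤ _)).op).hom
      (P2.coord j m)) := IsUnit.of_mul_eq_one _ h.symm
    have h2 := P2.basicOpen_of_isUnit h1
    rw [Scheme.basicOpen_res] at h2
    exact (h2.ge hx).2

theorem basicOpen_co {j : Fin 3} {U : T.Opens} (h : U ≤ q ⁻¹ᵁ P2.chart j) (m : Fin 3) :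
    T.basicOpen (co q j U h m) = U ⊓ q ⁻¹ᵁ P2.chart m := by
  have : co q j U h m = (T.presheaf.map (homOfLE h).op).hom ((q.app (P2.chart j)).hom (P2.coord j m)) := rfl
  rw [this, Scheme.basicOpen_res, ← Scheme.preimage_basicOpen, P2.chart_inf]
  ext x
  exact ⟨fun hx => ⟨hx.1, hx.2.2⟩, fun hx => ⟨hx.1, h hx.1, hx.2⟩⟩
end co

/-! ### Products of projective planes and their affine charts -/

/-- `T` with the maps `q a` is a product of projective planes over the complex numbers. -/
structure IsProd {T : Scheme.{0}} {k : ℕ} (s : T ⟶ SpecC) (q : Fin k → (T ⟶ P2)) : Prop where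
  comp_str : ∀ a, q a ≫ P2.str = s
  exists_lift : ∀ {T' : Scheme.{0}} (s' : T' ⟶ SpecC) (q' : Fin k → (T' ⟶ P2)),
    (∀ a, q' a ≫ P2.str = s') → ∃ m : T' ⟶ T, m ≫ s = s' ∧ ∀ a, m ≫ q a = q' a
  hom_ext : ∀ {T' : Scheme.{0}} (m m' : T' ⟶ T), (∀ a, m ≫ q a = m' ≫ q a) → m = m'

theorem isProd_P2xP2 : IsProd P2xP2.str P2xP2.proj where
  comp_str a := by
    fin_cases a
    · rfl
    · exact pullback.condition.symm
  exists_lift s' q' h := ⟨pullback.lift (q' 0) (q' 1) ((h 0).trans (h 1).symm), by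
    rw [P2xP2.str, pullback.lift_fst_assoc, h], fun a => by
    fin_cases a
    · exact pullback.lift_fst _ _ _
    · exact pullback.lift_snd _ _ _⟩
  hom_ext m m' h := pullback.hom_ext (h 0) (h 1)

theorem isProd_P2xP2xP2 : IsProd P2xP2xP2.str P2xP2xP2.proj where
  comp_str a := by
    fin_cases a
    · exact (Category.assoc _ _ _)
    · refine (Category.assoc _ _ _).trans ?_
      exact congrArg (fun f => pullback.fst P2xP2.str P2.str ≫ f) (isProd_P2xP2.comp_str 1)
    · exact pullback.condition.symm
  exists_lift s' q' h := by
    obtain ⟨m, h1, h2⟩ := isProd_P2xP2.exists_lift s' ![q' 0, q' 1] (fun a => by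
      fin_cases a
      · exact h 0
      · exact h 1)
    refine ⟨pullback.lift m (q' 2) (h1.trans (h 2).symm), ?_, fun a => ?_⟩
    · rw [P2xP2xP2.str, pullback.lift_fst_assoc, h1]
    · fin_cases a
      · exact (pullback.lift_fst_assoc _ _ _ _).trans (h2 0)
      · exact (pullback.lift_fst_assoc _ _ _ _).trans (h2 1)
      · exact pullback.lift_snd _ _ _
  hom_ext m m' h := by
    refine pullback.hom_ext (isProd_P2xP2.hom_ext _ _ fun a => ?_) (h 2)
    fin_cases a
    · simpa [P2xP2xP2.proj] using h 0
    · simpa [P2xP2xP2.proj] using h 1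

/-- The polynomial ring in the affine coordinates of the chart `j`. -/
abbrev ChartRing {k : ℕ} (j : Fin k → Fin 3) : Type :=
  MvPolynomial {v : Fin k × Fin 3 // v.2 ≠ j v.1} ℂ

/-- The affine coordinates of the chart `j`. -/
def chartVar {k : ℕ} (j : Fin k → Fin 3) (a : Fin k) (l : Fin 3) : ChartRing j :=
  if h : l = j a then 1 else MvPolynomial.X ⟨(a, l), h⟩

theorem chartVar_self {k : ℕ} (j : Fin k → Fin 3) (a : Fin k) : chartVar j a (j a) = 1 :=
  dif_pos rfl

theorem chartVar_ne {k : ℕ} (j : Fin k → Fin 3) (v : {v : Fin k × Fin 3 // v.2 ≠ j v.1}) :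
    chartVar j v.1.1 v.1.2 = MvPolynomial.X v :=
  dif_neg v.2

section
variable {T : Scheme.{0}} {k : ℕ} {s : T ⟶ SpecC} {q : Fin k → (T ⟶ P2)}

theorem coordinate_self (q : Fin k → (T ⟶ P2)) (j : Fin k → Fin 3) (a : Fin k) :
    coordinate q j a (j a) = 1 := co_self _ _

variable (s q) in
/-- Evaluation of polynomials in the affine coordinates of a chart. -/
def chartEval (j : Fin k → Fin 3) : ChartRing j →+* Γ(T, chart q j) :=
  MvPolynomial.eval₂Hom (scalars s (chart q j)) (fun v => coordinate q j v.1.1 v.1.2)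

theorem chartEval_C (j : Fin k → Fin 3) (r : ℂ) :
    chartEval s q j (MvPolynomial.C r) = scalars s (chart q j) r := MvPolynomial.eval₂Hom_C _ _ _

theorem chartEval_chartVar (j : Fin k → Fin 3) (a : Fin k) (l : Fin 3) :
    chartEval s q j (chartVar j a l) = coordinate q j a l := by
  by_cases h : l = j a
  · subst h
    rw [chartVar_self, coordinate_self, map_one]
  · rw [chartVar, dif_neg h]
    exact MvPolynomial.eval₂Hom_X' _ _ _

theorem mem_chart {j : Fin k → Fin 3} {t : T} : t ∈ chart q j ↔ ∀ a, q a t ∈ P2.chart (j a) := by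
  rw [chart, ← SetLike.mem_coe, TopologicalSpace.Opens.coe_iInf, Set.mem_iInter]
  exact Iff.rfl

theorem le_chart {T' : Scheme.{0}} {f : T' ⟶ T} {U : T'.Opens} {j : Fin k → Fin 3}
    (h : ∀ a, U ≤ (f ≫ q a) ⁻¹ᵁ P2.chart (j a)) : U ≤ f ⁻¹ᵁ chart q j :=
  fun _ ht => mem_chart.2 fun a => h a ht

theorem scalars_SpecMap {S : CommRingCat.{0}} (φ : CommRingCat.of ℂ ⟶ S) (r : ℂ) :
    scalars (Spec.map φ) ⊤ r = (Scheme.ΓSpecIso S).inv.hom (φ.hom r) := by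
  have h := ι_comp_eq (Spec.map φ) ⊤
  have h2 : (⊤ : (Spec S).Opens).ι ≫ Spec.map φ =
      (⊤ : (Spec S).Opens).toSpecΓ ≫ Spec.map (φ ≫ (Scheme.ΓSpecIso S).inv) := by
    rw [Spec.map_comp, Scheme.Opens.toSpecΓ_top]
    simp
  rw [h2] at h
  exact (congrArg (fun g => g.hom r) (toSpecΓ_comp_injective _ h)).symm

theorem appTop_toSpecΓ_comp {X : Scheme.{0}} (U : X.Opens) {R : CommRingCat.{0}} (ψ : R ⟶ Γ(X, U)) :
    (U.toSpecΓ ≫ Spec.map ψ).appTop = (Scheme.ΓSpecIso R).hom ≫ ψ ≫ U.topIso.inv := by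
  rw [Scheme.Hom.comp_appTop, Scheme.Opens.toSpecΓ_appTop, Scheme.ΓSpecIso_naturality_assoc]

/-- The chart and the affine space with ring `ChartRing j` have the same points: tuples of points
whose `j a`-th coordinates can be normalized to 1. The universal property gives `m` from affine
space to the product, evaluation of the coordinates gives `u` from the chart to affine space, and
these are inverse to each other. -/
theorem IsProd.chartEval_aux (hq : IsProd s q) (j : Fin k → Fin 3) :
    IsAffineOpen (chart q j) ∧ IsIso (CommRingCat.ofHom (chartEval s q j)) := by
  set S := CommRingCat.of (ChartRing j)
  set s' : Spec S ⟶ SpecC := Spec.map (CommRingCat.ofHom MvPolynomial.C) with hs'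
  have key : ∀ a, ∃ (q' : Spec S ⟶ P2) (h : ⊤ ≤ q' ⁻¹ᵁ P2.chart (j a)), q' ≫ P2.str = s' ∧
      ∀ l, co q' (j a) ⊤ h l = (Scheme.ΓSpecIso S).inv.hom (chartVar j a l) := fun a =>
    exists_hom_P2 s' (j a) _ (by rw [chartVar_self, map_one])
  choose q' h1 h2 h3 using key
  obtain ⟨m, hm1, hm2⟩ := hq.exists_lift s' q' h2
  have hm : ⊤ ≤ m ⁻¹ᵁ chart q j := le_chart fun a => by rw [hm2]; exact h1 a
  have hs : ∀ r, scalars s' ⊤ r = (Scheme.ΓSpecIso S).inv.hom (MvPolynomial.C r) := by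
    exact scalars_SpecMap _
  have hco : ∀ a l, (m.appLE _ ⊤ hm).hom (coordinate q j a l) =
      (Scheme.ΓSpecIso S).inv.hom (chartVar j a l) := by
    intro a l
    rw [coordinate_eq_co, appLE_co, ← h3]
    congr 1
    exact hm2 a
  have hψ : CommRingCat.ofHom (chartEval s q j) ≫ m.appLE _ ⊤ hm = (Scheme.ΓSpecIso S).inv := by
    refine CommRingCat.hom_ext (MvPolynomial.ringHom_ext (fun r => ?_) fun v => ?_)
    · rw [← hs, ← hm1]
      refine Eq.trans ?_ (appLE_scalars m s hm r)
      exact congrArg (m.appLE _ ⊤ hm).hom (chartEval_C j r)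
    · rw [← chartVar_ne j v, ← hco]
      exact congrArg (m.appLE _ ⊤ hm).hom (chartEval_chartVar j _ _)
  obtain ⟨u, hu⟩ : ∃ u : (chart q j).toScheme ⟶ Spec S,
    u = (chart q j).toSpecΓ ≫ Spec.map (CommRingCat.ofHom (chartEval s q j)) := ⟨_, rfl⟩
  have hum : u ≫ m = (chart q j).ι := by
    have hus : u ≫ s' = (chart q j).ι ≫ s := by
      rw [ι_comp_eq, hu, hs', Category.assoc, ← Spec.map_comp]
      congr 2
      exact CommRingCat.hom_ext (RingHom.ext (chartEval_C j))
    refine hq.hom_ext _ _ fun a => ?_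
    have e : ∀ l, u.appTop.hom ((Scheme.ΓSpecIso S).inv.hom (chartVar j a l)) =
        (chart q j).topIso.inv.hom (coordinate q j a l) := by
      intro l
      rw [← chartEval_chartVar (s := s), ← CommRingCat.comp_apply]
      have := appTop_toSpecΓ_comp (chart q j) (CommRingCat.ofHom (chartEval s q j))
      rw [← hu, ← Iso.inv_comp_eq] at this
      exact congrArg (fun g => g.hom (chartVar j a l)) this
    have hU : ⊤ ≤ (chart q j).ι ⁻¹ᵁ chart q j := by simp
    have e1 : (chart q j).ι.appLE (chart q j) ⊤ hU = (chart q j).topIso.inv := by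
      rw [Scheme.Opens.ι_appLE]
      rfl
    refine hom_P2_ext ?_ (j a) (fun t _ => ?_) (fun t _ => ?_) (fun l => ?_)
    · rw [Category.assoc, Category.assoc, Category.assoc, hq.comp_str, hm1, hus]
    · rw [Category.assoc, hm2]
      exact h1 a (x := u t) trivial
    · exact mem_chart.1 t.2 a
    · have e2 := e l
      rw [← h3, ← e1, coordinate_eq_co, appLE_co] at e2
      have e3 : u.appTop = u.appLE ⊤ ⊤ le_top := Scheme.Hom.app_eq_appLE _
      rw [← e2, e3]
      refine Eq.trans ?_ (appLE_co u (q' a) (h1 a) _ l).symm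
      congr 1
      rw [Category.assoc, hm2]
  have hm' : m.resLE _ ⊤ hm ≫ u = (⊤ : (Spec S).Opens).ι := by
    rw [hu, ← Scheme.Opens.toSpecΓ_SpecMap_appLE_assoc, ← Spec.map_comp, hψ, Scheme.Opens.toSpecΓ_top]
    simp
  have hiso : IsIso u := by
    refine ⟨(Spec S).topIso.inv ≫ m.resLE _ ⊤ hm, ?_, ?_⟩
    · rw [← cancel_mono (chart q j).ι]
      rw [Category.assoc, Category.assoc, Scheme.Hom.resLE_comp_ι, ← Scheme.topIso_hom,
        Iso.inv_hom_id_assoc, hum, Category.id_comp]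
    · rw [Category.assoc, hm', ← Scheme.topIso_hom, Iso.inv_hom_id]
  refine ⟨IsAffine.of_isIso u, ?_⟩
  have := appTop_toSpecΓ_comp (chart q j) (CommRingCat.ofHom (chartEval s q j))
  rw [← hu, ← Iso.inv_comp_eq, Iso.eq_comp_inv] at this
  rw [← this]
  have : IsIso u.appTop := inferInstanceAs (IsIso (u.app ⊤))
  exact @IsIso.comp_isIso _ _ _ _ _ _ _ (@IsIso.comp_isIso _ _ _ _ _ _ _ inferInstance
    inferInstance) inferInstance

theorem IsProd.isAffineOpen_chart (hq : IsProd s q) (j : Fin k → Fin 3) :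
    IsAffineOpen (chart q j) := (hq.chartEval_aux j).1

theorem IsProd.chartEval_bijective (hq : IsProd s q) (j : Fin k → Fin 3) :
    Function.Bijective (chartEval s q j) := by
  have := (hq.chartEval_aux j).2
  exact (ConcreteCategory.isIso_iff_bijective (CommRingCat.ofHom (chartEval s q j))).1 this

theorem IsProd.isDomain (hq : IsProd s q) (j : Fin k → Fin 3) : IsDomain Γ(T, chart q j) :=
  (RingEquiv.ofBijective _ (hq.chartEval_bijective j)).symm.toMulEquiv.isDomain _

theorem IsProd.exists_ringHom (hq : IsProd s q) (j : Fin k → Fin 3) {R : Type*} [CommRing R]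
    (σ : ℂ →+* R) (v : Fin k → Fin 3 → R) (hv : ∀ a, v a (j a) = 1) :
    ∃ φ : Γ(T, chart q j) →+* R, (∀ r, φ (scalars s _ r) = σ r) ∧
      ∀ a l, φ (coordinate q j a l) = v a l := by
  let e := RingEquiv.ofBijective _ (hq.chartEval_bijective j)
  have he : ∀ x, e.symm (chartEval s q j x) = x := e.symm_apply_apply
  refine ⟨(MvPolynomial.eval₂Hom σ (fun x => v x.1.1 x.1.2)).comp e.symm.toRingHom,
    fun r => ?_, fun a l => ?_⟩
  · rw [← chartEval_C (q := q)]
    refine (congrArg (MvPolynomial.eval₂Hom σ fun x => v x.1.1 x.1.2) (he _)).trans (MvPolynomial.eval₂Hom_C _ _ _)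
  · rw [← chartEval_chartVar (s := s)]
    refine (congrArg (MvPolynomial.eval₂Hom σ fun x => v x.1.1 x.1.2) (he _)).trans ?_
    by_cases h : l = j a
    · rw [h, chartVar_self, map_one, hv]
    · rw [chartVar, dif_neg h, MvPolynomial.eval₂Hom_X']

theorem map_dehomogenize {R : Type*} [CommRing R] (j : Fin k → Fin 3) (φ : Γ(T, chart q j) →+* R)
    (F : MvPolynomial (Fin k × Fin 3) ℂ) : φ (dehomogenize s q F j) =
      F.eval₂ (φ.comp (scalars s _)) (fun v => φ (coordinate q j v.1 v.2)) :=
  MvPolynomial.hom_eval₂ _ _ _ _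

theorem IsProd.dehomogenize_surjective (hq : IsProd s q) (j : Fin k → Fin 3)
    (g : Γ(T, chart q j)) : ∃ F, dehomogenize s q F j = g := by
  obtain ⟨G, rfl⟩ := (hq.chartEval_bijective j).2 g
  refine ⟨MvPolynomial.rename Subtype.val G, ?_⟩
  rw [dehomogenize, MvPolynomial.eval₂_rename]
  rfl
end

/-! ### Inverse images of ideal sheaves and effective Cartier divisors -/

section IdealSheaf
variable {X Y : Scheme.{0}}

/-- Both inclusions come from the adjunction between `map` and `comap`, tested against the ideal
sheaf of the extended ideal. -/
theorem ideal_comap_top [IsAffine X] [IsAffine Y] (I : Y.IdealSheafData) (f : X ⟶ Y) :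
    (I.comap f).ideal ⟨⊤, isAffineOpen_top X⟩ =
      (I.ideal ⟨⊤, isAffineOpen_top Y⟩).map f.appTop.hom := by
  apply le_antisymm
  · have h : I.comap f ≤ Scheme.IdealSheafData.equivOfIsAffine.symm
        ((I.ideal ⟨⊤, isAffineOpen_top Y⟩).map f.appTop.hom) := by
      rw [← Scheme.IdealSheafData.le_map_iff_comap_le]
      refine Scheme.IdealSheafData.le_of_isAffine ?_
      rw [Scheme.IdealSheafData.ideal_map_of_isAffineHom]
      refine Ideal.le_comap_map.trans (Ideal.comap_mono ?_)
      exact (Scheme.IdealSheafData.equivOfIsAffine.apply_symm_apply _).ge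
    refine (h ⟨⊤, isAffineOpen_top X⟩).trans ?_
    exact (Scheme.IdealSheafData.equivOfIsAffine.apply_symm_apply _).le
  · rw [Ideal.map_le_iff_le_comap]
    have h := Scheme.IdealSheafData.le_map_comap I f ⟨⊤, isAffineOpen_top Y⟩
    rw [Scheme.IdealSheafData.ideal_map_of_isAffineHom] at h
    exact h

theorem ideal_comap_isOpenImmersion (I : Y.IdealSheafData) (f : X ⟶ Y) [IsOpenImmersion f]
    {U : X.Opens} (hU : IsAffineOpen U) (V : Y.affineOpens) (h : U ≤ f ⁻¹ᵁ V.1) :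
    (I.comap f).ideal ⟨U, hU⟩ = (I.ideal V).map (f.appLE V.1 U h).hom := by
  have hle : f ''ᵁ U ≤ V.1 := by
    rintro _ ⟨x, hx, rfl⟩
    exact h hx
  rw [Scheme.IdealSheafData.ideal_comap_of_isOpenImmersion]
  rw [← Scheme.IdealSheafData.map_ideal I (U := ⟨f ''ᵁ U, hU.image_of_isOpenImmersion f⟩) (V := V) hle]
  have h1 : ∀ K : Ideal Γ(Y, f ''ᵁ U), K.comap (f.appIso U).inv.hom =
      K.map (f.appIso U).hom.hom := fun K =>
    (Ideal.map_comap_of_equiv (I := K) (f.appIso U).commRingCatIsoToRingEquiv).symm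
  rw [h1, Ideal.map_map, ← CommRingCat.hom_comp, Scheme.Hom.appIso_hom', Scheme.Hom.map_appLE]

theorem appLE_comp_appTop {Z : Scheme.{0}} (f : X ⟶ Y) (g : Y ⟶ Z) (V : Z.Opens)
    (h : ⊤ ≤ g ⁻¹ᵁ V) (h' : ⊤ ≤ (f ≫ g) ⁻¹ᵁ V) :
    g.appLE V ⊤ h ≫ f.appTop = (f ≫ g).appLE V ⊤ h' := by
  have e : f.appTop = f.appLE ⊤ ⊤ le_top := Scheme.Hom.app_eq_appLE _
  rw [e]
  exact Scheme.Hom.appLE_comp_appLE f g V ⊤ ⊤ h le_top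

theorem ideal_map_map_eq {A B B' D : CommRingCat.{0}} {f : A ⟶ B} {g : B ⟶ D} {f' : A ⟶ B'}
    {g' : B' ⟶ D} (h : f ≫ g = f' ≫ g') (K : Ideal A) :
    (K.map f.hom).map g.hom = (K.map f'.hom).map g'.hom := by
  rw [Ideal.map_map, Ideal.map_map, ← CommRingCat.hom_comp, h, CommRingCat.hom_comp]

theorem resLE_appTop (f : X ⟶ Y) {U : X.Opens} {V : Y.Opens} (h : U ≤ f ⁻¹ᵁ V)
    (hU : ⊤ ≤ U.ι ⁻¹ᵁ U) (hV : ⊤ ≤ V.ι ⁻¹ᵁ V) :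
    V.ι.appLE V ⊤ hV ≫ (f.resLE V U h).appTop = f.appLE V U h ≫ U.ι.appLE U ⊤ hU := by
  have e5 : f.resLE V U h ≫ V.ι = U.ι ≫ f := Scheme.Hom.resLE_comp_ι f h
  rw [appLE_comp_appTop _ _ _ _ (e5 ▸ hU.trans (U.ι.preimage_mono h)), Scheme.Hom.appLE_comp_appLE]
  congr 1

/-- Restriction of source and target to `U` and `V` reduces this to the affine case
`ideal_comap_top`; the equality is then carried back along the isomorphism `U.1.topIso`. -/
theorem ideal_comap (I : Y.IdealSheafData) (f : X ⟶ Y)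
    (U : X.affineOpens) (V : Y.affineOpens) (h : U.1 ≤ f ⁻¹ᵁ V.1) :
    (I.comap f).ideal U = (I.ideal V).map (f.appLE V.1 U.1 h).hom := by
  have : IsAffine U.1 := U.2
  have : IsAffine V.1 := V.2
  have hU : ⊤ ≤ U.1.ι ⁻¹ᵁ U.1 := by simp
  have hV : ⊤ ≤ V.1.ι ⁻¹ᵁ V.1 := by simp
  have e1 : U.1.ι.appLE U.1 ⊤ hU = U.1.topIso.inv := by
    rw [Scheme.Opens.ι_appLE]
    rfl
  have a1 := ideal_comap_isOpenImmersion (I.comap f) U.1.ι (isAffineOpen_top U.1) U hU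
  have a2 := ideal_comap_isOpenImmersion I V.1.ι (isAffineOpen_top V.1) V hV
  have a3 := ideal_comap_top (I.comap V.1.ι) (f.resLE V.1 U.1 h)
  have a4 : (I.comap f).comap U.1.ι = (I.comap V.1.ι).comap (f.resLE V.1 U.1 h) := by
    rw [← Scheme.IdealSheafData.comap_comp, ← Scheme.IdealSheafData.comap_comp,
      Scheme.Hom.resLE_comp_ι]
  have key : ((I.comap f).ideal U).map (U.1.ι.appLE U.1 ⊤ hU).hom =
      ((I.ideal V).map (f.appLE V.1 U.1 h).hom).map (U.1.ι.appLE U.1 ⊤ hU).hom := by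
    refine a1.symm.trans ((congrArg (fun K => K.ideal ⟨⊤, isAffineOpen_top _⟩) a4).trans
      (a3.trans ((congrArg (Ideal.map (f.resLE V.1 U.1 h).appTop.hom) a2).trans ?_)))
    exact ideal_map_map_eq (resLE_appTop f h hU hV) _
  rw [e1] at key
  have := congrArg (Ideal.map U.1.topIso.hom.hom) key
  simpa only [Ideal.map_map, ← CommRingCat.hom_comp, Category.assoc, Category.comp_id,
    Iso.inv_hom_id, CommRingCat.hom_id, Ideal.map_id] using this

theorem app_surjective_of_isClosedImmersion (f : X ⟶ Y) [IsClosedImmersion f] (U : Y.affineOpens) :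
    Function.Surjective (f.app U.1).hom := by
  have h1 := f.ker.subschemeι_app_surjective U
  have h2 : Function.Bijective (f.toImage.app (f.ker.subschemeι ⁻¹ᵁ U.1)).hom :=
    ConcreteCategory.bijective_of_isIso _
  have h3 : Function.Surjective ((f.toImage ≫ f.ker.subschemeι).app U.1).hom := by
    rw [Scheme.Hom.comp_app]
    exact h2.2.comp h1
  have h4 : ∀ g : X ⟶ Y, g = f → Function.Surjective (g.app U.1).hom →
      Function.Surjective (f.app U.1).hom := by
    rintro _ rfl
    exact id
  exact h4 _ f.toImage_imageι h3

/-- Over affine opens the ring map is surjective, so extending a contracted ideal gives the ideal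
back. -/
theorem map_comap_isClosedImmersion (I : X.IdealSheafData) (f : X ⟶ Y) [IsClosedImmersion f] :
    (I.map f).comap f = I := by
  refine Scheme.IdealSheafData.ext_of_iSup_eq_top
    (fun U : Y.affineOpens => ⟨f ⁻¹ᵁ U.1, U.2.preimage f⟩) ?_ fun U => ?_
  · rw [← Scheme.Hom.preimage_iSup, iSup_affineOpens_eq_top Y]
    rfl
  · rw [ideal_comap _ f _ U le_rfl, Scheme.IdealSheafData.ideal_map_of_isAffineHom,
      ← Scheme.Hom.app_eq_appLE]
    exact Ideal.map_comap_of_surjective _ (app_surjective_of_isClosedImmersion f U) _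

theorem comap_eq_bot_iff (I : Y.IdealSheafData) (f : X ⟶ Y) : I.comap f = ⊥ ↔ I ≤ f.ker := by
  rw [← Scheme.IdealSheafData.map_bot, Scheme.IdealSheafData.le_map_iff_comap_le, le_bot_iff]

theorem IsEffectiveCartier.exists_le {I : X.IdealSheafData} (hI : IsEffectiveCartier I) {x : X}
    {V : X.Opens} (hx : x ∈ V) : ∃ U : X.affineOpens, x ∈ U.1 ∧ U.1 ≤ V ∧
      ∃ f ∈ nonZeroDivisors Γ(X, U.1), I.ideal U = Ideal.span {f} := by
  obtain ⟨U, hxU, f, hf, hfI⟩ := hI x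
  obtain ⟨r, hr, hxr⟩ := U.2.exists_basicOpen_le ⟨x, hx⟩ hxU
  refine ⟨X.affineBasicOpen r, hxr, hr,
    (X.presheaf.map (homOfLE <| X.basicOpen_le r).op).hom f, ?_, ?_⟩
  · have := U.2.isLocalization_basicOpen r
    exact IsLocalization.map_nonZeroDivisors_le (.powers r) Γ(X, X.basicOpen r) ⟨f, hf, rfl⟩
  · rw [← I.map_ideal_basicOpen, hfI, Ideal.map_span, Set.image_singleton]
    rfl

theorem exists_affineOpens_le {x : X} {V : X.Opens} (hx : x ∈ V) :
    ∃ U : X.affineOpens, x ∈ U.1 ∧ U.1 ≤ V := by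
  obtain ⟨_, ⟨U, hU, rfl⟩, hxU, hUV⟩ := X.isBasis_affineOpens.exists_subset_of_mem_open hx V.isOpen
  exact ⟨⟨U, hU⟩, hxU, hUV⟩

theorem exists_ideal_eq_top {I : X.IdealSheafData} {x : X} (hx : x ∉ I.support) :
    ∃ U : X.affineOpens, x ∈ U.1 ∧ I.ideal U = ⊤ := by
  obtain ⟨U, hU, -⟩ := exists_affineOpens_le (show x ∈ (⊤ : X.Opens) from trivial)
  rw [Scheme.IdealSheafData.mem_support_iff_of_mem hU, Scheme.mem_zeroLocus_iff] at hx
  push Not at hx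
  obtain ⟨g, hg, hxg⟩ := hx
  refine ⟨X.affineBasicOpen g, hxg, ?_⟩
  rw [← I.map_ideal_basicOpen]
  have := U.2.isLocalization_basicOpen g
  refine Ideal.eq_top_of_isUnit_mem _ (Ideal.mem_map_of_mem _ hg) ?_
  exact IsLocalization.Away.algebraMap_isUnit (S := Γ(X, X.basicOpen g)) g

/-- A criterion for an effective Cartier divisor on a closed subscheme. -/
theorem isEffectiveCartier_comap_subschemeι {D D' : X.IdealSheafData}
    (h : ∀ x ∈ D.support, x ∈ D'.support → ∃ U : X.affineOpens, x ∈ U.1 ∧ ∃ f : Γ(X, U.1),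
      D'.ideal U ⊔ D.ideal U = Ideal.span {f} ⊔ D.ideal U ∧ ∀ g, f * g ∈ D.ideal U → g ∈ D.ideal U) :
    IsEffectiveCartier (D'.comap D.subschemeι) := by
  intro x
  have hx : D.subschemeι x ∈ D.support := by
    rw [← SetLike.mem_coe, ← D.range_subschemeι]
    exact ⟨x, rfl⟩
  obtain ⟨U, hxU, f, hf, hreg⟩ : ∃ U : X.affineOpens, D.subschemeι x ∈ U.1 ∧ ∃ f : Γ(X, U.1),
      D'.ideal U ⊔ D.ideal U = Ideal.span {f} ⊔ D.ideal U ∧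
        ∀ g, f * g ∈ D.ideal U → g ∈ D.ideal U := by
    -- Off the support of `D'` the ideal is locally the unit ideal and `f = 1` serves, which is why
    -- the hypothesis concerns only points of both supports.
    by_cases hx' : D.subschemeι x ∈ D'.support
    · exact h _ hx hx'
    · obtain ⟨U, hU, hU'⟩ := exists_ideal_eq_top hx'
      refine ⟨U, hU, 1, ?_, fun g hg => by rwa [one_mul] at hg⟩
      rw [hU', Ideal.span_singleton_one]
  have hsurj := D.subschemeι_app_surjective U
  have hker : ∀ g, (D.subschemeι.app U.1).hom g = 0 ↔ g ∈ D.ideal U := fun g => by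
    rw [← D.ker_subschemeι_app U]
    exact Iff.rfl
  have hD : (D.ideal U).map (D.subschemeι.app U.1).hom = ⊥ := by
    rw [Ideal.map_eq_bot_iff_le_ker]
    exact fun g hg => (hker g).2 hg
  refine ⟨⟨D.subschemeι ⁻¹ᵁ U.1, U.2.preimage _⟩, hxU, (D.subschemeι.app U.1).hom f, ?_, ?_⟩
  · rw [mem_nonZeroDivisors_iff_right]
    intro g hg
    obtain ⟨g, rfl⟩ := hsurj g
    have : (D.subschemeι.app U.1).hom (f * g) = 0 := by
      rw [map_mul, mul_comm]
      exact hg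
    exact (hker g).2 (hreg g ((hker _).1 this))
  · rw [ideal_comap _ _ _ U le_rfl, ← Scheme.Hom.app_eq_appLE]
    have := congrArg (Ideal.map (D.subschemeι.app U.1).hom) hf
    rwa [Ideal.map_sup, Ideal.map_sup, hD, sup_bot_eq, sup_bot_eq, Ideal.map_span,
      Set.image_singleton] at this
end IdealSheaf

/-! ### Zero schemes of multihomogeneous forms -/

section zeroIdeal
variable {T : Scheme.{0}} {k : ℕ} {s : T ⟶ SpecC} {q : Fin k → (T ⟶ P2)}

theorem iSup_chart (q : Fin k → (T ⟶ P2)) : ⨆ j, chart q j = ⊤ := by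
  rw [eq_top_iff]
  intro t _
  have h : ∀ a, ∃ j, q a t ∈ P2.chart j := fun a =>
    TopologicalSpace.Opens.mem_iSup.1 (P2.iSup_chart.ge (show q a t ∈ ⊤ from trivial))
  choose j hj using h
  exact TopologicalSpace.Opens.mem_iSup.2 ⟨j, mem_chart.2 hj⟩

theorem basicOpen_prod {X : Scheme.{0}} {U : X.Opens} {ι : Type*} (S : Finset ι) (f : ι → Γ(X, U)) :
    X.basicOpen (∏ i ∈ S, f i) = U ⊓ S.inf fun i => X.basicOpen (f i) := by
  classical
  induction S using Finset.induction_on with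
  | empty => simp [Scheme.basicOpen_of_isUnit]
  | insert i S hi ih =>
    rw [Finset.prod_insert hi, Scheme.basicOpen_mul, ih, Finset.inf_insert]
    exact inf_left_comm _ _ _

/-- Exhibits the overlap of two charts as a principal open subset of one of them. On a product of
planes it is therefore affine, and the inclusions of the charts are affine morphisms. -/
theorem basicOpen_prod_coordinate (j j' : Fin k → Fin 3) :
    T.basicOpen (∏ a, coordinate q j a (j' a)) = chart q j ⊓ chart q j' := by
  rw [basicOpen_prod]
  ext t
  have h : t ∈ Finset.univ.inf (fun a => T.basicOpen (coordinate q j a (j' a))) ↔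
      ∀ a, t ∈ T.basicOpen (coordinate q j a (j' a)) := by
    rw [← SetLike.mem_coe, Finset.inf_univ_eq_iInf, TopologicalSpace.Opens.coe_iInf, Set.mem_iInter]
    exact Iff.rfl
  constructor
  · rintro ⟨h1, h2⟩
    refine ⟨h1, mem_chart.2 fun a => ?_⟩
    have h3 := h.1 h2 a
    rw [coordinate_eq_co, basicOpen_co] at h3
    exact h3.2
  · rintro ⟨h1, h2⟩
    refine ⟨h1, h.2 fun a => ?_⟩
    rw [coordinate_eq_co, basicOpen_co]
    exact ⟨h1, mem_chart.1 h2 a⟩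

theorem IsProd.isAffineOpen_inf (hq : IsProd s q) (j j' : Fin k → Fin 3) :
    IsAffineOpen (chart q j ⊓ chart q j') := by
  rw [← basicOpen_prod_coordinate]
  exact (hq.isAffineOpen_chart j).basicOpen _

theorem IsProd.isAffineHom_chartι (hq : IsProd s q) (j : Fin k → Fin 3) :
    IsAffineHom (chart q j).ι := by
  refine isAffineHom_of_forall_exists_isAffineOpen _ fun t => ?_
  obtain ⟨j', hj'⟩ := TopologicalSpace.Opens.mem_iSup.1 ((iSup_chart q).ge (show t ∈ ⊤ from trivial))
  refine ⟨_, hj', hq.isAffineOpen_chart j', ?_⟩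
  rw [← (chart q j).ι.isAffineOpen_iff_of_isOpenImmersion, Scheme.Hom.image_preimage_eq_opensRange_inf, Scheme.Opens.opensRange_ι]
  exact hq.isAffineOpen_inf j j'

/-- A multihomogeneous polynomial. -/
abbrev IsMultihomogeneous (F : MvPolynomial (Fin k × Fin 3) ℂ) (d : Fin k → ℕ) : Prop :=
  MvPolynomial.IsWeightedHomogeneous (fun v : Fin k × Fin 3 => (Pi.single v.1 1 : Fin k → ℕ)) F d

/-- The restriction of `dehomogenize` to a smaller open subset. -/
def dehom (s : T ⟶ SpecC) (q : Fin k → (T ⟶ P2)) (F : MvPolynomial (Fin k × Fin 3) ℂ)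
    (j : Fin k → Fin 3) (U : T.Opens) (h : U ≤ chart q j) : Γ(T, U) :=
  F.eval₂ (scalars s U) (fun v : Fin k × Fin 3 => co (q v.1) (j v.1) U (h.trans (chart_le q j v.1)) v.2)

theorem dehomogenize_eq_dehom (F : MvPolynomial (Fin k × Fin 3) ℂ) (j : Fin k → Fin 3) :
    dehomogenize s q F j = dehom s q F j _ le_rfl := rfl

theorem map_dehom (F : MvPolynomial (Fin k × Fin 3) ℂ)
    (j : Fin k → Fin 3) {U V : T.Opens} (h : U ≤ chart q j) (e : V ≤ U) :
    (T.presheaf.map (homOfLE e).op).hom (dehom s q F j U h) = dehom s q F j V (e.trans h) := by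
  refine (MvPolynomial.hom_eval₂ _ _ _ _).trans ?_
  refine congrArg₂ (fun x y => MvPolynomial.eval₂ x y F) (RingHom.ext fun r => map_scalars s e r) ?_
  funext v
  exact map_co _ _ _ _

theorem appLE_dehom {T' : Scheme.{0}} (f : T' ⟶ T) (F : MvPolynomial (Fin k × Fin 3) ℂ)
    (j : Fin k → Fin 3) {U : T.Opens} {V : T'.Opens} (h : U ≤ chart q j) (e : V ≤ f ⁻¹ᵁ U)
    (h' : V ≤ chart (fun a => f ≫ q a) j) :
    (f.appLE U V e).hom (dehom s q F j U h) = dehom (f ≫ s) (fun a => f ≫ q a) F j V h' := by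
  refine (MvPolynomial.hom_eval₂ _ _ _ _).trans ?_
  refine congrArg₂ (fun x y => MvPolynomial.eval₂ x y F) (RingHom.ext fun r => appLE_scalars f s e r) ?_
  funext v
  exact appLE_co f _ _ e _

theorem dehom_trans {F : MvPolynomial (Fin k × Fin 3) ℂ} {d : Fin k → ℕ} (hF : IsMultihomogeneous F d)
    {j j' : Fin k → Fin 3} {U : T.Opens} (h : U ≤ chart q j) (h' : U ≤ chart q j') :
    dehom s q F j U h =
      (∏ a, co (q a) (j a) U (h.trans (chart_le q j a)) (j' a) ^ d a) * dehom s q F j' U h' := by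
  rw [dehom, dehom, ← eval₂_multihomogeneous hF]
  congr 1
  funext v
  exact co_trans _ _ _ _

theorem isUnit_co {q : T ⟶ P2} {j m : Fin 3} {U : T.Opens} (h : U ≤ q ⁻¹ᵁ P2.chart j)
    (h' : U ≤ q ⁻¹ᵁ P2.chart m) : IsUnit (co q j U h m) := by
  have := co_trans q h h' j
  rw [co_self] at this
  exact IsUnit.of_mul_eq_one _ this.symm

theorem span_dehom {F : MvPolynomial (Fin k × Fin 3) ℂ} {d : Fin k → ℕ} (hF : IsMultihomogeneous F d)
    {j j' : Fin k → Fin 3} {U : T.Opens} (h : U ≤ chart q j) (h' : U ≤ chart q j') :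
    Ideal.span {dehom s q F j U h} = Ideal.span {dehom s q F j' U h'} := by
  rw [dehom_trans hF h h', Ideal.span_singleton_mul_left_unit]
  exact IsUnit.prod_univ_iff.2 fun a => (isUnit_co _ (h'.trans (chart_le q j' a))).pow _

theorem iSup_affineOpens_chart (q : Fin k → (T ⟶ P2)) :
    ⨆ x : (Σ j, {U : T.affineOpens // U.1 ≤ chart q j}), x.2.1.1 = ⊤ := by
  rw [eq_top_iff]
  intro t _
  obtain ⟨j, hj⟩ := TopologicalSpace.Opens.mem_iSup.1 ((iSup_chart q).ge (show t ∈ ⊤ from trivial))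
  obtain ⟨U, hU, hUV⟩ := exists_affineOpens_le hj
  exact TopologicalSpace.Opens.mem_iSup.2 ⟨⟨j, U, hUV⟩, hU⟩

/-- The smallest ideal sheaf containing all local equations could a priori be too large on a chart.
This is excluded by an ideal sheaf `J` with exactly the expected value on each chart: the
intersection, over all charts, of the push-forwards of the principal ideals. Homogeneity is
essential, since it makes the equations of two charts differ by a unit on the overlap. -/
theorem IsProd.zeroIdeal_chart (hq : IsProd s q) {F : MvPolynomial (Fin k × Fin 3) ℂ} {d : Fin k → ℕ}
    (hF : IsMultihomogeneous F d) (j : Fin k → Fin 3) :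
    (zeroIdeal s q F).ideal ⟨_, hq.isAffineOpen_chart j⟩ = Ideal.span {dehomogenize s q F j} := by
  have haff := hq.isAffineHom_chartι
  have haff' : ∀ j, IsAffine (chart q j) := hq.isAffineOpen_chart
  have hle : ∀ i, ⊤ ≤ (chart q i).ι ⁻¹ᵁ chart q i := by simp
  let J' : ∀ i, (chart q i).toScheme.IdealSheafData := fun i =>
    Scheme.IdealSheafData.equivOfIsAffine.symm
      (Ideal.span {((chart q i).ι.appLE _ ⊤ (hle i)).hom (dehomogenize s q F i)})
  let J : T.IdealSheafData := ⨅ i, (J' i).map (chart q i).ι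
  have hJ' : ∀ i j, ((J' i).map (chart q i).ι).ideal ⟨_, hq.isAffineOpen_chart j⟩ =
      (Ideal.span {((chart q i).ι.app (chart q j)).hom (dehomogenize s q F j)}).comap
        ((chart q i).ι.app (chart q j)).hom := by
    intro i j
    rw [Scheme.IdealSheafData.ideal_map_of_isAffineHom]
    congr 1
    have h1 : (J' i).ideal ⟨_, (hq.isAffineOpen_chart j).preimage (chart q i).ι⟩ =
        (Ideal.span {((chart q i).ι.appLE _ ⊤ (hle i)).hom (dehomogenize s q F i)}).map
        ((chart q i).toScheme.presheaf.map (homOfLE le_top).op).hom := rfl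
    refine h1.trans ?_
    rw [Ideal.map_span, Set.image_singleton, Scheme.Hom.app_eq_appLE, ← CommRingCat.comp_apply]
    have h2 : chart (fun a => (chart q i).ι ≫ q a) i = ⊤ :=
      top_le_iff.1 fun t _ => mem_chart.2 fun a => mem_chart.1 t.2 a
    have h3 : (chart q i).ι ⁻¹ᵁ chart q j ≤ chart (fun a => (chart q i).ι ≫ q a) j := fun t ht =>
      mem_chart.2 fun a => mem_chart.1 (show (chart q i).ι t ∈ chart q j from ht) a
    rw [dehomogenize_eq_dehom, dehomogenize_eq_dehom, appLE_dehom _ _ _ _ _ h3,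
      span_dehom hF h3 (h2 ▸ le_top : _ ≤ chart (fun a => (chart q i).ι ≫ q a) i)]
    congr 2
    rw [CommRingCat.comp_apply]
    rw [appLE_dehom _ _ _ _ _ h2.ge]
    exact map_dehom _ _ _ _
  have hJ : ∀ j, J.ideal ⟨_, hq.isAffineOpen_chart j⟩ = Ideal.span {dehomogenize s q F j} := by
    intro j
    have h0 : J.ideal ⟨_, hq.isAffineOpen_chart j⟩ =
        ⨅ i, ((J' i).map (chart q i).ι).ideal ⟨_, hq.isAffineOpen_chart j⟩ := by
      rw [Scheme.IdealSheafData.ideal_iInf, iInf_apply]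
    rw [h0]
    apply le_antisymm
    · refine (iInf_le _ j).trans ?_
      rw [hJ']
      have : IsIso ((chart q j).ι.app (chart q j)) :=
        Scheme.Hom.isIso_app _ _ (by rw [Scheme.Opens.opensRange_ι])
      have hb : Function.Bijective ((chart q j).ι.app (chart q j)).hom :=
        ConcreteCategory.bijective_of_isIso _
      rw [← Set.image_singleton, ← Ideal.map_span, Ideal.comap_map_of_bijective _ hb]
    · refine le_iInf fun i => ?_
      rw [hJ', ← Set.image_singleton, ← Ideal.map_span]
      exact Ideal.le_comap_map
  -- `J` contains the local equations, and every ideal sheaf that contains them contains `J` on each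
  -- chart.
  have : zeroIdeal s q F = J := by
    apply le_antisymm
    · refine sInf_le fun j V hV => ?_
      refine J.ideal_le_comap_ideal (U := V) (V := ⟨_, hq.isAffineOpen_chart j⟩) hV ?_
      rw [hJ]
      exact Ideal.mem_span_singleton_self _
    · refine le_sInf fun I hI => ?_
      refine Scheme.IdealSheafData.le_of_iSup_eq_top
        (fun j => ⟨chart q j, hq.isAffineOpen_chart j⟩) (iSup_chart q) fun j => ?_
      rw [hJ, Ideal.span_singleton_le_iff_mem]
      have := hI j ⟨_, hq.isAffineOpen_chart j⟩ le_rfl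
      rw [dehomogenize_eq_dehom, map_dehom] at this
      exact this
  rw [this, hJ]

theorem IsProd.comap_zeroIdeal (hq : IsProd s q) {F : MvPolynomial (Fin k × Fin 3) ℂ}
    {d : Fin k → ℕ} (hF : IsMultihomogeneous F d) {T' : Scheme.{0}} (f : T' ⟶ T) (j : Fin k → Fin 3)
    (U : T'.affineOpens) (h : U.1 ≤ chart (fun a => f ≫ q a) j) :
    ((zeroIdeal s q F).comap f).ideal U =
      Ideal.span {dehom (f ≫ s) (fun a => f ≫ q a) F j U.1 h} := by
  have h' : U.1 ≤ f ⁻¹ᵁ chart q j := le_chart fun a => h.trans (chart_le _ j a)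
  rw [ideal_comap _ f U ⟨_, hq.isAffineOpen_chart j⟩ h', hq.zeroIdeal_chart hF, Ideal.map_span,
    Set.image_singleton, dehomogenize_eq_dehom, appLE_dehom _ _ _ _ _ h]

theorem eq_of_affineOpens {X : Scheme.{0}} {V : X.Opens} {g g' : Γ(X, V)}
    (h : ∀ x ∈ V, ∃ (U : X.Opens) (e : U ≤ V), x ∈ U ∧
      (X.presheaf.map (homOfLE e).op).hom g = (X.presheaf.map (homOfLE e).op).hom g') : g = g' := by
  refine TopCat.Presheaf.IsSheaf.section_ext X.IsSheaf fun x hx => ?_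
  obtain ⟨U, e, hxU, hU⟩ := h x hx
  exact ⟨U, e, hxU, hU⟩

theorem eq_zero_of_affineOpens {X : Scheme.{0}} {V : X.Opens} {g : Γ(X, V)}
    (h : ∀ (U : X.affineOpens) (e : U.1 ≤ V), (X.presheaf.map (homOfLE e).op).hom g = 0) : g = 0 := by
  refine eq_of_affineOpens fun x hx => ?_
  obtain ⟨U, hU, hUV⟩ := exists_affineOpens_le hx
  exact ⟨U.1, hUV, hU, (h U hUV).trans (map_zero _).symm⟩

theorem IsProd.zeroIdeal_le_ker (hq : IsProd s q) {F : MvPolynomial (Fin k × Fin 3) ℂ}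
    {d : Fin k → ℕ} (hF : IsMultihomogeneous F d) {T' : Scheme.{0}} (f : T' ⟶ T) :
    zeroIdeal s q F ≤ f.ker ↔
      ∀ j U h, dehom (f ≫ s) (fun a => f ≫ q a) F j U h = 0 := by
  rw [← comap_eq_bot_iff]
  constructor
  · intro h j U hU
    refine eq_zero_of_affineOpens fun V e => ?_
    rw [map_dehom, ← Ideal.span_singleton_eq_bot, ← hq.comap_zeroIdeal hF, h]
    rfl
  · intro h
    refine Scheme.IdealSheafData.ext_of_iSup_eq_top _ (iSup_affineOpens_chart fun a => f ≫ q a)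
      fun x => ?_
    rw [hq.comap_zeroIdeal hF f x.1 _ x.2.2, h, Ideal.span_singleton_eq_bot.2 rfl]
    rfl

end zeroIdeal

/-! ### Cross products, bilinear forms and incidence -/

section cross
variable {R : Type*} [CommRing R]

/-- The cross product, with indices modulo three. -/
def cross (x b : Fin 3 → R) (l : Fin 3) : R := x (l + 1) * b (l + 2) - x (l + 2) * b (l + 1)

theorem cross_zero (x b : Fin 3 → R) : cross x b 0 = x 1 * b 2 - x 2 * b 1 := rfl
theorem cross_one (x b : Fin 3 → R) : cross x b 1 = x 2 * b 0 - x 0 * b 2 := rfl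
theorem cross_two (x b : Fin 3 → R) : cross x b 2 = x 0 * b 1 - x 1 * b 0 := rfl

theorem sum_mul_cross_left (x b : Fin 3 → R) : ∑ l, x l * cross x b l = 0 := by
  rw [Fin.sum_univ_three, cross_zero, cross_one, cross_two]
  ring

theorem sum_mul_cross_right (x b : Fin 3 → R) : ∑ l, b l * cross x b l = 0 := by
  rw [Fin.sum_univ_three, cross_zero, cross_one, cross_two]
  ring

/-- Orthogonality to `x` and `b` leaves only the direction of their cross product. This
proportionality is what determines the third point of the blow-up. -/
theorem mul_cross_comm {x b z : Fin 3 → R} (hx : ∑ l, x l * z l = 0) (hb : ∑ l, b l * z l = 0)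
    (k l : Fin 3) : z l * cross x b k = z k * cross x b l := by
  rw [Fin.sum_univ_three] at hx hb
  fin_cases k <;> fin_cases l <;> simp only [Fin.zero_eta, Fin.mk_one, Fin.reduceFinMk, cross_zero, cross_one, cross_two] <;> grind
end cross

section bil
variable {k : ℕ}

/-- The bilinear form with matrix `M` in the groups of variables `a` and `b`. -/
def bil (M : Matrix (Fin 3) (Fin 3) ℂ) (a b : Fin k) : MvPolynomial (Fin k × Fin 3) ℂ :=
  ∑ l, ∑ m, MvPolynomial.C (M l m) * MvPolynomial.X (a, l) * MvPolynomial.X (b, m)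

theorem bil_one (a b : Fin k) : bil 1 a b = ∑ l, MvPolynomial.X (a, l) * MvPolynomial.X (b, l) := by
  simp [bil, Matrix.one_apply]

theorem isMultihomogeneous_bil (M : Matrix (Fin 3) (Fin 3) ℂ) (a b : Fin k) :
    IsMultihomogeneous (bil M a b) (Pi.single a 1 + Pi.single b 1) := by
  refine MvPolynomial.IsWeightedHomogeneous.sum _ _ _ fun l _ => MvPolynomial.IsWeightedHomogeneous.sum _ _ _ fun m _ => ?_
  have h := ((MvPolynomial.isWeightedHomogeneous_C
    (fun v : Fin k × Fin 3 => (Pi.single v.1 1 : Fin k → ℕ)) (M l m)).mul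
    (MvPolynomial.isWeightedHomogeneous_X ℂ _ (a, l))).mul
    (MvPolynomial.isWeightedHomogeneous_X ℂ _ (b, m))
  rwa [zero_add] at h

variable {T : Scheme.{0}} {s : T ⟶ SpecC} {q : Fin k → (T ⟶ P2)}

theorem dehom_bil (M : Matrix (Fin 3) (Fin 3) ℂ) (a b : Fin k) (j : Fin k → Fin 3) {U : T.Opens}
    (h : U ≤ chart q j) : dehom s q (bil M a b) j U h = ∑ l, ∑ m, scalars s U (M l m) *
      co (q a) (j a) U (h.trans (chart_le q j a)) l * co (q b) (j b) U (h.trans (chart_le q j b)) m := by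
  simp [dehom, bil, MvPolynomial.eval₂_sum]

/-- The bilinear form `M` vanishes at `(x, y)`. -/
def Incident (s : T ⟶ SpecC) (M : Matrix (Fin 3) (Fin 3) ℂ) (x y : T ⟶ P2) : Prop :=
  ∀ (i j : Fin 3) (U : T.Opens) (hx : U ≤ x ⁻¹ᵁ P2.chart i) (hy : U ≤ y ⁻¹ᵁ P2.chart j),
    ∑ l, ∑ m, scalars s U (M l m) * co x i U hx l * co y j U hy m = 0

theorem dehom_bil_eq_zero_iff (M : Matrix (Fin 3) (Fin 3) ℂ) (a b : Fin k) (hab : a ≠ b) :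
    (∀ j U h, dehom s q (bil M a b) j U h = 0) ↔ Incident s M (q a) (q b) := by
  constructor
  · intro h i j U hx hy
    refine eq_of_affineOpens fun t ht => ?_
    obtain ⟨n, hn⟩ := TopologicalSpace.Opens.mem_iSup.1 ((iSup_chart q).ge (show t ∈ ⊤ from trivial))
    have hn' := mem_chart.1 hn
    -- Only the charts of the factors `a` and `b` matter; elsewhere `n'` keeps a chart that contains
    -- the image of `t`.
    let n' := Function.update (Function.update n a i) b j
    have ha : n' a = i := by simp [n', hab]
    have hb : n' b = j := by simp [n']
    have hc : U ⊓ chart q n ≤ chart q n' := fun t ht => mem_chart.2 fun c => by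
      by_cases h1 : c = b
      · subst h1
        rw [hb]
        exact hy ht.1
      by_cases h2 : c = a
      · subst h2
        rw [ha]
        exact hx ht.1
      · simpa [n', h1, h2] using mem_chart.1 ht.2 c
    have h3 := h n' (U ⊓ chart q n) hc
    rw [dehom_bil] at h3
    refine ⟨U ⊓ chart q n, inf_le_left, ⟨ht, hn⟩, ?_⟩
    clear_value n'
    subst ha hb
    rw [map_zero, ← h3]
    simp only [map_sum, map_mul, map_co, map_scalars]
  · intro h j U hU
    rw [dehom_bil]
    exact h _ _ _ _ _

/-- A change of charts multiplies the value of the form by one coordinate ratio from each factor, so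
a single pair of charts containing everything suffices. -/
theorem Incident.of_chart {M : Matrix (Fin 3) (Fin 3) ℂ} {x y : T ⟶ P2} {i j : Fin 3}
    (hx : ⊤ ≤ x ⁻¹ᵁ P2.chart i) (hy : ⊤ ≤ y ⁻¹ᵁ P2.chart j)
    (h : ∑ l, ∑ m, scalars s ⊤ (M l m) * co x i ⊤ hx l * co y j ⊤ hy m = 0) : Incident s M x y := by
  intro i' j' U hx' hy'
  have h1 := congrArg (T.presheaf.map (homOfLE (le_top : U ≤ ⊤)).op).hom h
  simp only [map_sum, map_mul, map_co, map_scalars, map_zero] at h1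
  rw [← mul_zero (co x i' U hx' i * co y j' U hy' j), ← h1, Finset.mul_sum]
  refine Finset.sum_congr rfl fun l _ => ?_
  rw [Finset.mul_sum]
  refine Finset.sum_congr rfl fun m _ => ?_
  rw [co_trans x hx' (le_top.trans hx) l, co_trans y hy' (le_top.trans hy) m]
  ring

theorem incident_one {x y : T ⟶ P2} (h : Incident s 1 x y) {i j : Fin 3} {U : T.Opens}
    (hx : U ≤ x ⁻¹ᵁ P2.chart i) (hy : U ≤ y ⁻¹ᵁ P2.chart j) :
    ∑ l, co x i U hx l * co y j U hy l = 0 := by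
  have := h i j U hx hy
  simpa [Matrix.one_apply, apply_ite (scalars s U)] using this
end bil

theorem mem_nonZeroDivisors_of_bijective {A B : Type*} [CommRing A] [CommRing B] {φ : A →+* B}
    (hφ : Function.Bijective φ) {a : A} (ha : a ∈ nonZeroDivisors A) : φ a ∈ nonZeroDivisors B := by
  rw [mem_nonZeroDivisors_iff_right] at ha ⊢
  intro b hb
  obtain ⟨c, rfl⟩ := hφ.2 b
  rw [← map_mul] at hb
  rw [ha c (hφ.1 (hb.trans (map_zero φ).symm)), map_zero]

/-! ### Generators of invertible ideals and the ideal of minors -/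

section cartier
variable {X Y : Scheme.{0}}

theorem IsEffectiveCartier.comap_isOpenImmersion {I : Y.IdealSheafData} (hI : IsEffectiveCartier I)
    (f : X ⟶ Y) [IsOpenImmersion f] : IsEffectiveCartier (I.comap f) := by
  intro x
  obtain ⟨U, hxU, hU, g, hg, hgI⟩ := hI.exists_le (show f x ∈ f.opensRange from ⟨x, rfl⟩)
  have : IsIso (f.app U.1) := f.isIso_app _ hU
  have hb : Function.Bijective (f.app U.1).hom := ConcreteCategory.bijective_of_isIso _
  refine ⟨⟨f ⁻¹ᵁ U.1, U.2.preimage_of_isOpenImmersion f hU⟩, hxU, (f.app U.1).hom g, ?_, ?_⟩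
  · exact mem_nonZeroDivisors_of_bijective hb hg
  · rw [ideal_comap _ _ _ U le_rfl, ← Scheme.Hom.app_eq_appLE, hgI, Ideal.map_span,
      Set.image_singleton]

/-- An explicit form of Nakayama's lemma. If `f` is a local equation, `m l = d l * f` and `f = ∑ c l
* m l`, then `∑ c l * d l = 1` because `f` is a nonzerodivisor. Hence some `d k` is a unit at `x`,
and near `x` the section `m k` can replace `f`. -/
theorem IsEffectiveCartier.exists_generator {I : X.IdealSheafData} (hI : IsEffectiveCartier I)
    {V : X.Opens} {ι : Type*} [Fintype ι] (m : ι → Γ(X, V))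
    (hm : ∀ (U : X.affineOpens) (h : U.1 ≤ V),
      I.ideal U = Ideal.span (Set.range fun l => (X.presheaf.map (homOfLE h).op).hom (m l)))
    {x : X} (hx : x ∈ V) : ∃ (U : X.affineOpens) (h : U.1 ≤ V) (k : ι), x ∈ U.1 ∧
      (X.presheaf.map (homOfLE h).op).hom (m k) ∈ nonZeroDivisors Γ(X, U.1) ∧
      ∃ w : ι → Γ(X, U.1), ∀ l, (X.presheaf.map (homOfLE h).op).hom (m l) =
        w l * (X.presheaf.map (homOfLE h).op).hom (m k) := by
  obtain ⟨U, hxU, hU, f, hf, hfI⟩ := hI.exists_le hx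
  have h1 := hm U hU
  rw [hfI] at h1
  have h2 : ∀ l, ∃ d, d * f = (X.presheaf.map (homOfLE hU).op).hom (m l) := fun l =>
    Ideal.mem_span_singleton'.1 (h1.ge (Ideal.subset_span ⟨l, rfl⟩))
  choose d hd using h2
  obtain ⟨c, hc⟩ := Ideal.mem_span_range_iff_exists_fun.1 (h1.le (Ideal.mem_span_singleton_self f))
  have h3 : ∑ l, c l * d l = 1 := by
    have h4 : (∑ l, c l * d l - 1) * f = 0 := by
      rw [sub_mul, one_mul, sub_eq_zero, Finset.sum_mul]
      refine Eq.trans (Finset.sum_congr rfl fun l _ => ?_) hc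
      rw [mul_assoc, hd]
    exact sub_eq_zero.1 ((mem_nonZeroDivisors_iff_right.1 hf) _ h4)
  obtain ⟨k, hk⟩ : ∃ k, x ∈ X.basicOpen (d k) := by
    by_contra! hcon
    have h5 : ∀ k, X.presheaf.germ U.1 x hxU (d k) ∈ IsLocalRing.maximalIdeal (X.presheaf.stalk x) :=
      fun k => by
        rw [IsLocalRing.mem_maximalIdeal, mem_nonunits_iff, ← X.mem_basicOpen _ _ hxU]
        exact hcon k
    have h6 : (1 : X.presheaf.stalk x) ∈ IsLocalRing.maximalIdeal (X.presheaf.stalk x) := by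
      rw [← map_one (X.presheaf.germ U.1 x hxU).hom, ← h3, map_sum]
      refine Ideal.sum_mem _ fun l _ => ?_
      rw [map_mul]
      exact Ideal.mul_mem_left _ _ (h5 l)
    exact (Ideal.ne_top_iff_one _).1 (IsLocalRing.maximalIdeal.isMaximal _).ne_top h6
  have := U.2.isLocalization_basicOpen (d k)
  let ρ := (X.presheaf.map (homOfLE (X.basicOpen_le (d k))).op).hom
  have hρ : IsUnit (ρ (d k)) := IsLocalization.Away.algebraMap_isUnit (S := Γ(X, X.basicOpen (d k))) (d k)
  have hfρ : ρ f ∈ nonZeroDivisors _ :=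
    IsLocalization.map_nonZeroDivisors_le (.powers (d k)) Γ(X, X.basicOpen (d k)) ⟨f, hf, rfl⟩
  have hmρ : ∀ l, (X.presheaf.map (homOfLE ((X.basicOpen_le (d k)).trans hU)).op).hom (m l) =
      ρ (d l) * ρ f := fun l => by
    rw [← map_mul, hd, ← CommRingCat.comp_apply, ← Functor.map_comp]
    rfl
  refine ⟨X.affineBasicOpen (d k), (X.basicOpen_le _).trans hU, k, hk, ?_, ?_⟩
  · refine (hmρ k).symm ▸ mul_mem (hρ.mem_nonZeroDivisors) hfρ
  · obtain ⟨u, hu⟩ := hρ.exists_left_inv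
    refine ⟨fun l => ρ (d l) * u, fun l => (hmρ l).trans ?_⟩
    refine Eq.trans ?_ (congrArg (fun z => ρ (d l) * u * z) (hmρ k).symm)
    linear_combination - ρ (d l) * ρ f * hu
end cartier

section
variable {T : Scheme.{0}} {s : T ⟶ SpecC}

/-- The linear forms with coefficient matrix `B`, evaluated on a chart. -/
def linCo (s : T ⟶ SpecC) (B : Matrix (Fin 3) (Fin 3) ℂ) (y : T ⟶ P2) (j : Fin 3) (U : T.Opens)
    (h : U ≤ y ⁻¹ᵁ P2.chart j) (l : Fin 3) : Γ(T, U) :=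
  ∑ m, scalars s U (B l m) * co y j U h m

theorem map_linCo (B : Matrix (Fin 3) (Fin 3) ℂ) (y : T ⟶ P2) {j : Fin 3} {U V : T.Opens}
    (h : U ≤ y ⁻¹ᵁ P2.chart j) (e : V ≤ U) (l : Fin 3) :
    (T.presheaf.map (homOfLE e).op).hom (linCo s B y j U h l) = linCo s B y j V (e.trans h) l := by
  simp only [linCo, map_sum, map_mul, map_co, map_scalars]

theorem appLE_linCo {T' : Scheme.{0}} (f : T' ⟶ T) (B : Matrix (Fin 3) (Fin 3) ℂ) (y : T ⟶ P2) {j : Fin 3} {U : T.Opens}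
    {V : T'.Opens} (h : U ≤ y ⁻¹ᵁ P2.chart j) (e : V ≤ f ⁻¹ᵁ U) (h' : V ≤ (f ≫ y) ⁻¹ᵁ P2.chart j)
    (l : Fin 3) :
    (f.appLE U V e).hom (linCo s B y j U h l) = linCo (f ≫ s) B (f ≫ y) j V h' l := by
  simp only [linCo, map_sum, map_mul, appLE_co, appLE_scalars]

theorem map_cross {A A' : Type*} [CommRing A] [CommRing A'] (φ : A →+* A') (x b : Fin 3 → A) (l : Fin 3) :
    φ (cross x b l) = cross (fun l => φ (x l)) (fun l => φ (b l)) l := by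
  simp [cross]

theorem Incident.sum_linCo {B : Matrix (Fin 3) (Fin 3) ℂ} {z y : T ⟶ P2} (h : Incident s B z y)
    {k j : Fin 3} {U : T.Opens} (hz : U ≤ z ⁻¹ᵁ P2.chart k) (hy : U ≤ y ⁻¹ᵁ P2.chart j) :
    ∑ l, linCo s B y j U hy l * co z k U hz l = 0 := by
  rw [← h k j U hz hy]
  refine Finset.sum_congr rfl fun l _ => ?_
  rw [linCo, Finset.sum_mul]
  exact Finset.sum_congr rfl fun m _ => by ring

/-- The coefficients of the `l`-th component of the cross product of `x` and `B y`. -/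
def minorMat (B : Matrix (Fin 3) (Fin 3) ℂ) (l : Fin 3) : Matrix (Fin 3) (Fin 3) ℂ :=
  fun p m => if p = l + 1 then B (l + 2) m else if p = l + 2 then - B (l + 1) m else 0

theorem sum_minorMat {R : Type*} [CommRing R] (σ : ℂ →+* R) (B : Matrix (Fin 3) (Fin 3) ℂ)
    (x y : Fin 3 → R) (l : Fin 3) :
    ∑ p, ∑ m, σ (minorMat B l p m) * x p * y m = cross x (fun p => ∑ m, σ (B p m) * y m) l := by
  fin_cases l <;>
    simp [minorMat, Fin.sum_univ_three, cross] <;> ring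

/-- The ideal sheaf of the locus where `x` is proportional to `B y`. -/
def minorIdeal (B : Matrix (Fin 3) (Fin 3) ℂ) : P2xP2.IdealSheafData :=
  ⨆ l, zeroIdeal P2xP2.str P2xP2.proj (bil (minorMat B l) 0 1)

theorem chart_two (q : Fin 2 → (T ⟶ P2)) {i j : Fin 3} {U : T.Opens} (hx : U ≤ q 0 ⁻¹ᵁ P2.chart i)
    (hy : U ≤ q 1 ⁻¹ᵁ P2.chart j) : U ≤ chart q ![i, j] := fun t ht => mem_chart.2 fun a => by
  fin_cases a
  · exact hx ht
  · exact hy ht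

theorem comap_minorIdeal (B : Matrix (Fin 3) (Fin 3) ℂ) (f : T ⟶ P2xP2) {i j : Fin 3} (U : T.affineOpens)
    (hx : U.1 ≤ (f ≫ P2xP2.proj 0) ⁻¹ᵁ P2.chart i) (hy : U.1 ≤ (f ≫ P2xP2.proj 1) ⁻¹ᵁ P2.chart j) :
    ((minorIdeal B).comap f).ideal U = Ideal.span (Set.range
      (cross (co (f ≫ P2xP2.proj 0) i U.1 hx) (linCo (f ≫ P2xP2.str) B (f ≫ P2xP2.proj 1) j U.1 hy))) := by
  have h := chart_two (fun a => f ≫ P2xP2.proj a) hx hy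
  have h1 : (minorIdeal B).comap f = ⨆ l, (zeroIdeal P2xP2.str P2xP2.proj (bil (minorMat B l) 0 1)).comap f :=
    (Scheme.IdealSheafData.map_gc f).l_iSup
  rw [h1, Scheme.IdealSheafData.ideal_iSup, iSup_apply, ← Set.iUnion_singleton_eq_range, Ideal.span,
    Submodule.span_iUnion]
  refine iSup_congr fun l => ?_
  rw [isProd_P2xP2.comap_zeroIdeal (isMultihomogeneous_bil _ _ _) f ![i, j] U h, dehom_bil]
  congr 2
  exact sum_minorMat _ _ _ _ _

/-- Proportionality of `z` to the cross product can be divided by the `k`-th component, a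
nonzerodivisor. Where `z_n ≠ 0` this gives `z_k * w n = 1` in the chart `n`, so `z` lies in the
chart `k`; there the same division identifies its coordinates with `w`. -/
theorem le_chart_of_cross {B : Matrix (Fin 3) (Fin 3) ℂ} {x y z : T ⟶ P2} (hxz : Incident s 1 x z)
    (hzy : Incident s B z y) {i j k : Fin 3} (U : T.affineOpens) (hx : U.1 ≤ x ⁻¹ᵁ P2.chart i)
    (hy : U.1 ≤ y ⁻¹ᵁ P2.chart j)
    (hm : cross (co x i U.1 hx) (linCo s B y j U.1 hy) k ∈ nonZeroDivisors Γ(T, U.1))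
    (w : Fin 3 → Γ(T, U.1)) (hw : ∀ l, cross (co x i U.1 hx) (linCo s B y j U.1 hy) l =
      w l * cross (co x i U.1 hx) (linCo s B y j U.1 hy) k) :
    ∃ h : U.1 ≤ z ⁻¹ᵁ P2.chart k, ∀ l, co z k U.1 h l = w l := by
  have h : U.1 ≤ z ⁻¹ᵁ P2.chart k := by
    intro t ht
    obtain ⟨n, hn⟩ := TopologicalSpace.Opens.mem_iSup.1 (P2.iSup_chart.ge (show z t ∈ ⊤ from trivial))
    obtain ⟨r, hr, htr⟩ := U.2.exists_basicOpen_le (V := z ⁻¹ᵁ P2.chart n) ⟨t, hn⟩ ht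
    have := U.2.isLocalization_basicOpen r
    have hle := T.basicOpen_le r
    have hm' : (T.presheaf.map (homOfLE hle).op).hom (cross (co x i U.1 hx) (linCo s B y j U.1 hy) k) ∈
        nonZeroDivisors Γ(T, T.basicOpen r) :=
      IsLocalization.map_nonZeroDivisors_le (.powers r) Γ(T, T.basicOpen r) ⟨_, hm, rfl⟩
    have hw' := congrArg (T.presheaf.map (homOfLE hle).op).hom (hw n)
    rw [map_mul] at hw'
    simp only [map_cross, map_co, map_linCo] at hm' hw'
    have h1 := mul_cross_comm (incident_one hxz (hle.trans hx) hr)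
      (hzy.sum_linCo hr (hle.trans hy)) k n
    rw [hw', co_self, one_mul] at h1
    have h2 : (co z n (T.basicOpen r) hr k * (T.presheaf.map (homOfLE hle).op).hom (w n) - 1) *
        cross (co x i _ (hle.trans hx)) (linCo s B y j _ (hle.trans hy)) k = 0 := by
      linear_combination -h1
    have h3 := (mem_nonZeroDivisors_iff_right.1 hm') _ h2
    have h4 : IsUnit (co z n (T.basicOpen r) hr k) := IsUnit.of_mul_eq_one _ (sub_eq_zero.1 h3)
    have h5 := T.basicOpen_of_isUnit h4
    rw [basicOpen_co] at h5
    exact (h5.ge htr).2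
  refine ⟨h, fun l => ?_⟩
  have h1 := mul_cross_comm (incident_one hxz hx h) (hzy.sum_linCo h hy) k l
  rw [hw l, co_self, one_mul] at h1
  have h2 : (co z k U.1 h l - w l) * cross (co x i _ hx) (linCo s B y j _ hy) k = 0 := by
    linear_combination h1
  exact sub_eq_zero.1 ((mem_nonZeroDivisors_iff_right.1 hm) _ h2)
end

/-! ### The universal property of the candidate blow-up -/

section Z

/-- The three forms cutting out the blow-up. -/
def blowupForm (B : Matrix (Fin 3) (Fin 3) ℂ) : Fin 3 → MvPolynomial (Fin 3 × Fin 3) ℂ :=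
  ![bil 1 0 1, bil 1 0 2, bil B 2 1]

/-- The corresponding divisors. -/
def blowupDivisor (B : Matrix (Fin 3) (Fin 3) ℂ) (n : Fin 3) : P2xP2xP2.IdealSheafData :=
  zeroIdeal P2xP2xP2.str P2xP2xP2.proj (blowupForm B n)

/-- The ideal sheaf of their intersection. -/
def blowupIdeal (B : Matrix (Fin 3) (Fin 3) ℂ) : P2xP2xP2.IdealSheafData :=
  blowupDivisor B 0 ⊔ blowupDivisor B 1 ⊔ blowupDivisor B 2

variable {B : Matrix (Fin 3) (Fin 3) ℂ} {T : Scheme.{0}}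

theorem blowupIdeal_le_ker (f : T ⟶ P2xP2xP2) : blowupIdeal B ≤ f.ker ↔
    Incident (f ≫ P2xP2xP2.str) 1 (f ≫ P2xP2xP2.proj 0) (f ≫ P2xP2xP2.proj 1) ∧
    Incident (f ≫ P2xP2xP2.str) 1 (f ≫ P2xP2xP2.proj 0) (f ≫ P2xP2xP2.proj 2) ∧
    Incident (f ≫ P2xP2xP2.str) B (f ≫ P2xP2xP2.proj 2) (f ≫ P2xP2xP2.proj 1) := by
  have h (M : Matrix (Fin 3) (Fin 3) ℂ) (a b : Fin 3) (hab : a ≠ b) :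
      zeroIdeal P2xP2xP2.str P2xP2xP2.proj (bil M a b) ≤ f.ker ↔
      Incident (f ≫ P2xP2xP2.str) M (f ≫ P2xP2xP2.proj a) (f ≫ P2xP2xP2.proj b) := by
    rw [isProd_P2xP2xP2.zeroIdeal_le_ker (isMultihomogeneous_bil M a b)]
    exact dehom_bil_eq_zero_iff (q := fun a => f ≫ P2xP2xP2.proj a) M a b hab
  rw [blowupIdeal, sup_le_iff, sup_le_iff, and_assoc]
  exact and_congr (h _ _ _ (by decide)) (and_congr (h _ _ _ (by decide)) (h _ _ _ (by decide)))

theorem flagIdeal_le_ker (f : T ⟶ P2xP2) : flagIdeal ≤ f.ker ↔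
    Incident (f ≫ P2xP2.str) 1 (f ≫ P2xP2.proj 0) (f ≫ P2xP2.proj 1) := by
  rw [flagIdeal, ← bil_one, isProd_P2xP2.zeroIdeal_le_ker (isMultihomogeneous_bil 1 0 1)]
  exact dehom_bil_eq_zero_iff (q := fun a => f ≫ P2xP2.proj a) 1 0 1 (by decide)

instance : IsClosedImmersion W.ι := inferInstanceAs (IsClosedImmersion flagIdeal.subschemeι)

theorem W.incident (g : T ⟶ W) : Incident (g ≫ W.ι ≫ P2xP2.str) 1 (g ≫ W.ι ≫ P2xP2.proj 0)
    (g ≫ W.ι ≫ P2xP2.proj 1) := by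
  have h : flagIdeal ≤ (g ≫ W.ι).ker := by
    refine le_trans ?_ (Scheme.Hom.le_ker_comp _ _)
    exact flagIdeal.ker_subschemeι.ge
  simpa only [Category.assoc] using (flagIdeal_le_ker _).1 h

theorem blowupIdeal_le_ker_comp (h : T ⟶ (blowupIdeal B).subscheme) :
    blowupIdeal B ≤ (h ≫ (blowupIdeal B).subschemeι).ker :=
  (blowupIdeal B).ker_subschemeι.ge.trans (Scheme.Hom.le_ker_comp _ _)

theorem W.exists_lift (f : T ⟶ P2xP2)
    (h : Incident (f ≫ P2xP2.str) 1 (f ≫ P2xP2.proj 0) (f ≫ P2xP2.proj 1)) : ∃ g : T ⟶ W, g ≫ W.ι = f :=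
  ⟨IsClosedImmersion.lift W.ι f (flagIdeal.ker_subschemeι.le.trans ((flagIdeal_le_ker f).2 h)),
    IsClosedImmersion.lift_fac _ _ _⟩

/-- The projection to the first two factors. -/
def proj12 : P2xP2xP2 ⟶ P2xP2 := pullback.fst P2xP2.str P2.str

theorem exists_blowupMap (B : Matrix (Fin 3) (Fin 3) ℂ) :
    ∃ π : (blowupIdeal B).subscheme ⟶ W, π ≫ W.ι = (blowupIdeal B).subschemeι ≫ proj12 := by
  refine W.exists_lift _ ?_
  have := ((blowupIdeal_le_ker _).1 (blowupIdeal B).ker_subschemeι.ge).1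
  simp only [Category.assoc]
  exact this

/-- The morphism from the complete intersection to the flag variety. -/
def blowupMap (B : Matrix (Fin 3) (Fin 3) ℂ) : (blowupIdeal B).subscheme ⟶ W :=
  (exists_blowupMap B).choose

theorem blowupMap_ι : blowupMap B ≫ W.ι = (blowupIdeal B).subschemeι ≫ proj12 :=
  (exists_blowupMap B).choose_spec

theorem blowupMap_str : blowupMap B ≫ W.ι ≫ P2xP2.str =
    (blowupIdeal B).subschemeι ≫ P2xP2xP2.str := by
  rw [← Category.assoc, blowupMap_ι, Category.assoc]
  rfl

theorem blowupMap_proj_zero : blowupMap B ≫ W.ι ≫ P2xP2.proj 0 =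
    (blowupIdeal B).subschemeι ≫ P2xP2xP2.proj 0 := by
  rw [← Category.assoc, blowupMap_ι, Category.assoc]
  rfl

theorem blowupMap_proj_one : blowupMap B ≫ W.ι ≫ P2xP2.proj 1 =
    (blowupIdeal B).subschemeι ≫ P2xP2xP2.proj 1 := by
  rw [← Category.assoc, blowupMap_ι, Category.assoc]
  rfl

theorem exists_lift_blowup (g : T ⟶ W) (z : T ⟶ P2) (hz : z ≫ P2.str = g ≫ W.ι ≫ P2xP2.str)
    (hxz : Incident (g ≫ W.ι ≫ P2xP2.str) 1 (g ≫ W.ι ≫ P2xP2.proj 0) z)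
    (hzy : Incident (g ≫ W.ι ≫ P2xP2.str) B z (g ≫ W.ι ≫ P2xP2.proj 1)) :
    ∃ h : T ⟶ (blowupIdeal B).subscheme, h ≫ blowupMap B = g := by
  obtain ⟨m, hm1, hm2⟩ := isProd_P2xP2xP2.exists_lift (g ≫ W.ι ≫ P2xP2.str)
    ![g ≫ W.ι ≫ P2xP2.proj 0, g ≫ W.ι ≫ P2xP2.proj 1, z] (fun a => by
      fin_cases a
      · simp [isProd_P2xP2.comp_str]
      · simp [isProd_P2xP2.comp_str]
      · exact hz)
  have h0 : m ≫ P2xP2xP2.proj 0 = g ≫ W.ι ≫ P2xP2.proj 0 := hm2 0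
  have h1 : m ≫ P2xP2xP2.proj 1 = g ≫ W.ι ≫ P2xP2.proj 1 := hm2 1
  have h2 : m ≫ P2xP2xP2.proj 2 = z := hm2 2
  have hle : blowupIdeal B ≤ m.ker := by
    rw [blowupIdeal_le_ker, h0, h1, h2, hm1]
    exact ⟨W.incident g, hxz, hzy⟩
  refine ⟨IsClosedImmersion.lift (blowupIdeal B).subschemeι m
    ((blowupIdeal B).ker_subschemeι.le.trans hle), ?_⟩
  rw [← cancel_mono W.ι, Category.assoc, blowupMap_ι, IsClosedImmersion.lift_fac_assoc]
  refine isProd_P2xP2.hom_ext _ _ fun a => ?_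
  rw [Category.assoc, Category.assoc]
  fin_cases a
  · exact h0
  · exact h1

theorem blowup_hom_ext {h h' : T ⟶ (blowupIdeal B).subscheme} (e : h ≫ blowupMap B = h' ≫ blowupMap B)
    (e2 : h ≫ (blowupIdeal B).subschemeι ≫ P2xP2xP2.proj 2 =
      h' ≫ (blowupIdeal B).subschemeι ≫ P2xP2xP2.proj 2) : h = h' := by
  rw [← cancel_mono (blowupIdeal B).subschemeι]
  refine isProd_P2xP2xP2.hom_ext _ _ fun a => ?_
  rw [Category.assoc, Category.assoc]
  fin_cases a
  · have := congrArg (fun f => f ≫ W.ι ≫ P2xP2.proj 0) e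
    simp only [Category.assoc, blowupMap_proj_zero] at this
    exact this
  · have := congrArg (fun f => f ≫ W.ι ≫ P2xP2.proj 1) e
    simp only [Category.assoc, blowupMap_proj_one] at this
    exact this
  · exact e2

theorem comap_blowup_comp {I : W.IdealSheafData} (hI : I = (minorIdeal B).comap W.ι) (g : T ⟶ W)
    {i j : Fin 3} (U : T.affineOpens) (hx : U.1 ≤ (g ≫ W.ι ≫ P2xP2.proj 0) ⁻¹ᵁ P2.chart i)
    (hy : U.1 ≤ (g ≫ W.ι ≫ P2xP2.proj 1) ⁻¹ᵁ P2.chart j) :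
    (I.comap g).ideal U = Ideal.span (Set.range (cross (co (g ≫ W.ι ≫ P2xP2.proj 0) i U.1 hx)
      (linCo (g ≫ W.ι ≫ P2xP2.str) B (g ≫ W.ι ≫ P2xP2.proj 1) j U.1 hy))) := by
  rw [hI, ← Scheme.IdealSheafData.comap_comp]
  exact comap_minorIdeal B (g ≫ W.ι) U hx hy

theorem exists_generator_cross {I : W.IdealSheafData} (hI : I = (minorIdeal B).comap W.ι) (g : T ⟶ W)
    (hg : IsEffectiveCartier (I.comap g)) (t : T) : ∃ (i j k : Fin 3) (U : T.affineOpens)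
      (hx : U.1 ≤ (g ≫ W.ι ≫ P2xP2.proj 0) ⁻¹ᵁ P2.chart i)
      (hy : U.1 ≤ (g ≫ W.ι ≫ P2xP2.proj 1) ⁻¹ᵁ P2.chart j), t ∈ U.1 ∧
      cross (co _ i U.1 hx) (linCo (g ≫ W.ι ≫ P2xP2.str) B _ j U.1 hy) k ∈ nonZeroDivisors Γ(T, U.1) ∧
      ∃ w : Fin 3 → Γ(T, U.1), ∀ l, cross (co _ i U.1 hx) (linCo (g ≫ W.ι ≫ P2xP2.str) B _ j U.1 hy) l =
        w l * cross (co _ i U.1 hx) (linCo (g ≫ W.ι ≫ P2xP2.str) B _ j U.1 hy) k := by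
  obtain ⟨i, hi⟩ := TopologicalSpace.Opens.mem_iSup.1
    (P2.iSup_chart.ge (show (g ≫ W.ι ≫ P2xP2.proj 0) t ∈ ⊤ from trivial))
  obtain ⟨j, hj⟩ := TopologicalSpace.Opens.mem_iSup.1
    (P2.iSup_chart.ge (show (g ≫ W.ι ≫ P2xP2.proj 1) t ∈ ⊤ from trivial))
  obtain ⟨V, hV⟩ : ∃ V : T.Opens, V = (g ≫ W.ι ≫ P2xP2.proj 0) ⁻¹ᵁ P2.chart i ⊓
    (g ≫ W.ι ≫ P2xP2.proj 1) ⁻¹ᵁ P2.chart j := ⟨_, rfl⟩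
  have hVx : V ≤ (g ≫ W.ι ≫ P2xP2.proj 0) ⁻¹ᵁ P2.chart i := hV.trans_le inf_le_left
  have hVy : V ≤ (g ≫ W.ι ≫ P2xP2.proj 1) ⁻¹ᵁ P2.chart j := hV.trans_le inf_le_right
  have hres : ∀ (U : T.Opens) (h : U ≤ V) (l : Fin 3), (T.presheaf.map (homOfLE h).op).hom
      (cross (co _ i V hVx) (linCo (g ≫ W.ι ≫ P2xP2.str) B _ j V hVy) l) =
      cross (co _ i U (h.trans hVx)) (linCo (g ≫ W.ι ≫ P2xP2.str) B _ j U (h.trans hVy)) l := by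
    intro U h l
    simp only [map_cross, map_co, map_linCo]
  obtain ⟨U, hU, k, htU, hk, w, hw⟩ := hg.exists_generator
    (cross (co _ i V hVx) (linCo (g ≫ W.ι ≫ P2xP2.str) B _ j V hVy)) (fun U h => by
      rw [comap_blowup_comp hI g U (h.trans hVx) (h.trans hVy)]
      simp only [hres]) (x := t) (hV ▸ ⟨hi, hj⟩)
  simp only [hres] at hk hw
  exact ⟨i, j, k, U, hU.trans hVx, hU.trans hVy, htU, hk, w, hw⟩

/-- Two lifts can differ only in the third point, and locally its coordinates are forced to be the
ratios `w` of the components of the cross product. -/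
theorem blowup_unique {I : W.IdealSheafData} (hI : I = (minorIdeal B).comap W.ι) (g : T ⟶ W)
    (hg : IsEffectiveCartier (I.comap g)) {h h' : T ⟶ (blowupIdeal B).subscheme}
    (e : h ≫ blowupMap B = g) (e' : h' ≫ blowupMap B = g) : h = h' := by
  refine blowup_hom_ext (e.trans e'.symm) (Scheme.hom_ext_of_forall _ _ fun t => ?_)
  obtain ⟨i, j, k, U, hx, hy, ht, hk, w, hw⟩ := exists_generator_cross hI g hg t
  have key : ∀ h : T ⟶ (blowupIdeal B).subscheme, h ≫ blowupMap B = g →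
      Incident (g ≫ W.ι ≫ P2xP2.str) 1 (g ≫ W.ι ≫ P2xP2.proj 0)
        (h ≫ (blowupIdeal B).subschemeι ≫ P2xP2xP2.proj 2) ∧
      Incident (g ≫ W.ι ≫ P2xP2.str) B (h ≫ (blowupIdeal B).subschemeι ≫ P2xP2xP2.proj 2)
        (g ≫ W.ι ≫ P2xP2.proj 1) := by
    rintro h rfl
    have := ((blowupIdeal_le_ker _).1 (blowupIdeal_le_ker_comp h)).2
    simp only [Category.assoc, blowupMap_proj_zero, blowupMap_proj_one, blowupMap_str] at this ⊢
    exact this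
  obtain ⟨h1, h2⟩ := le_chart_of_cross (key h e).1 (key h e).2 U hx hy hk w hw
  obtain ⟨h1', h2'⟩ := le_chart_of_cross (key h' e').1 (key h' e').2 U hx hy hk w hw
  have hU : ⊤ ≤ U.1.ι ⁻¹ᵁ U.1 := by simp
  refine ⟨U.1, ht, hom_P2_ext ?_ k (hU.trans (U.1.ι.preimage_mono h1))
    (hU.trans (U.1.ι.preimage_mono h1')) fun l => ?_⟩
  · have := congrArg (fun f => U.1.ι ≫ f ≫ W.ι ≫ P2xP2.str) (e.trans e'.symm)
    simp only [Category.assoc, blowupMap_str] at this ⊢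
    rw [isProd_P2xP2xP2.comp_str]
    exact this
  · rw [← appLE_co _ _ h1 hU, ← appLE_co _ _ h1' hU, h2, h2']

/-- The ratios `w` serve as coordinates of the third point. The identities that make `x × B y`
orthogonal to `x` and to `B y` remain true after division by the nonzerodivisor, and they are the
two missing equations. -/
theorem blowup_exists_local {I : W.IdealSheafData} (hI : I = (minorIdeal B).comap W.ι) (g : T ⟶ W)
    (hg : IsEffectiveCartier (I.comap g)) (t : T) : ∃ (U : T.Opens)
      (h : U.toScheme ⟶ (blowupIdeal B).subscheme), t ∈ U ∧ h ≫ blowupMap B = U.ι ≫ g := by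
  obtain ⟨i, j, k, U, hx, hy, ht, hk, w, hw⟩ := exists_generator_cross hI g hg t
  have hU : ⊤ ≤ U.1.ι ⁻¹ᵁ U.1 := by simp
  have hwk : w k = 1 := by
    have := hw k
    exact (sub_eq_zero.1 ((mem_nonZeroDivisors_iff_right.1 hk) (w k - 1) (by linear_combination -this)))
  obtain ⟨z, hz1, hz2, hz3⟩ := exists_hom_P2 (U.1.ι ≫ g ≫ W.ι ≫ P2xP2.str) k
    (fun l => (U.1.ι.appLE U.1 ⊤ hU).hom (w l)) (by rw [hwk, map_one])
  have key : ∀ v : Fin 3 → Γ(T, U.1), ∑ l, v l *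
      cross (co _ i U.1 hx) (linCo (g ≫ W.ι ≫ P2xP2.str) B _ j U.1 hy) l = 0 → ∑ l, v l * w l = 0 := by
    intro v hv
    refine (mem_nonZeroDivisors_iff_right.1 hk) _ ?_
    rw [← hv, Finset.sum_mul]
    exact Finset.sum_congr rfl fun l _ => by rw [hw l]; ring
  have k1 := congrArg (U.1.ι.appLE U.1 ⊤ hU).hom (key _ (sum_mul_cross_left _ _))
  have k2 := congrArg (U.1.ι.appLE U.1 ⊤ hU).hom (key _ (sum_mul_cross_right _ _))
  have hx' : ⊤ ≤ (U.1.ι ≫ g ≫ W.ι ≫ P2xP2.proj 0) ⁻¹ᵁ P2.chart i := hU.trans (U.1.ι.preimage_mono hx)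
  have hy' : ⊤ ≤ (U.1.ι ≫ g ≫ W.ι ≫ P2xP2.proj 1) ⁻¹ᵁ P2.chart j := hU.trans (U.1.ι.preimage_mono hy)
  rw [map_sum, map_zero] at k1 k2
  obtain ⟨h, hh⟩ := exists_lift_blowup (B := B) (U.1.ι ≫ g) z (by simpa only [Category.assoc] using hz2) (by
    simp only [Category.assoc]
    refine Incident.of_chart hx' hz1 ?_
    rw [← k1]
    simp only [map_mul, appLE_co, hz3, Matrix.one_apply, apply_ite, map_one, map_zero, ite_mul,
      zero_mul, one_mul, Finset.sum_ite_eq, Finset.mem_univ, if_true]) (by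
    simp only [Category.assoc]
    refine Incident.of_chart hz1 hy' ?_
    rw [← k2]
    refine Finset.sum_congr rfl fun l _ => ?_
    rw [map_mul, appLE_linCo _ _ _ _ _ hy', linCo, Finset.sum_mul]
    refine Finset.sum_congr rfl fun m _ => ?_
    rw [hz3]
    ring)
  exact ⟨U.1, h, ht, hh⟩

/-- The local lifts glue by uniqueness, since the ideal stays invertible on the overlaps of the open
cover. -/
theorem isBlowup_blowupMap {I : W.IdealSheafData} (hI : I = (minorIdeal B).comap W.ι)
    (hc : IsEffectiveCartier (I.comap (blowupMap B))) : IsBlowup (blowupMap B) I := by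
  refine ⟨hc, fun T g hg => ?_⟩
  choose U h hU hh using blowup_exists_local hI g hg
  let 𝒰 : T.OpenCover := T.openCoverOfIsOpenCover U (by
    rw [TopologicalSpace.IsOpenCover, eq_top_iff]
    exact fun t _ => TopologicalSpace.Opens.mem_iSup.2 ⟨t, hU t⟩)
  obtain ⟨m, hm⟩ : ∃ m : T ⟶ (blowupIdeal B).subscheme, ∀ a, (U a).ι ≫ m = h a := by
    refine ⟨𝒰.glueMorphisms h fun a b => ?_, 𝒰.ι_glueMorphisms h _⟩
    have e : pullback.fst (U a).ι (U b).ι ≫ (U a).ι ≫ g = pullback.snd (U a).ι (U b).ι ≫ (U b).ι ≫ g :=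
      pullback.condition_assoc _
    refine blowup_unique hI (pullback.fst (U a).ι (U b).ι ≫ (U a).ι ≫ g) ?_ ?_ ?_
    · rw [← Category.assoc, Scheme.IdealSheafData.comap_comp]
      exact hg.comap_isOpenImmersion _
    · exact (Category.assoc _ _ _).trans (congrArg _ (hh a))
    · exact (Category.assoc _ _ _).trans ((congrArg _ (hh b)).trans e.symm)
  have hmg : m ≫ blowupMap B = g := Scheme.Cover.hom_ext 𝒰 _ _ fun a =>
    (Category.assoc _ _ _).symm.trans ((congrArg (· ≫ blowupMap B) (hm a)).trans (hh a))
  exact ⟨m, hmg, fun h' e' => blowup_unique hI g hg e' hmg⟩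
end Z

/-! ### Coprime minors and regular sequences on a chart -/

/-- Names the remaining index, so that sums over the three coordinates can be expanded relative to a
chart. -/
theorem exists_third {i j : Fin 3} (hij : i ≠ j) : ∃ n, n ≠ i ∧ n ≠ j ∧ (∀ l, l = i ∨ l = j ∨ l = n) ∧
    ∀ {R : Type} [CommRing R] (f : Fin 3 → R), ∑ l, f l = f i + f j + f n := by
  have hex : ∃ n, n ≠ i ∧ n ≠ j ∧ (∀ l, l = i ∨ l = j ∨ l = n) := by revert i j; decide
  obtain ⟨n, h1, h2, h3⟩ := hex
  refine ⟨n, h1, h2, h3, fun f => ?_⟩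
  have hu : (Finset.univ : Finset (Fin 3)) = {i, j, n} := by
    ext l
    simpa using h3 l
  rw [hu, Finset.sum_insert (by simp [hij, h1.symm]), Finset.sum_insert (by simp [h2.symm]),
    Finset.sum_singleton, add_assoc]

/-- A quadratic form that vanishes on an affine chart is zero, so `A` is antisymmetric; an
antisymmetric matrix of odd size is singular. -/
theorem det_eq_zero_of_quadratic {A : Matrix (Fin 3) (Fin 3) ℂ} (i : Fin 3)
    (h : ∀ x : Fin 3 → ℂ, x i = 1 → ∑ m, x m * ∑ l, A m l * x l = 0) : A.det = 0 := by
  obtain ⟨j, hj⟩ : ∃ j, i ≠ j := (exists_ne i).imp fun _ => Ne.symm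
  obtain ⟨n, hni, hnj, hall, hs⟩ := exists_third hj
  have key : ∀ s t : ℂ, A i i + s * (A i j + A j i) + t * (A i n + A n i) + s ^ 2 * A j j +
      t ^ 2 * A n n + s * t * (A j n + A n j) = 0 := by
    intro s t
    have := h (fun l => if l = i then 1 else if l = j then s else t) (by simp)
    simp only [hs, if_true, hj.symm, hni, hnj, if_false] at this
    linear_combination this
  -- The values at these six points determine the six coefficients of the form.
  have e0 := key 0 0
  have e1 := key 1 0
  have e2 := key (-1) 0
  have e3 := key 0 1
  have e4 := key 0 (-1)
  have e5 := key 1 1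
  have hT : A.transpose = -A := by
    have aii : A i i = 0 := by linear_combination e0
    have ajj : A j j = 0 := by linear_combination (e1 + e2) / 2 - e0
    have ann : A n n = 0 := by linear_combination (e3 + e4) / 2 - e0
    have aij : A i j + A j i = 0 := by linear_combination (e1 - e2) / 2
    have ain : A i n + A n i = 0 := by linear_combination (e3 - e4) / 2
    have ajn : A j n + A n j = 0 := by linear_combination e5 - e1 - e3 + e0
    ext a b
    rw [Matrix.transpose_apply, Matrix.neg_apply]
    rcases hall a with rfl | rfl | rfl <;> rcases hall b with rfl | rfl | rfl <;> grind
  have := congrArg Matrix.det hT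
  rw [Matrix.det_transpose, Matrix.det_neg] at this
  simp at this
  linear_combination this / 2

section relPrime
open Polynomial

/-- Modulo `d` the vector `b = B y` equals `b i` times `x`, hence `y = A b` equals `b i` times `a =
A x`. Pairing with `x` and using `x · y = 0` shows that `d` divides `b i * (x · a)`, and `y j = 1`
removes the factor `b i`. So `d` divides the nonzero element `x · a`, which has degree zero in the
polynomial variable, and `d` is a constant. The coordinates `y j = 1` and `y n = X` then make it a
unit. -/
theorem isUnit_of_dvd_dvd {S : Type} [CommRing S] [IsDomain S] {x : Fin 3 → S} {i j n : Fin 3}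
    (hs : ∀ {R : Type} [CommRing R] (f : Fin 3 → R), ∑ l, f l = f i + f j + f n)
    (hxi : x i = 1) {y : Fin 3 → S[X]} (hyj : y j = 1) (hyn : y n = X)
    (hyi : y i = - C (x j) - C (x n) * X) (σ : ℂ →+* S) {A B : Matrix (Fin 3) (Fin 3) ℂ}
    (hAB : A * B = 1) (hQ : ∑ m, x m * ∑ l, σ (A m l) * x l ≠ 0) {d : S[X]}
    (hd : ∀ l, d ∣ ∑ m, C (σ (B l m)) * y m - C (x l) * ∑ m, C (σ (B i m)) * y m) : IsUnit d := by
  set b : Fin 3 → S[X] := fun l => ∑ m, C (σ (B l m)) * y m with hb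
  set a : Fin 3 → S := fun m => ∑ l, σ (A m l) * x l with ha
  have h1 : ∀ m, y m = ∑ l, C (σ (A m l)) * b l := by
    intro m
    have : ∀ p, ∑ l, σ (A m l) * σ (B l p) = σ ((1 : Matrix (Fin 3) (Fin 3) ℂ) m p) := fun p => by
      rw [← hAB, Matrix.mul_apply, map_sum]
      simp only [map_mul]
    simp only [hb, Finset.mul_sum]
    rw [Finset.sum_comm]
    simp only [← mul_assoc, ← C_mul, ← Finset.sum_mul, ← map_sum, this]
    simp [Matrix.one_apply, apply_ite σ]
  have h2 : ∀ m, d ∣ y m - b i * C (a m) := by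
    intro m
    have : y m - b i * C (a m) = ∑ l, C (σ (A m l)) * (b l - C (x l) * b i) := by
      rw [h1 m, ha, map_sum, Finset.mul_sum, ← Finset.sum_sub_distrib]
      refine Finset.sum_congr rfl fun l _ => ?_
      rw [C_mul]
      ring
    rw [this]
    exact Finset.dvd_sum fun l _ => (hd l).mul_left _
  have hxy : ∑ m, C (x m) * y m = 0 := by
    rw [hs, hxi, hyj, hyn, hyi, C_1]
    ring
  have h3 : d ∣ b i * C (∑ m, x m * a m) := by
    have : b i * C (∑ m, x m * a m) = - ∑ m, C (x m) * (y m - b i * C (a m)) := by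
      rw [map_sum, Finset.mul_sum]
      simp only [mul_sub, Finset.sum_sub_distrib, hxy, zero_sub, neg_neg]
      refine Finset.sum_congr rfl fun m _ => ?_
      rw [C_mul]
      ring
    rw [this, dvd_neg]
    exact Finset.dvd_sum fun l _ => (h2 l).mul_left _
  have h4 : d ∣ C (∑ m, x m * a m) := by
    have := ((h2 j).mul_left (C (∑ m, x m * a m))).add (h3.mul_left (C (a j)))
    rw [hyj] at this
    convert this using 1
    ring
  have h5 : d.natDegree = 0 := by
    have := natDegree_le_of_dvd h4 (C_ne_zero.2 hQ)
    rwa [natDegree_C, Nat.le_zero] at this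
  obtain ⟨d0, rfl⟩ : ∃ d0, d = C d0 := ⟨_, eq_C_of_natDegree_eq_zero h5⟩
  have hbi : b i = C (σ (B i j) - σ (B i i) * x j) + C (σ (B i n) - σ (B i i) * x n) * X := by
    simp only [hb]
    rw [hs, hyj, hyn, hyi]
    simp only [map_sub, map_mul]
    ring
  have hj := h2 j
  have hn := h2 n
  rw [hyj, hbi, C_dvd_iff_dvd_coeff] at hj
  rw [hyn, hbi, C_dvd_iff_dvd_coeff] at hn
  have j0 := hj 0
  have j1 := hj 1
  have n1 := hn 1
  simp only [coeff_sub, coeff_mul_C, coeff_add, coeff_C_mul, coeff_C, coeff_X, coeff_one] at j0 j1 n1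
  norm_num at j0 j1 n1
  rw [isUnit_C, isUnit_iff_dvd_one]
  -- With `b i = β + γ X`, the constant divides `1 - β * a j`, `γ * a j` and `1 - γ * a n`; this
  -- combination of the three equals 1.
  have := (j0.add (n1.mul_left ((σ (B i j) - σ (B i i) * x j) * a j))).add
    (j1.mul_left ((σ (B i j) - σ (B i i) * x j) * a n))
  convert this using 1
  ring

/-- A common divisor also divides `C M`. If `N ≠ 0`, its degree is zero and it is a common divisor
of `M` and `N`; if `N = 0`, then `M` is already a unit. -/
theorem isRelPrime_blowup {S : Type} [CommRing S] [IsDomain S] {M N : S[X]} (h : IsRelPrime M N) :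
    IsRelPrime (C N) (C M + C N * X : S[X][X]) := by
  intro d h1 h2
  have h3 : d ∣ C M := by
    have := h2.sub (h1.mul_right X)
    rwa [add_sub_cancel_right] at this
  by_cases hN : N = 0
  · have : IsUnit M := h dvd_rfl (hN ▸ dvd_zero M)
    exact isUnit_of_dvd_unit h3 (isUnit_C.2 this)
  · have h5 : d.natDegree = 0 := by
      have := natDegree_le_of_dvd h1 (C_ne_zero.2 hN)
      rwa [natDegree_C, Nat.le_zero] at this
    obtain ⟨d0, rfl⟩ : ∃ d0, d = C d0 := ⟨_, eq_C_of_natDegree_eq_zero h5⟩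
    rw [C_dvd_iff_dvd_coeff] at h1 h3
    have e1 := h1 0
    have e3 := h3 0
    rw [coeff_C_zero] at e1 e3
    exact isUnit_C.2 (h e3 e1)

/-- Shows that the kernel of `φ` lies in `I`. When `φ` also kills `I`, questions modulo `I` can be
settled in the polynomial ring `R`. -/
theorem mem_of_retraction {A R : Type*} [CommRing A] [CommRing R] {I : Ideal A} {φ : A →+* R}
    {ψ : R →+* A} (h : (Ideal.Quotient.mk I).comp (ψ.comp φ) = Ideal.Quotient.mk I) (g : A) :
    ψ (φ g) - g ∈ I := by
  rw [← Ideal.Quotient.eq]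
  exact congrArg (fun f => f g) h

end relPrime

section
variable {T : Scheme.{0}} {k : ℕ} {s : T ⟶ SpecC} {q : Fin k → (T ⟶ P2)}

theorem IsProd.ringHom_ext (hq : IsProd s q) (j : Fin k → Fin 3) {R : Type*} [CommRing R]
    {φ ψ : Γ(T, chart q j) →+* R} (h : ∀ r, φ (scalars s _ r) = ψ (scalars s _ r))
    (h' : ∀ a l, φ (coordinate q j a l) = ψ (coordinate q j a l)) : φ = ψ := by
  ext g
  obtain ⟨G, rfl⟩ := (hq.chartEval_bijective j).2 g
  refine congrArg (fun f : ChartRing j →+* R => f G) (?_ : φ.comp (chartEval s q j) = ψ.comp (chartEval s q j))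
  refine MvPolynomial.ringHom_ext (fun r => ?_) fun v => ?_
  · rw [RingHom.comp_apply, RingHom.comp_apply, chartEval_C, h]
  · rw [RingHom.comp_apply, RingHom.comp_apply, ← chartVar_ne, chartEval_chartVar, h']

/-- Evaluation at the quotients of variables in the fraction field is a generic point of the chart.
By homogeneity, vanishing there means that `F` itself vanishes. -/
theorem IsProd.dehomogenize_ne_zero (hq : IsProd s q) {F : MvPolynomial (Fin k × Fin 3) ℂ}
    {d : Fin k → ℕ} (hF : IsMultihomogeneous F d) (hF0 : F ≠ 0) (j : Fin k → Fin 3) :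
    dehomogenize s q F j ≠ 0 := by
  intro h0
  let K := FractionRing (MvPolynomial (Fin k × Fin 3) ℂ)
  let ι : MvPolynomial (Fin k × Fin 3) ℂ →+* K := algebraMap _ _
  have hι : Function.Injective ι := IsFractionRing.injective _ _
  have hX : ∀ v, ι (MvPolynomial.X v) ≠ 0 := fun v => by
    rw [map_ne_zero_iff _ hι]
    exact MvPolynomial.X_ne_zero v
  obtain ⟨φ, h1, h2⟩ := hq.exists_ringHom j (ι.comp MvPolynomial.C)
    (fun a l => ι (MvPolynomial.X (a, l)) / ι (MvPolynomial.X (a, j a))) (fun a => div_self (hX _))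
  have h3 := map_dehomogenize (s := s) j φ F
  rw [h0, map_zero, show φ.comp (scalars s _) = ι.comp MvPolynomial.C from RingHom.ext h1] at h3
  simp only [h2] at h3
  have h4 := eval₂_multihomogeneous hF (ι.comp MvPolynomial.C) (fun a => ι (MvPolynomial.X (a, j a)))
    (fun v => ι (MvPolynomial.X v) / ι (MvPolynomial.X (v.1, j v.1)))
  rw [← h3, mul_zero] at h4
  simp only [mul_div_cancel₀ _ (hX _)] at h4
  have h5 := MvPolynomial.hom_eval₂ F MvPolynomial.C ι MvPolynomial.X
  rw [MvPolynomial.eval₂_eta, h4] at h5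
  exact hF0 ((map_eq_zero_iff _ hι).1 h5)

theorem IsProd.isEffectiveCartier (hq : IsProd s q) {F : MvPolynomial (Fin k × Fin 3) ℂ}
    {d : Fin k → ℕ} (hF : IsMultihomogeneous F d) (hF0 : F ≠ 0) : IsEffectiveCartier (zeroIdeal s q F) := by
  intro t
  obtain ⟨j, hj⟩ := TopologicalSpace.Opens.mem_iSup.1 ((iSup_chart q).ge (show t ∈ ⊤ from trivial))
  have := hq.isDomain j
  exact ⟨⟨_, hq.isAffineOpen_chart j⟩, hj, _,
    mem_nonZeroDivisors_of_ne_zero (hq.dehomogenize_ne_zero hF hF0 j), hq.zeroIdeal_chart hF j⟩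

theorem bil_ne_zero {M : Matrix (Fin 3) (Fin 3) ℂ} (hM : M ≠ 0) {a b : Fin k} (hab : a ≠ b) :
    bil M a b ≠ 0 := by
  intro h
  refine hM (Matrix.ext fun l m => ?_)
  have := congrArg (MvPolynomial.eval (fun v => if v = (a, l) then 1 else if v = (b, m) then 1 else 0)) h
  simpa [bil, hab, hab.symm, Prod.ext_iff] using this

/-- If every `y_l` with `l ≠ i` vanished at `t`, then after normalizing `x_i = y_i = 1` the
incidence relation would put 1 in the maximal ideal. -/
theorem exists_ne_of_incident {x y : T ⟶ P2} (h : Incident s 1 x y) (t : T) (i : Fin 3)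
    (hi : x t ∈ P2.chart i) : ∃ j, i ≠ j ∧ y t ∈ P2.chart j := by
  obtain ⟨j, hj⟩ := TopologicalSpace.Opens.mem_iSup.1 (P2.iSup_chart.ge (show y t ∈ ⊤ from trivial))
  by_cases hij : i = j
  swap
  · exact ⟨j, hij, hj⟩
  subst hij
  obtain ⟨U, hU⟩ : ∃ U : T.Opens, U = x ⁻¹ᵁ P2.chart i ⊓ y ⁻¹ᵁ P2.chart i := ⟨_, rfl⟩
  have hx : U ≤ x ⁻¹ᵁ P2.chart i := hU.trans_le inf_le_left
  have hy : U ≤ y ⁻¹ᵁ P2.chart i := hU.trans_le inf_le_right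
  have ht : t ∈ U := hU ▸ ⟨hi, hj⟩
  by_contra! hcon
  have h5 : ∀ l, i ≠ l → T.presheaf.germ U t ht (co y i U hy l) ∈ IsLocalRing.maximalIdeal (T.presheaf.stalk t) :=
    fun l hl => by
      rw [IsLocalRing.mem_maximalIdeal, mem_nonunits_iff, ← T.mem_basicOpen _ _ ht, basicOpen_co]
      exact fun h => hcon l hl h.2
  obtain ⟨l, hl⟩ : ∃ l, i ≠ l := (exists_ne i).imp fun _ => Ne.symm
  obtain ⟨n, hni, hnl, -, hs⟩ := exists_third hl
  have h1 := incident_one h hx hy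
  rw [hs, co_self, co_self, mul_one] at h1
  have h6 : (1 : T.presheaf.stalk t) ∈ IsLocalRing.maximalIdeal (T.presheaf.stalk t) := by
    have h7 : (1 : T.presheaf.stalk t) = -(T.presheaf.germ U t ht (co x i U hx l) *
        T.presheaf.germ U t ht (co y i U hy l)) - (T.presheaf.germ U t ht (co x i U hx n) *
        T.presheaf.germ U t ht (co y i U hy n)) := by
      have := congrArg (T.presheaf.germ U t ht) h1
      simp only [map_add, map_mul, map_one, map_zero] at this
      linear_combination this
    rw [h7]
    exact sub_mem (neg_mem (Ideal.mul_mem_left _ _ (h5 l hl))) (Ideal.mul_mem_left _ _ (h5 n hni.symm))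
  exact (Ideal.ne_top_iff_one _).1 (IsLocalRing.maximalIdeal.isMaximal _).ne_top h6

end

section algebra
open Polynomial

variable {T : Scheme.{0}} {s : T ⟶ SpecC} {q : Fin 3 → (T ⟶ P2)}

theorem map_dehomogenize_bil {k : ℕ} {q : Fin k → (T ⟶ P2)} {R : Type*} [CommRing R] {j : Fin k → Fin 3}
    (φ : Γ(T, chart q j) →+* R) (M : Matrix (Fin 3) (Fin 3) ℂ) (a b : Fin k) :
    φ (dehomogenize s q (bil M a b) j) = ∑ l, ∑ m, φ (scalars s _ (M l m)) *
      φ (coordinate q j a l) * φ (coordinate q j b m) := by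
  rw [dehomogenize_eq_dehom, dehom_bil]
  simp only [map_sum, map_mul]
  rfl

theorem map_dehomogenize_bil_one {k : ℕ} {q : Fin k → (T ⟶ P2)} {R : Type*} [CommRing R] {j : Fin k → Fin 3}
    (φ : Γ(T, chart q j) →+* R) (a b : Fin k) :
    φ (dehomogenize s q (bil 1 a b) j) = ∑ l, φ (coordinate q j a l) * φ (coordinate q j b l) := by
  rw [map_dehomogenize_bil]
  simp only [Matrix.one_apply, apply_ite, map_one, map_zero, ite_mul, zero_mul, one_mul,
    Finset.sum_ite_eq, Finset.mem_univ, if_true]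

/-- Since `x_i = 1` for `i = j 0`, the equation `x · y = 0` can be solved for `y_i`. The quotient by
it embeds in the polynomial ring `P`, a domain in which `x · z` is not zero. The superfluous
variables of `P` do no harm, because only a retraction is needed. -/
theorem IsProd.mem_of_mul_mem_one (hq : IsProd s q) {j : Fin 3 → Fin 3} (h1 : j 0 ≠ j 1) (h2 : j 0 ≠ j 2)
    {g : Γ(T, chart q j)}
    (hg : dehomogenize s q (bil 1 0 2) j * g ∈ Ideal.span {dehomogenize s q (bil 1 0 1) j}) :
    g ∈ Ideal.span {dehomogenize s q (bil 1 0 1) j} := by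
  obtain ⟨n, hn0, hn1, hall, hs⟩ := exists_third h1
  let P := MvPolynomial (Fin 3 × Fin 3) ℂ
  obtain ⟨φ, hφ, hφ'⟩ := hq.exists_ringHom j (MvPolynomial.C : ℂ →+* P)
    ![fun l => if l = j 0 then 1 else MvPolynomial.X (0, l),
      fun l => if l = j 0 then - (if j 1 = j 0 then 1 else MvPolynomial.X (0, j 1)) -
        (if n = j 0 then 1 else MvPolynomial.X (0, n)) * MvPolynomial.X (1, n)
        else if l = j 1 then 1 else MvPolynomial.X (1, l),
      fun l => if l = j 2 then 1 else MvPolynomial.X (2, l)] (fun a => by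
        fin_cases a
        · exact if_pos rfl
        · exact (if_neg h1.symm).trans (if_pos rfl)
        · exact if_pos rfl)
  have v0 : ∀ l, φ (coordinate q j 0 l) = if l = j 0 then 1 else MvPolynomial.X (0, l) := hφ' 0
  have v1 : ∀ l, φ (coordinate q j 1 l) = if l = j 0 then - (if j 1 = j 0 then 1 else MvPolynomial.X (0, j 1)) -
        (if n = j 0 then 1 else MvPolynomial.X (0, n)) * MvPolynomial.X (1, n)
        else if l = j 1 then 1 else MvPolynomial.X (1, l) := hφ' 1
  have v2 : ∀ l, φ (coordinate q j 2 l) = if l = j 2 then 1 else MvPolynomial.X (2, l) := hφ' 2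
  let ψ : P →+* Γ(T, chart q j) := MvPolynomial.eval₂Hom (scalars s _) (fun v => coordinate q j v.1 v.2)
  have hψX : ∀ v, ψ (MvPolynomial.X v) = coordinate q j v.1 v.2 := fun v => MvPolynomial.eval₂Hom_X' _ _ _
  have hf1 := map_dehomogenize_bil_one (s := s) (q := q) (RingHom.id Γ(T, chart q j)) 0 1
  simp only [RingHom.id_apply] at hf1
  have hret : (Ideal.Quotient.mk (Ideal.span {dehomogenize s q (bil 1 0 1) j})).comp (ψ.comp φ) =
      Ideal.Quotient.mk _ := by
    refine hq.ringHom_ext j (fun r => ?_) fun a l => ?_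
    · simp only [RingHom.comp_apply, hφ]
      rw [show ψ (MvPolynomial.C r) = scalars s _ r from MvPolynomial.eval₂Hom_C _ _ _]
    · simp only [RingHom.comp_apply]
      rw [Ideal.Quotient.eq]
      have ha : a = 0 ∨ a = 1 ∨ a = 2 := by revert a; decide
      rcases ha with rfl | rfl | rfl
      · rw [v0]
        split_ifs with h
        · rw [map_one, h, coordinate_self, sub_self]
          exact zero_mem _
        · rw [hψX, sub_self]
          exact zero_mem _
      · rw [v1]
        rcases hall l with rfl | rfl | rfl
        · rw [if_pos rfl, ← neg_mem_iff, Ideal.mem_span_singleton]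
          refine dvd_of_eq ?_
          rw [hf1, hs, coordinate_self, coordinate_self, if_neg h1.symm, if_neg hn0]
          simp only [map_sub, map_neg, map_mul, hψX]
          ring
        · rw [if_neg h1.symm, if_pos rfl, map_one, coordinate_self, sub_self]
          exact zero_mem _
        · rw [if_neg hn0, if_neg hn1, hψX, sub_self]
          exact zero_mem _
      · rw [v2]
        split_ifs with h
        · rw [map_one, h, coordinate_self, sub_self]
          exact zero_mem _
        · rw [hψX, sub_self]
          exact zero_mem _
  have hφ1 : φ (dehomogenize s q (bil 1 0 1) j) = 0 := by
    rw [map_dehomogenize_bil_one, hs]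
    simp only [v0, v1, h1.symm, hn0, hn1, if_true, if_false]
    ring
  have hφ2 : φ (dehomogenize s q (bil 1 0 2) j) ≠ 0 := by
    intro h0
    -- At the point with `z_i = 1`, where `i = j 0`, and all other variables zero, the form takes
    -- the value 1.
    have := congrArg (MvPolynomial.eval (fun v : Fin 3 × Fin 3 => if v = (2, j 0) then 1 else 0)) h0
    rw [map_dehomogenize_bil_one, hs] at this
    simp only [v0, v2, h1.symm, hn0, h2, if_true, if_false] at this
    split_ifs at this <;> simp at this
  obtain ⟨c, hc⟩ := Ideal.mem_span_singleton'.1 hg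
  have h3 := congrArg φ hc
  rw [map_mul, map_mul, hφ1, mul_zero] at h3
  have h4 : φ g = 0 := (mul_eq_zero.1 h3.symm).resolve_left hφ2
  have h5 := mem_of_retraction hret g
  rw [h4, map_zero, zero_sub] at h5
  exact (Submodule.neg_mem_iff _).1 h5

theorem cross_third {R : Type*} [CommRing R] (x b : Fin 3 → R) {i k p : Fin 3} (hik : i ≠ k) (hpi : p ≠ i)
    (hpk : p ≠ k) : cross x b k = x i * b p - x p * b i ∨ cross x b k = - (x i * b p - x p * b i) := by
  have : (k + 1 = i ∧ k + 2 = p) ∨ (k + 1 = p ∧ k + 2 = i) := by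
    revert i k p; decide
  rcases this with ⟨rfl, rfl⟩ | ⟨rfl, rfl⟩
  · exact Or.inl rfl
  · refine Or.inr ?_
    rw [cross]
    ring

/-- Because `x (j 0) = 1`, the two equations express the coordinates of `y` and `z` with index `j 0`
through the others. What is left are the coordinates of `x`, held by `S`, and one free coordinate
each of `y` and `z`, the two polynomial variables. -/
theorem IsProd.exists_retraction (hq : IsProd s q) {j : Fin 3 → Fin 3}
    {n p : Fin 3} (hn0 : n ≠ j 0) (hn1 : n ≠ j 1)
    (hsn : ∀ {R : Type} [CommRing R] (f : Fin 3 → R), ∑ l, f l = f (j 0) + f (j 1) + f n)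
    (hp0 : p ≠ j 0) (hp2 : p ≠ j 2)
    (hsp : ∀ {R : Type} [CommRing R] (f : Fin 3 → R), ∑ l, f l = f (j 0) + f (j 2) + f p)
    {S : Type} [CommRing S] (σ : ℂ →+* S) {x : Fin 3 → S} (hx0 : x (j 0) = 1)
    {ψ₀ : S →+* Γ(T, chart q j)} (hψσ : ∀ r, ψ₀ (σ r) = scalars s _ r)
    (hψx : ∀ l, ψ₀ (x l) = coordinate q j 0 l)
    {y : Fin 3 → S[X]} (hyj : y (j 1) = 1) (hyn : y n = X)
    (hyi : y (j 0) = - C (x (j 1)) - C (x n) * X)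
    {z : Fin 3 → S[X][X]} (hzk : z (j 2) = 1) (hzp : z p = X)
    (hzi : z (j 0) = - C (C (x (j 2))) - C (C (x p)) * X) :
    ∃ (φ : Γ(T, chart q j) →+* S[X][X])
      (ψ : S[X][X] →+* Γ(T, chart q j)),
      (∀ g, ψ (φ g) - g ∈ Ideal.span {dehomogenize s q (bil 1 0 1) j} ⊔
        Ideal.span {dehomogenize s q (bil 1 0 2) j}) ∧
      φ (dehomogenize s q (bil 1 0 1) j) = 0 ∧ φ (dehomogenize s q (bil 1 0 2) j) = 0 ∧
      (∀ r, φ (scalars s _ r) = C (C (σ r))) ∧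
      (∀ l, φ (coordinate q j 0 l) = C (C (x l))) ∧ (∀ l, φ (coordinate q j 1 l) = C (y l)) ∧
      ∀ l, φ (coordinate q j 2 l) = z l := by
  obtain ⟨φ, hφ, hφ'⟩ := hq.exists_ringHom j
    (((C : S[X] →+* _).comp C).comp σ)
    ![fun l => C (C (x l)), fun l => C (y l), z] (fun a => by
        fin_cases a
        · exact (congrArg (fun a => C (C a)) hx0).trans (by simp)
        · exact (congrArg C hyj).trans C_1
        · exact hzk)
  have v0 : ∀ l, φ (coordinate q j 0 l) = C (C (x l)) := hφ' 0
  have v1 : ∀ l, φ (coordinate q j 1 l) = C (y l) := hφ' 1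
  have v2 : ∀ l, φ (coordinate q j 2 l) = z l := hφ' 2
  let ψ₁ : S[X] →+* Γ(T, chart q j) := eval₂RingHom ψ₀ (coordinate q j 1 n)
  obtain ⟨ψ, hψC, hψX⟩ : ∃ ψ : S[X][X] →+* Γ(T, chart q j),
      (∀ a, ψ (C a) = ψ₁ a) ∧ ψ X = coordinate q j 2 p :=
    ⟨eval₂RingHom ψ₁ (coordinate q j 2 p), fun a => eval₂_C _ _, eval₂_X _ _⟩
  have hψ₁C : ∀ a, ψ₁ (C a) = ψ₀ a := fun a => eval₂_C _ _
  have hψ₁X : ψ₁ X = coordinate q j 1 n := eval₂_X _ _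
  have hf1 := map_dehomogenize_bil_one (s := s) (q := q) (RingHom.id Γ(T, chart q j)) 0 1
  have hf2 := map_dehomogenize_bil_one (s := s) (q := q) (RingHom.id Γ(T, chart q j)) 0 2
  simp only [RingHom.id_apply] at hf1 hf2
  rw [hsn, coordinate_self, coordinate_self] at hf1
  rw [hsp, coordinate_self, coordinate_self] at hf2
  have hln : ∀ l, l = j 0 ∨ l = j 1 ∨ l = n := fun l => by
    by_contra! h
    have := hsn (fun m => if m = l then (1 : ℤ) else 0)
    simp [h.1.symm, h.2.1.symm, h.2.2.symm] at this
  have hlp : ∀ l, l = j 0 ∨ l = j 2 ∨ l = p := fun l => by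
    by_contra! h
    have := hsp (fun m => if m = l then (1 : ℤ) else 0)
    simp [h.1.symm, h.2.1.symm, h.2.2.symm] at this
  refine ⟨φ, ψ, ?_, ?_, ?_, hφ, v0, v1, v2⟩
  · refine mem_of_retraction (A := Γ(T, chart q j)) (R := S[X][X]) (φ := φ) (ψ := ψ) ?_
    refine hq.ringHom_ext j (fun r => ?_) fun a l => ?_
    · simp only [RingHom.comp_apply, hφ, hψC, hψ₁C]
      rw [hψσ]
    · simp only [RingHom.comp_apply]
      rw [Ideal.Quotient.eq]
      have ha : a = 0 ∨ a = 1 ∨ a = 2 := by revert a; decide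
      rcases ha with rfl | rfl | rfl
      · rw [v0, hψC, hψ₁C, hψx, sub_self]
        exact zero_mem _
      · rw [v1, hψC]
        rcases hln l with rfl | rfl | rfl
        · refine Ideal.mem_sup_left ?_
          rw [hyi, ← neg_mem_iff, Ideal.mem_span_singleton]
          refine dvd_of_eq ?_
          rw [hf1]
          simp only [map_sub, map_neg, map_mul, hψ₁C, hψx, hψ₁X]
          ring
        · rw [hyj, map_one, coordinate_self, sub_self]
          exact zero_mem _
        · rw [hyn, hψ₁X, sub_self]
          exact zero_mem _
      · rw [v2]
        rcases hlp l with rfl | rfl | rfl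
        · refine Ideal.mem_sup_right ?_
          rw [hzi, ← neg_mem_iff, Ideal.mem_span_singleton]
          refine dvd_of_eq ?_
          rw [hf2]
          rw [map_sub, map_neg, map_mul, hψC, hψC, hψ₁C, hψ₁C, hψx, hψx, hψX]
          ring
        · rw [hzk, map_one, coordinate_self, sub_self]
          exact zero_mem _
        · rw [hzp, hψX, sub_self]
          exact zero_mem _
  · rw [map_dehomogenize_bil_one, hsn]
    simp only [v0, v1, hx0, hyi, hyj, hyn, map_sub, map_neg, map_mul, map_one]
    ring
  · rw [map_dehomogenize_bil_one, hsp]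
    simp only [v0, v2, hx0, hzi, hzk, hzp, map_one]
    ring

/-- After elimination the third form is `C M + C N * X`, and the `j 2`-th component of the cross
product is `C N` up to sign. The first claim holds because the form is a nonzero element of a
domain. For the second, coprimality in a factorial ring turns divisibility of `C N * φ g` by the
form into divisibility of `φ g`, which `ψ` carries back. -/
theorem IsProd.blowup_regular_aux (hq : IsProd s q) {j : Fin 3 → Fin 3} (h1 : j 0 ≠ j 1) (h2 : j 0 ≠ j 2)
    {A B : Matrix (Fin 3) (Fin 3) ℂ} (hAB : A * B = 1)
    {S : Type} [CommRing S] [IsDomain S] [UniqueFactorizationMonoid S] (σ : ℂ →+* S) {x : Fin 3 → S}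
    (hx0 : x (j 0) = 1) {ψ₀ : S →+* Γ(T, chart q j)} (hψσ : ∀ r, ψ₀ (σ r) = scalars s _ r)
    (hψx : ∀ l, ψ₀ (x l) = coordinate q j 0 l) (hQ : ∑ m, x m * ∑ l, σ (A m l) * x l ≠ 0) {I : Ideal Γ(T, chart q j)}
    (hI : I = Ideal.span {dehomogenize s q (bil 1 0 1) j} ⊔ Ideal.span {dehomogenize s q (bil 1 0 2) j}) :
    (∀ g, dehomogenize s q (bil B 2 1) j * g ∈ I → g ∈ I) ∧
    ∀ g, cross (coordinate q j 0) (fun l => ∑ m, scalars s _ (B l m) * coordinate q j 1 m) (j 2) * g ∈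
      I ⊔ Ideal.span {dehomogenize s q (bil B 2 1) j} →
      g ∈ I ⊔ Ideal.span {dehomogenize s q (bil B 2 1) j} := by
  obtain ⟨n, hn0, hn1, -, hsn⟩ := exists_third h1
  obtain ⟨p, hp0, hp2, hlp, hsp⟩ := exists_third h2
  obtain ⟨y, hyi, hyj, hyn⟩ : ∃ y : Fin 3 → S[X], y (j 0) = - C (x (j 1)) - C (x n) * X ∧ y (j 1) = 1 ∧
      y n = X := ⟨fun l => if l = j 0 then - C (x (j 1)) - C (x n) * X else if l = j 1 then 1 else X,
    if_pos rfl, (if_neg h1.symm).trans (if_pos rfl), (if_neg hn0).trans (if_neg hn1)⟩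
  obtain ⟨z, hzi, hzk, hzp⟩ : ∃ z : Fin 3 → S[X][X], z (j 0) = - C (C (x (j 2))) - C (C (x p)) * X ∧
      z (j 2) = 1 ∧ z p = X :=
    ⟨fun l => if l = j 0 then - C (C (x (j 2))) - C (C (x p)) * X else if l = j 2 then 1 else X,
    if_pos rfl, (if_neg h2.symm).trans (if_pos rfl), (if_neg hp0).trans (if_neg hp2)⟩
  obtain ⟨φ, ψ, hψφ, hf1, hf2, hφ, v0, v1, v2⟩ := hq.exists_retraction hn0 hn1 hsn hp0 hp2 hsp
    σ hx0 hψσ hψx hyj hyn hyi hzk hzp hzi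
  rw [← hI] at hψφ
  have hker : ∀ g ∈ I, φ g = 0 := by
    have : I ≤ RingHom.ker φ := by
      rw [hI, sup_le_iff, Ideal.span_singleton_le_iff_mem, Ideal.span_singleton_le_iff_mem]
      exact ⟨hf1, hf2⟩
    exact fun g hg => this hg
  let b : Fin 3 → S[X] := fun l => ∑ m, C (σ (B l m)) * y m
  let M := b (j 2) - C (x (j 2)) * b (j 0)
  let N := b p - C (x p) * b (j 0)
  have hMN : IsRelPrime M N := by
    intro d hM hN
    refine isUnit_of_dvd_dvd (i := j 0) (j := j 1) (n := n) hsn hx0 hyj hyn hyi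
      σ hAB hQ fun l => ?_
    rcases hlp l with rfl | rfl | rfl
    · rw [hx0, C_1, one_mul, sub_self]
      exact dvd_zero d
    · exact hM
    · exact hN
  have hφ3 : φ (dehomogenize s q (bil B 2 1) j) = C M + C N * X := by
    have h3 : φ (dehomogenize s q (bil B 2 1) j) = ∑ l, z l * C (b l) := by
      rw [map_dehomogenize_bil]
      refine Finset.sum_congr rfl fun l _ => ?_
      rw [map_sum, Finset.mul_sum]
      refine Finset.sum_congr rfl fun m _ => ?_
      rw [hφ, v1, v2, C_mul]
      ring
    rw [h3, hsp, hzi, hzk, hzp]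
    simp only [M, N, C_sub, C_mul]
    ring
  have hrel := isRelPrime_blowup hMN
  rw [← hφ3] at hrel
  have h30 : φ (dehomogenize s q (bil B 2 1) j) ≠ 0 := by
    intro h0
    rw [h0] at hrel
    rw [hφ3] at h0
    have hN : C N = 0 := by
      have := congrArg (fun f => Polynomial.coeff f 1) h0
      simp only [coeff_add, coeff_C_succ, coeff_C_mul, coeff_X_one, coeff_zero, mul_one, zero_add] at this
      rw [this, C_0]
    exact not_isUnit_zero (hrel (dvd_of_eq hN.symm) (dvd_refl 0))
  refine ⟨fun g hg => ?_, fun g hg => ?_⟩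
  · have h4 := hker _ hg
    rw [map_mul] at h4
    have h5 := hψφ g
    rw [(mul_eq_zero.1 h4).resolve_left h30, map_zero, zero_sub] at h5
    exact (Submodule.neg_mem_iff _).1 h5
  · obtain ⟨u, hu, w, hw, huw⟩ := Submodule.mem_sup.1 hg
    obtain ⟨c, rfl⟩ := Ideal.mem_span_singleton'.1 hw
    have h4 := congrArg φ huw
    rw [map_add, hker u hu, zero_add, map_mul, map_mul, map_cross] at h4
    have h5 : φ (dehomogenize s q (bil B 2 1) j) ∣ C N * φ g := by
      have h6 : (fun l => φ (∑ m, scalars s _ (B l m) * coordinate q j 1 m)) = fun l => C (b l) := by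
        funext l
        simp only [map_sum, map_mul, hφ, v1, b]
      rw [h6] at h4
      simp only [v0] at h4
      have h7 : C N = C (C (x (j 0))) * C (b p) - C (C (x p)) * C (b (j 0)) := by
        rw [hx0]
        simp [N]
      rw [h7]
      rcases cross_third (fun l => C (C (x l))) (fun l => C (b l)) h2 hp0 hp2 with h | h
      · rw [← h, ← h4]
        exact dvd_mul_left _ _
      · rw [← neg_eq_iff_eq_neg.2 h, neg_mul, ← h4, dvd_neg]
        exact dvd_mul_left _ _
    obtain ⟨r, hr⟩ := hrel.symm.dvd_of_dvd_mul_left h5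
    have h8 := hψφ g
    have h9 := hψφ (dehomogenize s q (bil B 2 1) j)
    rw [hr, map_mul] at h8
    -- Modulo `I`, `g` is `ψ (φ g)`, the product of `ψ r` with the image of the third form under `ψ
    -- ∘ φ`, and that image is congruent to the form itself.
    have h10 : g = dehomogenize s q (bil B 2 1) j * ψ r +
        ((ψ (φ (dehomogenize s q (bil B 2 1) j)) - dehomogenize s q (bil B 2 1) j) * ψ r -
        (ψ (φ (dehomogenize s q (bil B 2 1) j)) * ψ r - g)) := by ring
    rw [h10]
    refine add_mem (Ideal.mem_sup_right (Ideal.mul_mem_right _ _ (Ideal.mem_span_singleton_self _)))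
      (Ideal.mem_sup_left (sub_mem (Ideal.mul_mem_right _ _ h9) h8))

theorem IsProd.blowup_regular (hq : IsProd s q) {j : Fin 3 → Fin 3} (h1 : j 0 ≠ j 1) (h2 : j 0 ≠ j 2)
    {A B : Matrix (Fin 3) (Fin 3) ℂ} (hAB : A * B = 1) {I : Ideal Γ(T, chart q j)}
    (hI : I = Ideal.span {dehomogenize s q (bil 1 0 1) j} ⊔ Ideal.span {dehomogenize s q (bil 1 0 2) j}) :
    (∀ g, dehomogenize s q (bil B 2 1) j * g ∈ I → g ∈ I) ∧
    ∀ g, cross (coordinate q j 0) (fun l => ∑ m, scalars s _ (B l m) * coordinate q j 1 m) (j 2) * g ∈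
      I ⊔ Ideal.span {dehomogenize s q (bil B 2 1) j} →
      g ∈ I ⊔ Ideal.span {dehomogenize s q (bil B 2 1) j} := by
  -- The variable with index `j 0` is superfluous, since `x` has 1 in that place; only factoriality
  -- and the map `ψ₀` matter.
  let S := MvPolynomial (Fin 3) ℂ
  obtain ⟨x, hx⟩ : ∃ x : Fin 3 → S, x = fun l => if l = j 0 then 1 else MvPolynomial.X l := ⟨_, rfl⟩
  have hx0 : x (j 0) = 1 := by rw [hx]; exact if_pos rfl
  let ψ₀ : S →+* Γ(T, chart q j) := MvPolynomial.eval₂Hom (scalars s _) (fun l => coordinate q j 0 l)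
  have hψx : ∀ l, ψ₀ (x l) = coordinate q j 0 l := fun l => by
    rw [hx]
    dsimp only
    split_ifs with h
    · rw [map_one, h, coordinate_self]
    · exact MvPolynomial.eval₂Hom_X' _ _ _
  -- Were this quadratic form zero on the chart, `A` would be singular, contrary to `A * B = 1`.
  have hQ : ∑ m, x m * ∑ l, MvPolynomial.C (A m l) * x l ≠ 0 := by
    intro h0
    have hdet : A.det = 0 := by
      refine det_eq_zero_of_quadratic (j 0) fun v hv => ?_
      have h3 := congrArg (MvPolynomial.eval v) h0
      have h4 : ∀ l, MvPolynomial.eval v (x l) = v l := fun l => by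
        rw [hx]
        dsimp only
        split_ifs with h
        · rw [map_one, h, hv]
        · exact MvPolynomial.eval_X l
      simpa only [map_sum, map_mul, h4, MvPolynomial.eval_C, map_zero] using h3
    have := congrArg Matrix.det hAB
    rw [Matrix.det_mul, hdet, zero_mul, Matrix.det_one] at this
    exact zero_ne_one this
  exact hq.blowup_regular_aux h1 h2 hAB (MvPolynomial.C : ℂ →+* S) hx0
    (fun r => MvPolynomial.eval₂Hom_C _ _ _) hψx hQ hI

end algebra

/-! ### Complete intersection and exceptional divisor -/

section
variable {T : Scheme.{0}} {s : T ⟶ SpecC}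

theorem IsProd.exists_ne_of_mem_support {k : ℕ} {q : Fin k → (T ⟶ P2)} (hq : IsProd s q) {a b : Fin k}
    (hab : a ≠ b) {t : T} (ht : t ∈ (zeroIdeal s q (bil 1 a b)).support) {i : Fin 3}
    (hi : q a t ∈ P2.chart i) : ∃ j, i ≠ j ∧ q b t ∈ P2.chart j := by
  rw [← SetLike.mem_coe, ← Scheme.IdealSheafData.range_subschemeι] at ht
  obtain ⟨t, rfl⟩ := ht
  have h := (hq.zeroIdeal_le_ker (isMultihomogeneous_bil 1 a b) _).1
    (zeroIdeal s q (bil 1 a b)).ker_subschemeι.ge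
  have h2 := (dehom_bil_eq_zero_iff (q := fun c => _ ≫ q c) 1 a b hab).1 h
  exact exists_ne_of_incident h2 t i hi

variable {B : Matrix (Fin 3) (Fin 3) ℂ}

/-- Charts of this shape are those on which the coordinates of `y` and `z` with index `j 0` are not
normalized to 1 and can be eliminated. -/
theorem exists_good_chart {t : P2xP2xP2} (h0 : t ∈ (blowupDivisor B 0).support)
    (h1 : t ∈ (blowupDivisor B 1).support) :
    ∃ j : Fin 3 → Fin 3, j 0 ≠ j 1 ∧ j 0 ≠ j 2 ∧ t ∈ chart P2xP2xP2.proj j := by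
  obtain ⟨i, hi⟩ := TopologicalSpace.Opens.mem_iSup.1
    (P2.iSup_chart.ge (show P2xP2xP2.proj 0 t ∈ ⊤ from trivial))
  obtain ⟨j, hij, hj⟩ := isProd_P2xP2xP2.exists_ne_of_mem_support (a := 0) (b := 1) (by decide) h0 hi
  obtain ⟨k, hik, hk⟩ := isProd_P2xP2xP2.exists_ne_of_mem_support (a := 0) (b := 2) (by decide) h1 hi
  refine ⟨![i, j, k], hij, hik, mem_chart.2 fun a => ?_⟩
  fin_cases a
  · exact hi
  · exact hj
  · exact hk

theorem blowupDivisor_chart (n : Fin 3) (j : Fin 3 → Fin 3) :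
    (blowupDivisor B n).ideal ⟨_, isProd_P2xP2xP2.isAffineOpen_chart j⟩ =
      Ideal.span {dehomogenize P2xP2xP2.str P2xP2xP2.proj (blowupForm B n) j} := by
  have hn : n = 0 ∨ n = 1 ∨ n = 2 := by revert n; decide
  rcases hn with rfl | rfl | rfl
  · exact isProd_P2xP2xP2.zeroIdeal_chart (isMultihomogeneous_bil 1 0 1) j
  · exact isProd_P2xP2xP2.zeroIdeal_chart (isMultihomogeneous_bil 1 0 2) j
  · exact isProd_P2xP2xP2.zeroIdeal_chart (isMultihomogeneous_bil B 2 1) j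

/-- Modulo `I` the vector `z` is orthogonal to `x` and `b`, so each component of the cross product
is `z l` times the `k`-th. On the candidate blow-up this makes the inverse image ideal principal. -/
theorem span_cross_sup {R : Type*} [CommRing R] {I : Ideal R} {x b z : Fin 3 → R} {k : Fin 3} (hz : z k = 1)
    (hx : ∑ l, x l * z l ∈ I) (hb : ∑ l, b l * z l ∈ I) :
    Ideal.span (Set.range (cross x b)) ⊔ I = Ideal.span {cross x b k} ⊔ I := by
  refine le_antisymm (sup_le (Ideal.span_le.2 ?_) le_sup_right)
    (sup_le_sup_right (Ideal.span_mono (Set.singleton_subset_iff.2 (Set.mem_range_self k))) _)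
  rintro _ ⟨l, rfl⟩
  have h : cross x b l - z l * cross x b k ∈ I := by
    rw [← Ideal.Quotient.eq_zero_iff_mem] at hx hb ⊢
    simp only [map_sum, map_mul] at hx hb
    have := mul_cross_comm hx hb k l
    rw [← map_cross, ← map_cross, ← map_mul, ← map_mul, hz, one_mul] at this
    rw [map_sub, this, sub_self]
  rw [SetLike.mem_coe, ← sub_add_cancel (cross x b l) (z l * cross x b k), add_comm]
  exact add_mem (Ideal.mem_sup_left (Ideal.mul_mem_left _ _ (Ideal.mem_span_singleton_self _)))
    (Ideal.mem_sup_right h)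

theorem isCompleteIntersection_blowupDivisor {A : Matrix (Fin 3) (Fin 3) ℂ} (hAB : A * B = 1) :
    IsCompleteIntersection (blowupDivisor B 0) (blowupDivisor B 1) (blowupDivisor B 2) := by
  refine ⟨isProd_P2xP2xP2.isEffectiveCartier (isMultihomogeneous_bil 1 0 1)
    (bil_ne_zero one_ne_zero (by decide)), isEffectiveCartier_comap_subschemeι fun t h0 h1 => ?_,
    isEffectiveCartier_comap_subschemeι fun t h h2 => ?_⟩
  · obtain ⟨j, h01, h02, ht⟩ := exists_good_chart h0 h1
    refine ⟨⟨chart P2xP2xP2.proj j, isProd_P2xP2xP2.isAffineOpen_chart j⟩, ht,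
      dehomogenize P2xP2xP2.str P2xP2xP2.proj (blowupForm B 1) j, by rw [blowupDivisor_chart], fun g hg => ?_⟩
    rw [blowupDivisor_chart] at hg ⊢
    exact isProd_P2xP2xP2.mem_of_mul_mem_one h01 h02 hg
  · obtain ⟨j, h01, h02, ht⟩ := exists_good_chart
      (Scheme.IdealSheafData.support_antitone (le_sup_left : blowupDivisor B 0 ≤ _) h)
      (Scheme.IdealSheafData.support_antitone (le_sup_right : blowupDivisor B 1 ≤ _) h)
    refine ⟨⟨chart P2xP2xP2.proj j, isProd_P2xP2xP2.isAffineOpen_chart j⟩, ht,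
      dehomogenize P2xP2xP2.str P2xP2xP2.proj (blowupForm B 2) j, by rw [blowupDivisor_chart], ?_⟩
    refine (isProd_P2xP2xP2.blowup_regular h01 h02 hAB ?_).1
    rw [Scheme.IdealSheafData.ideal_sup, Pi.sup_apply, blowupDivisor_chart, blowupDivisor_chart]
    rfl

theorem isEffectiveCartier_comap_blowupMap {A : Matrix (Fin 3) (Fin 3) ℂ} (hAB : A * B = 1) :
    IsEffectiveCartier (((minorIdeal B).comap W.ι).comap (blowupMap B)) := by
  -- The inverse image through `W` is also the restriction of an ideal sheaf on the triple product,
  -- to which the criterion for closed subschemes applies.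
  rw [← Scheme.IdealSheafData.comap_comp, blowupMap_ι, Scheme.IdealSheafData.comap_comp]
  refine isEffectiveCartier_comap_subschemeι fun t h _ => ?_
  obtain ⟨j, h01, h02, ht⟩ := exists_good_chart
    (Scheme.IdealSheafData.support_antitone (le_sup_left.trans le_sup_left : blowupDivisor B 0 ≤ _) h)
    (Scheme.IdealSheafData.support_antitone (le_sup_right.trans le_sup_left : blowupDivisor B 1 ≤ blowupIdeal B) h)
  have hI : (blowupIdeal B).ideal ⟨_, isProd_P2xP2xP2.isAffineOpen_chart j⟩ =
      Ideal.span {dehomogenize P2xP2xP2.str P2xP2xP2.proj (bil 1 0 1) j} ⊔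
      Ideal.span {dehomogenize P2xP2xP2.str P2xP2xP2.proj (bil 1 0 2) j} ⊔
      Ideal.span {dehomogenize P2xP2xP2.str P2xP2xP2.proj (bil B 2 1) j} := by
    rw [blowupIdeal, Scheme.IdealSheafData.ideal_sup, Pi.sup_apply, Scheme.IdealSheafData.ideal_sup,
      Pi.sup_apply, blowupDivisor_chart, blowupDivisor_chart, blowupDivisor_chart]
    rfl
  have hreg := (isProd_P2xP2xP2.blowup_regular h01 h02 hAB rfl).2
  rw [← hI] at hreg
  refine ⟨⟨chart P2xP2xP2.proj j, isProd_P2xP2xP2.isAffineOpen_chart j⟩, ht, _, ?_, hreg⟩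
  have h3 := comap_minorIdeal B proj12 ⟨_, isProd_P2xP2xP2.isAffineOpen_chart j⟩ (i := j 0) (j := j 1)
    (chart_le P2xP2xP2.proj j 0) (chart_le P2xP2xP2.proj j 1)
  rw [h3]
  refine span_cross_sup (z := coordinate P2xP2xP2.proj j 2) (coordinate_self _ _ _) ?_ ?_
  · rw [hI]
    refine Ideal.mem_sup_left (Ideal.mem_sup_right ?_)
    convert Ideal.mem_span_singleton_self _
    exact (map_dehomogenize_bil_one (RingHom.id _) 0 2).symm
  · rw [hI]
    refine Ideal.mem_sup_right ?_
    convert Ideal.mem_span_singleton_self _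
    refine Eq.trans ?_ (map_dehomogenize_bil (RingHom.id _) B 2 1).symm
    refine Finset.sum_congr rfl fun l _ => ?_
    refine (Finset.sum_mul _ _ _).trans (Finset.sum_congr rfl fun m _ => ?_)
    exact mul_right_comm _ _ _
end

/-! ### Orders of vanishing on integral schemes -/

section
variable {C : Scheme.{0}} [IsIntegral C]

/-- The rational function defined by a regular function on a nonempty open subset. -/
def toK (U : C.Opens) (h : genericPoint C ∈ U) : Γ(C, U) →+* C.functionField :=
  (C.presheaf.germ U (genericPoint C) h).hom

theorem genericPoint_mem {U : C.Opens} {p : C} (h : p ∈ U) : genericPoint C ∈ U :=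
  map_genericPoint_mem (𝟙 C) h

theorem toK_injective {U : C.Opens} (h : genericPoint C ∈ U) : Function.Injective (toK U h) :=
  germ_injective_of_isIntegral C _ h

theorem toK_map {U V : C.Opens} (h : genericPoint C ∈ V) (e : V ≤ U) (f : Γ(C, U)) :
    toK V h ((C.presheaf.map (homOfLE e).op).hom f) = toK U (e h) f :=
  C.presheaf.germ_res_apply (homOfLE e) _ h f

theorem algebraMap_germ {U : C.Opens} {p : C} (hp : p ∈ U) (f : Γ(C, U)) :
    algebraMap (C.presheaf.stalk p) C.functionField (C.presheaf.germ U p hp f) =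
      toK U (genericPoint_mem hp) f :=
  haveI : Nonempty U := ⟨⟨p, hp⟩⟩
  Scheme.algebraMap_germ_eq_germToFunctionField C hp f

variable [IsLocallyNoetherian C]

/-- For a regular function the order is the length of the local ring modulo its germ. The length is
finite because the germ is a nonzerodivisor in a Noetherian ring of dimension at most one. -/
theorem ord_toK {U : C.Opens} {p : C} (hp : p ∈ U) (hc : Order.coheight p = 1) {f : Γ(C, U)} (hf : f ≠ 0) :
    ∃ n : ℕ, Ring.ord (C.presheaf.stalk p) (C.presheaf.germ U p hp f) = n ∧
      C.ord (toK U (genericPoint_mem hp) f) p = n := by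
  have hK : Ring.KrullDimLE 1 (C.presheaf.stalk p) := AlgebraicGeometry.krullDimLE_of_coheight_le hc.le
  have h0 : C.presheaf.germ U p hp f ∈ nonZeroDivisors (C.presheaf.stalk p) :=
    mem_nonZeroDivisors_of_ne_zero ((map_ne_zero_iff _ (germ_injective_of_isIntegral C _ hp)).2 hf)
  obtain ⟨n, hn⟩ := ENat.ne_top_iff_exists.mp (Ring.ord_ne_top (R := C.presheaf.stalk p) h0)
  refine ⟨n, hn.symm, ?_⟩
  rw [Scheme.ord_eq_iff hc ((map_ne_zero_iff _ (toK_injective _)).2 hf), ← algebraMap_germ hp]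
  refine (Ring.ordFrac_eq_ord _ (nonZeroDivisors.ne_zero h0)).trans ?_
  exact Ring.ordMonoidWithZeroHom_eq_coe _ h0 hn.symm

theorem ord_toK_nonneg {U : C.Opens} {p : C} (hp : p ∈ U) (f : Γ(C, U)) :
    0 ≤ C.ord (toK U (genericPoint_mem hp) f) p := by
  by_cases hc : Order.coheight p = 1
  · by_cases hf : f = 0
    · simp [hf]
    · obtain ⟨n, -, hn⟩ := ord_toK hp hc hf
      rw [hn]
      exact Int.natCast_nonneg n
  · rw [Scheme.ord_eq_zero_of_coheight_neq_one hc]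

theorem one_le_ord_toK {U : C.Opens} {p : C} (hp : p ∈ U) (hc : Order.coheight p = 1) {f : Γ(C, U)} (hf : f ≠ 0)
    (h : p ∉ C.basicOpen f) : 1 ≤ C.ord (toK U (genericPoint_mem hp) f) p := by
  obtain ⟨n, hn', hn⟩ := ord_toK hp hc hf
  rw [hn]
  have : n ≠ 0 := by
    rintro rfl
    rw [Ring.ord, Nat.cast_zero, Module.length_eq_zero_iff, Submodule.Quotient.subsingleton_iff,
      Ideal.span_singleton_eq_top] at hn'
    exact h ((C.mem_basicOpen f p hp).2 hn')
  omega

theorem ord_toK_eq_zero {U : C.Opens} {p : C} {f : Γ(C, U)} (h : p ∈ C.basicOpen f) :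
    C.ord (toK U (genericPoint_mem (C.basicOpen_le f h)) f) p = 0 := by
  by_cases hc : Order.coheight p = 1
  · have hp := C.basicOpen_le f h
    have hu := (C.mem_basicOpen f p hp).1 h
    have hf : f ≠ 0 := by
      rintro rfl
      rw [map_zero] at hu
      exact not_isUnit_zero hu
    obtain ⟨n, hn', hn⟩ := ord_toK hp hc hf
    rw [hn]
    rw [Ring.ord_of_isUnit hu] at hn'
    exact_mod_cast hn'.symm
  · exact Scheme.ord_eq_zero_of_coheight_neq_one hc _

theorem ord_toK_eq_one {U : C.Opens} {p : C} (hp : p ∈ U) (hc : Order.coheight p = 1) {f : Γ(C, U)} (hf : f ≠ 0)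
    (h : Ideal.span {C.presheaf.germ U p hp f} = IsLocalRing.maximalIdeal (C.presheaf.stalk p)) :
    C.ord (toK U (genericPoint_mem hp) f) p = 1 := by
  obtain ⟨n, hn', hn⟩ := ord_toK hp hc hf
  rw [hn]
  have : Ring.ord (C.presheaf.stalk p) (C.presheaf.germ U p hp f) = 1 := by
    rw [Ring.ord, Module.length_eq_one_iff, isSimpleModule_iff_isCoatom, ← Ideal.isMaximal_def, h]
    infer_instance
  rw [this] at hn'
  exact_mod_cast hn'.symm
end

/-! ### Homogeneous coordinates with values in a field, and nefness -/

section coords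
variable {C : Scheme.{0}}

/-- `X` are homogeneous coordinates of the image of `p` under `x`, evaluated by `φ`. -/
def IsCoords {p : C} {L : Type*} [Field L] (φ : C.presheaf.stalk p →+* L) (x : C ⟶ P2) (X : Fin 3 → L) : Prop :=
  ∀ (j : Fin 3) (U : C.Opens) (h : U ≤ x ⁻¹ᵁ P2.chart j) (hU : p ∈ U),
    X j ≠ 0 ∧ ∀ l, φ (C.presheaf.germ U p hU (co x j U h l)) * X j = X l

/-- The ratios in one chart around the image of `p` serve; the transition rule makes them valid in
all charts. -/
theorem exists_isCoords {p : C} {L : Type*} [Field L] (φ : C.presheaf.stalk p →+* L) (x : C ⟶ P2) :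
    ∃ X j, IsCoords φ x X ∧ X j = 1 := by
  obtain ⟨i, hi⟩ := TopologicalSpace.Opens.mem_iSup.1
    (P2.iSup_chart.ge (show x p ∈ ⊤ from trivial))
  replace hi : p ∈ x ⁻¹ᵁ P2.chart i := hi
  refine ⟨fun l => φ (C.presheaf.germ (x ⁻¹ᵁ P2.chart i) p hi (co x i _ le_rfl l)), i,
    fun j U h hU => ?_, ?_⟩
  · beta_reduce
    have hV : p ∈ U ⊓ x ⁻¹ᵁ P2.chart i := ⟨hU, hi⟩
    have h1 := fun l => congrArg (fun f => φ (C.presheaf.germ _ p hV f))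
      (co_trans x (j := i) (m := j) (U := U ⊓ x ⁻¹ᵁ P2.chart i) inf_le_right (inf_le_left.trans h) l)
    simp only [map_mul] at h1
    have h2 : ∀ l, C.presheaf.germ _ p hV (co x i (U ⊓ x ⁻¹ᵁ P2.chart i) inf_le_right l) =
        C.presheaf.germ (x ⁻¹ᵁ P2.chart i) p hi (co x i _ le_rfl l) := fun l => by
      rw [← map_co x le_rfl inf_le_right]
      exact C.presheaf.germ_res_apply _ _ _ _
    have h3 : ∀ l, C.presheaf.germ _ p hV (co x j (U ⊓ x ⁻¹ᵁ P2.chart i) (inf_le_left.trans h) l) =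
        C.presheaf.germ U p hU (co x j U h l) := fun l => by
      rw [← map_co x h inf_le_left]
      exact C.presheaf.germ_res_apply _ _ _ _
    simp only [h2, h3] at h1
    refine ⟨fun h0 => ?_, fun l => ?_⟩
    · have := h1 i
      rw [h0, zero_mul, co_self, map_one, map_one] at this
      exact one_ne_zero this
    · rw [h1 l, mul_comm]
  · simp only [co_self, map_one]

variable [IsIntegral C]

/-- `X` are homogeneous coordinates of the image of the generic point under `x`. -/
abbrev IsGenericCoords (x : C ⟶ P2) (X : Fin 3 → C.functionField) : Prop :=
  IsCoords (p := genericPoint C) (RingHom.id C.functionField) x X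

theorem IsCoords.toK_co {x : C ⟶ P2} {X : Fin 3 → C.functionField} (hX : IsGenericCoords x X)
    {j : Fin 3} {U : C.Opens} (h : U ≤ x ⁻¹ᵁ P2.chart j) (hU : genericPoint C ∈ U) (l : Fin 3) :
    toK U hU (co x j U h l) * X j = X l :=
  (hX j U h hU).2 l

variable {k : ℕ} {T : Scheme.{0}} {s : T ⟶ SpecC} {q : Fin k → (T ⟶ P2)}

/-- Between two charts, the local equations of `F` and the functions `g / ∏ a, X a (J p a) ^ d a`
change by products of the same coordinate ratios. The form `F` enters only through its multidegree.
-/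
theorem IsProd.exists_rationalSection (hq : IsProd s q) {F : MvPolynomial (Fin k × Fin 3) ℂ} {d : Fin k → ℕ}
    (hF : IsMultihomogeneous F d) (hF0 : F ≠ 0) (i : C ⟶ T) {X : Fin k → Fin 3 → C.functionField}
    (hX : ∀ a, IsGenericCoords (i ≫ q a) (X a)) {J : C → Fin k → Fin 3} (hJ : ∀ p, i p ∈ chart q (J p))
    {g : C.functionField} (hg : g ≠ 0) :
    ∃ σ : RationalSection (zeroIdeal s q F) i, ∀ p, σ.h p = g / ∏ a, X a (J p a) ^ d a := by
  have hη : ∀ p, genericPoint C ∈ i ⁻¹ᵁ chart q (J p) := fun p => map_genericPoint_mem i (hJ p)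
  have hX0 : ∀ p a, X a (J p a) ≠ 0 := fun p a =>
    (hX a (J p a) (i ⁻¹ᵁ chart q (J p)) (i.preimage_mono (chart_le q _ a)) (hη p)).1
  have hdom := hq.isDomain
  refine ⟨⟨fun p => ⟨_, hq.isAffineOpen_chart (J p)⟩, hJ, fun p => dehomogenize s q F (J p), fun p =>
    mem_nonZeroDivisors_of_ne_zero (hq.dehomogenize_ne_zero hF hF0 _), fun p => hq.zeroIdeal_chart hF _,
    fun p => g / ∏ a, X a (J p a) ^ d a, fun p => div_ne_zero hg
      (Finset.prod_ne_zero_iff.2 fun a _ => pow_ne_zero _ (hX0 p a)), fun p p' => ?_⟩, fun p => rfl⟩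
  obtain ⟨V, hV⟩ : ∃ V, V = chart q (J p) ⊓ chart q (J p') := ⟨_, rfl⟩
  have h1 : V ≤ chart q (J p) := hV.le.trans inf_le_left
  have h2 : V ≤ chart q (J p') := hV.le.trans inf_le_right
  have hηV : i (genericPoint C) ∈ V := hV.ge ⟨hη p, hη p'⟩
  let u := ∏ a, co (q a) (J p a) V (h1.trans (chart_le q _ a)) (J p' a) ^ d a
  refine ⟨T.presheaf.germ V _ hηV u, ?_, ?_⟩
  · have h3 : (T.presheaf.map (homOfLE h1).op).hom (dehomogenize s q F (J p)) =
        u * (T.presheaf.map (homOfLE h2).op).hom (dehomogenize s q F (J p')) := by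
      rw [dehomogenize_eq_dehom, dehomogenize_eq_dehom, map_dehom, map_dehom]
      exact dehom_trans hF h1 h2
    have h4 := congrArg (T.presheaf.germ V _ hηV).hom h3
    rw [map_mul] at h4
    refine Eq.trans ?_ (h4.trans (congrArg _ ?_))
    · exact (T.presheaf.germ_res_apply (homOfLE h1) _ hηV _).symm
    · exact T.presheaf.germ_res_apply (homOfLE h2) _ hηV _
  · have h3 : (i.stalkMap (genericPoint C)).hom (T.presheaf.germ V _ hηV u) =
        toK (i ⁻¹ᵁ V) hηV ((i.app V).hom u) := Scheme.Hom.germ_stalkMap_apply _ _ _ _ _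
    have h4 : toK (i ⁻¹ᵁ V) hηV ((i.app V).hom u) * ∏ a, X a (J p a) ^ d a =
        ∏ a, X a (J p' a) ^ d a := by
      rw [map_prod, map_prod, ← Finset.prod_mul_distrib]
      refine Finset.prod_congr rfl fun a _ => ?_
      rw [map_pow, map_pow, ← mul_pow]
      congr 1
      have := (hX a).toK_co (i.preimage_mono (h1.trans (chart_le q _ a))) hηV (J p' a)
      rw [← this]
      congr 2
      rw [Scheme.Hom.app_eq_appLE]
      exact appLE_co i (q a) _ le_rfl _
    have h5 : ∀ p, ∏ a, X a (J p a) ^ d a ≠ 0 := fun p =>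
      Finset.prod_ne_zero_iff.2 fun a _ => pow_ne_zero _ (hX0 p a)
    refine Eq.trans ?_ (congrArg (· * _) h3.symm)
    rw [div_eq_iff (h5 p), mul_right_comm, h4, mul_div_cancel₀ _ (h5 p')]

/-- The section is the monomial in the coordinates `j a`, which are nonzero at the generic point of
the curve. Its local expressions are products of coordinate ratios, hence regular, so no order is
negative. -/
theorem IsProd.isNef (hq : IsProd s q) {F : MvPolynomial (Fin k × Fin 3) ℂ} {d : Fin k → ℕ}
    (hF : IsMultihomogeneous F d) (hF0 : F ≠ 0) : IsNef (zeroIdeal s q F) := by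
  refine ⟨hq.isEffectiveCartier hF hF0, fun C _ i _ => ?_⟩
  choose X j hX hX1 using fun a => exists_isCoords (p := genericPoint C) (RingHom.id C.functionField) (i ≫ q a)
  have hJ : ∀ p, ∃ J, i p ∈ chart q J := fun p =>
    TopologicalSpace.Opens.mem_iSup.1 ((iSup_chart q).ge (show i p ∈ ⊤ from trivial))
  choose J hJ using hJ
  obtain ⟨σ, hσ⟩ := hq.exists_rationalSection hF hF0 i hX hJ one_ne_zero
  refine ⟨σ, finsum_nonneg fun p => ?_⟩
  have hη : genericPoint C ∈ i ⁻¹ᵁ chart q (J p) := map_genericPoint_mem i (hJ p)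
  have hle : ∀ a, i ⁻¹ᵁ chart q (J p) ≤ (i ≫ q a) ⁻¹ᵁ P2.chart (J p a) := fun a =>
    i.preimage_mono (chart_le q _ a)
  have h : σ.h p = toK _ hη (∏ a, co (i ≫ q a) (J p a) _ (hle a) (j a) ^ d a) := by
    rw [hσ, map_prod, one_div, ← Finset.prod_inv_distrib]
    refine Finset.prod_congr rfl fun a _ => ?_
    rw [map_pow, ← inv_pow]
    congr 1
    have := (hX a).toK_co (hle a) hη (j a)
    rw [hX1] at this
    exact (eq_inv_of_mul_eq_one_left this).symm
  rw [h]
  exact ord_toK_nonneg (show p ∈ i ⁻¹ᵁ chart q (J p) from hJ p) _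
end coords

/-! ### Closed points and evaluation in the complex numbers -/

section points

theorem finiteType_grading : Algebra.FiniteType (grading 0) (MvPolynomial (Fin 3) ℂ) := by
  have : IsScalarTower ℂ (grading 0) (MvPolynomial (Fin 3) ℂ) := IsScalarTower.of_algebraMap_eq (R := ℂ) (S := grading 0) (A := MvPolynomial (Fin 3) ℂ) fun _ => rfl
  exact Algebra.FiniteType.of_restrictScalars_finiteType ℂ (grading 0) _

instance : LocallyOfFiniteType P2.str := by
  have h1 := finiteType_grading
  have h2 : LocallyOfFiniteType (Spec.map (CommRingCat.ofHom (algebraMap ℂ (grading 0)))) := by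
    rw [HasRingHomProperty.Spec_iff (P := @LocallyOfFiniteType)]
    refine RingHom.FiniteType.of_surjective _ fun F => ?_
    have h3 := MvPolynomial.totalDegree_eq_zero_iff_eq_C.1
      ((MvPolynomial.totalDegree_zero_iff_isHomogeneous _).2 F.2)
    exact ⟨_, Subtype.ext h3.symm⟩
  exact MorphismProperty.comp_mem @LocallyOfFiniteType (Proj.toSpecZero grading) _ inferInstance h2

theorem isProd_P2 : IsProd P2.str (fun _ : Fin 1 => 𝟙 P2) where
  comp_str _ := Category.id_comp _
  exists_lift s' q' h := ⟨q' 0, h 0, fun a => by rw [Category.comp_id, Subsingleton.elim a 0]⟩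
  hom_ext m m' h := by simpa using h 0

theorem exists_eval₂_eq {C : Scheme.{0}} {t : C ⟶ SpecC} {x : C ⟶ P2} [IsClosedImmersion x]
    (hx : x ≫ P2.str = t) (i : Fin 3) (f : Γ(C, x ⁻¹ᵁ P2.chart i)) :
    ∃ F : MvPolynomial (Fin 3) ℂ, F.eval₂ (scalars t _) (co x i _ le_rfl) = f := by
  have hle : P2.chart i ≤ chart (fun _ : Fin 1 => 𝟙 P2) (fun _ => i) := fun p hp => mem_chart.2 fun _ => hp
  have hle' : chart (fun _ : Fin 1 => 𝟙 P2) (fun _ => i) ≤ P2.chart i := fun p hp => mem_chart.1 hp 0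
  obtain ⟨g, rfl⟩ := app_surjective_of_isClosedImmersion x ⟨_, P2.isAffineOpen_chart i⟩ f
  obtain ⟨F, hF⟩ := isProd_P2.dehomogenize_surjective (fun _ => i)
    ((P2.presheaf.map (homOfLE hle').op).hom g)
  have h1 := congrArg (P2.presheaf.map (homOfLE hle).op).hom hF
  have h2 : (P2.presheaf.map (homOfLE hle).op).hom ((P2.presheaf.map (homOfLE hle').op).hom g) = g := by
    rw [← CommRingCat.comp_apply, ← Functor.map_comp, ← op_comp]
    exact congrArg (fun f => CommRingCat.Hom.hom f g) (P2.presheaf.map_id _)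
  rw [h2, dehomogenize_eq_dehom, map_dehom, dehom] at h1
  rw [← h1]
  refine ⟨MvPolynomial.rename Prod.snd F, ?_⟩
  rw [MvPolynomial.eval₂_rename]
  refine Eq.trans ?_ (MvPolynomial.hom_eval₂ _ _ _ _).symm
  refine congrArg₂ (fun a b => MvPolynomial.eval₂ a b F) (RingHom.ext fun r => ?_) (funext fun v => ?_)
  · rw [← hx]
    refine (appLE_scalars x P2.str le_rfl r).symm.trans ?_
    rw [← Scheme.Hom.app_eq_appLE]
    rfl
  · refine Eq.trans ?_ (congrArg (fun g => CommRingCat.Hom.hom g _) (Scheme.Hom.app_eq_appLE x).symm)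
    refine Eq.trans ?_ (appLE_co x (𝟙 P2) _ le_rfl _).symm
    simp only [Function.comp, Category.comp_id]

variable {C : Scheme.{0}}

/-- Evaluation of germs at a closed point of a complex variety. -/
def ev (t : C ⟶ SpecC) [LocallyOfFiniteType t] (p : C) (hp : IsClosed {p}) : C.presheaf.stalk p →+* ℂ :=
  (residueFieldIsoBase t p hp).hom.hom.comp (C.residue p).hom

theorem ev_eq_zero (t : C ⟶ SpecC) [LocallyOfFiniteType t] {p : C} (hp : IsClosed {p})
    {a : C.presheaf.stalk p} : ev t p hp a = 0 ↔ ¬ IsUnit a := by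
  have h1 : Function.Injective (residueFieldIsoBase t p hp).hom.hom := RingHom.injective _
  rw [ev, RingHom.comp_apply, map_eq_zero_iff _ h1, ← mem_nonunits_iff, ← IsLocalRing.mem_maximalIdeal]
  exact IsLocalRing.residue_eq_zero_iff _

theorem ev_germ_eq_zero (t : C ⟶ SpecC) [LocallyOfFiniteType t] {p : C} (hp : IsClosed {p})
    {U : C.Opens} (hU : p ∈ U) {f : Γ(C, U)} : ev t p hp (C.presheaf.germ U p hU f) = 0 ↔ p ∉ C.basicOpen f := by
  rw [ev_eq_zero, C.mem_basicOpen f p hU]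

theorem ev_scalars (t : C ⟶ SpecC) [LocallyOfFiniteType t] {p : C} (hp : IsClosed {p})
    {U : C.Opens} (hU : p ∈ U) (r : ℂ) : ev t p hp (C.presheaf.germ U p hU (scalars t U r)) = r := by
  have h1 := SpecMap_residueFieldIsoBase_inv t p hp
  have h2 : t = C.toSpecΓ ≫ Spec.map (CommRingCat.ofHom (scalars t ⊤)) := by
    have h : C.presheaf.map (homOfLE (le_top : (⊤ : C.Opens) ≤ ⊤)).op = 𝟙 _ := C.presheaf.map_id _
    rw [ofHom_scalars, h, Category.comp_id, Spec.map_comp, ← Scheme.toSpecΓ_naturality_assoc]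
    simp
  have h3 : (residueFieldIsoBase t p hp).inv = CommRingCat.ofHom (scalars t ⊤) ≫
      C.presheaf.germ ⊤ p trivial ≫ C.residue p := by
    apply Spec.map_injective
    rw [h1, Scheme.fromSpecResidueField, Spec.map_comp, Spec.map_comp, ← Scheme.fromSpecStalk_toSpecΓ]
    conv_lhs => rw [h2]
    simp only [Category.assoc]
  have h4 := congrArg (fun f => (residueFieldIsoBase t p hp).hom.hom (f.hom r)) h3
  have h5 : (residueFieldIsoBase t p hp).hom.hom ((residueFieldIsoBase t p hp).inv.hom r) = r :=
    congrArg (fun f => f.hom r) (residueFieldIsoBase t p hp).inv_hom_id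
  have h6 : C.presheaf.germ U p hU (scalars t U r) = C.presheaf.germ ⊤ p trivial (scalars t ⊤ r) := by
    rw [← map_scalars t (le_top : U ≤ ⊤)]
    exact C.presheaf.germ_res_apply _ _ _ _
  rw [h6]
  exact h4.symm.trans h5

/-- The functions on the affine preimage of a chart are polynomials in the coordinate ratios, so `ξ`
decides which of them vanish at the point. Principal opens form a basis, so the two points are
topologically inseparable. -/
theorem eq_of_isCoords {t : C ⟶ SpecC} [LocallyOfFiniteType t] {x : C ⟶ P2} [IsClosedImmersion x]
    (hx : x ≫ P2.str = t) {p r : C} (hp : IsClosed {p}) (hr : IsClosed {r}) {i : Fin 3}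
    (hpi : x p ∈ P2.chart i) (hri : x r ∈ P2.chart i) {ξ : Fin 3 → ℂ}
    (hξp : IsCoords (ev t p hp) x ξ) (hξr : IsCoords (ev t r hr) x ξ) : p = r := by
  have hV : IsAffineOpen (x ⁻¹ᵁ P2.chart i) := IsAffineOpen.preimage (P2.isAffineOpen_chart i) x
  have h0 := (hξp i _ le_rfl hpi).1
  have key : ∀ {p : C} (hp : IsClosed {p}) (hpi : p ∈ x ⁻¹ᵁ P2.chart i) (h : IsCoords (ev t p hp) x ξ)
      (F : MvPolynomial (Fin 3) ℂ), ev t p hp (C.presheaf.germ _ p hpi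
        (F.eval₂ (scalars t _) (co x i _ le_rfl))) = F.eval (fun l => ξ l / ξ i) := by
    intro p hp hpi h F
    refine (MvPolynomial.hom_eval₂ F _ ((ev t p hp).comp (C.presheaf.germ _ p hpi).hom) _).trans ?_
    refine congrArg₂ (fun a b => MvPolynomial.eval₂ a b F) (RingHom.ext fun r => ?_) (funext fun l => ?_)
    · exact ev_scalars t hp hpi r
    · exact eq_div_of_mul_eq h0 ((h i _ le_rfl hpi).2 l)
  have h1 : ∀ f : Γ(C, x ⁻¹ᵁ P2.chart i), p ∈ C.basicOpen f ↔ r ∈ C.basicOpen f := fun f => by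
    obtain ⟨F, rfl⟩ := exists_eval₂_eq hx i f
    rw [← not_iff_not, ← ev_germ_eq_zero t hp hpi, ← ev_germ_eq_zero t hr hri, key hp hpi hξp, key hr hri hξr]
  refine Inseparable.eq (inseparable_iff_forall_isOpen.2 fun W hW => ?_)
  constructor
  · intro h
    obtain ⟨f, hf, hpf⟩ := hV.exists_basicOpen_le (V := ⟨W, hW⟩) ⟨p, h⟩ hpi
    exact hf ((h1 f).1 hpf)
  · intro h
    obtain ⟨f, hf, hpf⟩ := hV.exists_basicOpen_le (V := ⟨W, hW⟩) ⟨r, h⟩ hri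
    exact hf ((h1 f).2 hpf)
end points

/-! ### Points of a curve and counting zeros -/

section curve
variable {C : Scheme.{0}}

theorem lt_of_le_of_specializes {p r : C} (h : p ≤ r) (hne : p ≠ r) : p < r :=
  lt_of_le_not_ge h fun h' => hne (Specializes.antisymm h' h).eq

variable [IsIntegralCurve C]

theorem krullDim_curve : Order.krullDim C = 1 := by
  rw [← IsIntegralCurve.dim_eq_one (C := C), topologicalKrullDim]
  exact (Order.krullDim_eq_of_orderIso (irreducibleSetEquivPoints (α := C))).symm

theorem coheight_le_one (p : C) : Order.coheight p ≤ 1 := by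
  have := Order.coheight_le_krullDim p
  rw [krullDim_curve] at this
  exact_mod_cast this

theorem le_genericPoint (p : C) : p ≤ genericPoint C := genericPoint_specializes p

theorem not_isClosed_genericPoint : ¬ IsClosed {genericPoint C} := by
  intro h
  have h1 : ∀ p : C, p = genericPoint C := fun p => by
    have := (genericPoint_specializes p).mem_closed h rfl
    exact this
  have : Subsingleton C := ⟨fun a b => (h1 a).trans (h1 b).symm⟩
  have h2 := Order.krullDim_nonpos_of_subsingleton (α := C)
  rw [krullDim_curve] at h2
  exact absurd h2 (by decide)

theorem coheight_eq_one {p : C} (hp : IsClosed {p}) : Order.coheight p = 1 := by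
  have h : p < genericPoint C := lt_of_le_of_specializes (le_genericPoint p) fun h => by
    rw [h] at hp
    exact not_isClosed_genericPoint hp
  exact le_antisymm (coheight_le_one p) (le_add_self.trans (Order.coheight_add_one_le h))

theorem isClosed_of_coheight {p : C} (hp : Order.coheight p = 1) : IsClosed {p} := by
  rw [← closure_subset_iff_isClosed]
  intro r hr
  by_contra hne
  have h : r < p := lt_of_le_of_specializes (specializes_iff_mem_closure.2 hr) hne
  have := (Order.coheight_add_one_le h).trans (coheight_le_one r)
  rw [hp] at this
  exact absurd this (by decide)

/-- Closed points are dense in a scheme locally of finite type over `ℂ`. A finite set of them would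
be closed, hence everything, but the generic point is not closed. -/
theorem infinite_closedPoints (t : C ⟶ SpecC) [LocallyOfFiniteType t] : (closedPoints C).Infinite := by
  intro hfin
  have : JacobsonSpace C := LocallyOfFiniteType.jacobsonSpace t
  have h1 : IsClosed (closedPoints C) := by
    rw [← Set.biUnion_of_singleton (closedPoints C)]
    exact hfin.isClosed_biUnion fun p hp => hp
  have h2 := closure_closedPoints (X := C)
  rw [h1.closure_eq] at h2
  exact not_isClosed_genericPoint (h2.ge (Set.mem_univ (genericPoint C)))

end curve

theorem card_le_of_finsum {α : Type*} {f : α → ℤ} (hf : ∀ a, 0 ≤ f a) {n : ℕ} (hn : n ≠ 0)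
    (h : ∑ᶠ a, f a = n) (S : Finset α) (hS : ∀ a ∈ S, 1 ≤ f a) : S.card ≤ n := by
  classical
  -- A `finsum` with infinite support is zero by convention, which `n ≠ 0` excludes.
  have hfin : f.support.Finite := by
    by_contra hc
    rw [finsum_of_infinite_support hc] at h
    exact hn (by exact_mod_cast h.symm)
  have h1 : ∑ᶠ a, f a = ∑ a ∈ hfin.toFinset, f a := finsum_eq_sum _ hfin
  have h2 : S ⊆ hfin.toFinset := fun a ha => by
    have := hS a ha
    simp only [Set.Finite.mem_toFinset, Function.mem_support]
    omega
  have h3 : (S.card : ℤ) ≤ ∑ a ∈ S, f a := by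
    rw [Finset.card_eq_sum_ones, Nat.cast_sum]
    exact Finset.sum_le_sum fun a ha => by simpa using hS a ha
  have h4 := Finset.sum_le_sum_of_subset_of_nonneg h2 (f := f) fun a _ _ => hf a
  rw [← h1, h] at h4
  exact_mod_cast h3.trans h4

theorem finite_support_of_finsum_ne_zero {α : Type*} {f : α → ℤ} (h : ∑ᶠ a, f a ≠ 0) : f.support.Finite := by
  by_contra hc
  exact h (finsum_of_infinite_support hc)

/-! ### Linear and bilinear forms on conics -/

section conic
variable {C : Scheme.{0}}

theorem exists_chart (x : C ⟶ P2) : ∃ i : C → Fin 3, ∀ p, x p ∈ P2.chart (i p) := by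
  have h : ∀ p, ∃ i, x p ∈ P2.chart i := fun p => TopologicalSpace.Opens.mem_iSup.1
    (P2.iSup_chart.ge (show x p ∈ ⊤ from trivial))
  choose i hi using h
  exact ⟨i, hi⟩

theorem IsCoords.ev_sum {t : C ⟶ SpecC} [LocallyOfFiniteType t] {x : C ⟶ P2} {p : C} {hp : IsClosed {p}} {ξ : Fin 3 → ℂ} (hξ : IsCoords (ev t p hp) x ξ) {i : Fin 3}
    {U : C.Opens} (h : U ≤ x ⁻¹ᵁ P2.chart i) (hU : p ∈ U) (c : Fin 3 → ℂ) :
    ev t p hp (C.presheaf.germ U p hU (∑ l, scalars t U (c l) * co x i U h l)) = (∑ l, c l * ξ l) / ξ i := by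
  rw [eq_div_iff (hξ i U h hU).1, map_sum, map_sum, Finset.sum_mul]
  refine Finset.sum_congr rfl fun l _ => ?_
  rw [map_mul, map_mul, ev_scalars, mul_assoc, (hξ i U h hU).2]

variable [IsIntegralCurve C]

/-- The pullback of the tautological line bundle by `x` has degree two. -/
def IsConic (x : C ⟶ P2) : Prop := ∀ (X : Fin 3 → C.functionField) (_ : IsGenericCoords x X) (i : C → Fin 3)
  (_ : ∀ p, x p ∈ P2.chart (i p)) (g : C.functionField) (_ : g ≠ 0), ∑ᶠ p, C.ord (g / X (i p)) p = 2

/-- The inclusion of the constants in the function field. -/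
def constK (t : C ⟶ SpecC) : ℂ →+* C.functionField := (toK ⊤ trivial).comp (scalars t ⊤)

theorem toK_scalars (t : C ⟶ SpecC) {U : C.Opens} (hU : genericPoint C ∈ U) (r : ℂ) :
    toK U hU (scalars t U r) = constK t r := by
  rw [← map_scalars t le_top r, toK_map hU le_top]
  rfl

theorem IsCoords.toK_sum {t : C ⟶ SpecC} {x : C ⟶ P2} {X : Fin 3 → C.functionField} (hX : IsGenericCoords x X) {i : Fin 3} {U : C.Opens} (h : U ≤ x ⁻¹ᵁ P2.chart i)
    (hU : genericPoint C ∈ U) (c : Fin 3 → ℂ) :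
    toK U hU (∑ l, scalars t U (c l) * co x i U h l) = (∑ l, constK t (c l) * X l) / X i := by
  rw [eq_div_iff (hX i U h hU).1, map_sum, Finset.sum_mul]
  refine Finset.sum_congr rfl fun l _ => ?_
  rw [map_mul, toK_scalars, mul_assoc, hX.toK_co]

variable {t : C ⟶ SpecC} [LocallyOfFiniteType t] {x y : C ⟶ P2} {X Y : Fin 3 → C.functionField}

/-- The linear form gives regular local functions of total order two, and each of its zeros
contributes at least one. -/
theorem IsConic.card_le_two (hx : IsConic x) (hX : IsGenericCoords x X) {c : Fin 3 → ℂ}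
    (hc : ∑ l, constK t (c l) * X l ≠ 0) (S : Finset C) (hS : ∀ p ∈ S, ∃ (hp : IsClosed {p}) (ξ : Fin 3 → ℂ),
      IsCoords (ev t p hp) x ξ ∧ ∑ l, c l * ξ l = 0) : S.card ≤ 2 := by
  obtain ⟨i, hi'⟩ := exists_chart x
  have hi : ∀ p, p ∈ x ⁻¹ᵁ P2.chart (i p) := hi'
  have h0 : ∀ p, C.ord ((∑ l, constK t (c l) * X l) / X (i p)) p = C.ord (toK _ (genericPoint_mem (hi p))
      (∑ l, scalars t (x ⁻¹ᵁ P2.chart (i p)) (c l) * co x (i p) _ le_rfl l)) p := fun p => by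
    rw [hX.toK_sum]
  refine card_le_of_finsum (fun p => ?_) two_ne_zero (hx X hX i hi' _ hc) S fun p hp => ?_
  · rw [h0]
    exact ord_toK_nonneg (hi p) _
  · obtain ⟨hp, ξ, hξ, hcξ⟩ := hS p hp
    rw [h0]
    refine one_le_ord_toK (hi p) (coheight_eq_one hp) (fun hz => ?_) ?_
    · have := hX.toK_sum (t := t) le_rfl (genericPoint_mem (hi p)) c
      rw [hz, map_zero, eq_comm, div_eq_zero_iff] at this
      exact this.elim hc (hX (i p) _ le_rfl (genericPoint_mem (hi p))).1
    · rw [← ev_germ_eq_zero t hp (hi p), hξ.ev_sum le_rfl (hi p), hcξ, zero_div]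

/-- The bilinear form gives a section of the tensor product of the two line bundles, whose degrees
add up to four. Its local expressions are regular, so each zero contributes at least one. -/
theorem card_le_four (hx : IsConic x) (hy : IsConic y) (hX : IsGenericCoords x X) (hY : IsGenericCoords y Y)
    {M : Matrix (Fin 3) (Fin 3) ℂ} (hM : ∑ l, ∑ m, constK t (M l m) * X l * Y m ≠ 0) (S : Finset C)
    (hS : ∀ p ∈ S, ∃ (hp : IsClosed {p}) (ξ η : Fin 3 → ℂ), IsCoords (ev t p hp) x ξ ∧
      IsCoords (ev t p hp) y η ∧ ∑ l, ∑ m, M l m * ξ l * η m = 0) : S.card ≤ 4 := by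
  obtain ⟨i, hi'⟩ := exists_chart x
  obtain ⟨j, hj'⟩ := exists_chart y
  have hi : ∀ p, p ∈ x ⁻¹ᵁ P2.chart (i p) := hi'
  have hj : ∀ p, p ∈ y ⁻¹ᵁ P2.chart (j p) := hj'
  have hU : ∀ p, p ∈ x ⁻¹ᵁ P2.chart (i p) ⊓ y ⁻¹ᵁ P2.chart (j p) := fun p => ⟨hi p, hj p⟩
  have hi0 : ∀ p, X (i p) ≠ 0 := fun p => (hX (i p) _ le_rfl (genericPoint_mem (hi p))).1
  have hj0 : ∀ p, Y (j p) ≠ 0 := fun p => (hY (j p) _ le_rfl (genericPoint_mem (hj p))).1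
  obtain ⟨G, hG⟩ : ∃ G, G = ∑ l, ∑ m, constK t (M l m) * X l * Y m := ⟨_, rfl⟩
  rw [← hG] at hM
  let f : ∀ p, Γ(C, x ⁻¹ᵁ P2.chart (i p) ⊓ y ⁻¹ᵁ P2.chart (j p)) := fun p =>
    ∑ l, ∑ m, scalars t _ (M l m) * co x (i p) _ inf_le_left l * co y (j p) _ inf_le_right m
  have h0 : ∀ p, G / X (i p) * (1 / Y (j p)) = toK _ (genericPoint_mem (hU p)) (f p) := fun p => by
    rw [div_mul_div_comm, mul_one, div_eq_iff (mul_ne_zero (hi0 p) (hj0 p)), map_sum, Finset.sum_mul, hG]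
    refine Finset.sum_congr rfl fun l _ => ?_
    rw [map_sum, Finset.sum_mul]
    refine Finset.sum_congr rfl fun m _ => ?_
    rw [map_mul, map_mul, toK_scalars, ← hX.toK_co (j := i p) inf_le_left (genericPoint_mem (hU p)) l,
      ← hY.toK_co (j := j p) inf_le_right (genericPoint_mem (hU p)) m]
    ring
  have h1 := hx X hX i hi' G hM
  have h2 := hy Y hY j hj' 1 one_ne_zero
  have h3 : ∑ᶠ p, C.ord (G / X (i p) * (1 / Y (j p))) p = (4 : ℕ) := by
    have : ∀ p, C.ord (G / X (i p) * (1 / Y (j p))) p = C.ord (G / X (i p)) p + C.ord (1 / Y (j p)) p :=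
      fun p => Scheme.ord_mul (div_ne_zero hM (hi0 p)) (div_ne_zero one_ne_zero (hj0 p))
    rw [finsum_congr this, finsum_add_distrib (finite_support_of_finsum_ne_zero (by rw [h1]; decide))
      (finite_support_of_finsum_ne_zero (by rw [h2]; decide)), h1, h2]
    rfl
  refine card_le_of_finsum (fun p => ?_) four_ne_zero h3 S fun p hp => ?_
  · rw [h0]
    exact ord_toK_nonneg (hU p) _
  · obtain ⟨hp, ξ, η, hξ, hη, hMξ⟩ := hS p hp
    rw [h0]
    refine one_le_ord_toK (hU p) (coheight_eq_one hp) (fun hz => ?_) ?_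
    · have := h0 p
      rw [hz, map_zero, mul_eq_zero] at this
      exact this.elim (div_ne_zero hM (hi0 p)) (div_ne_zero one_ne_zero (hj0 p))
    · rw [← ev_germ_eq_zero t hp (hU p)]
      have h4 : ev t p hp (C.presheaf.germ _ p (hU p) (f p)) * (ξ (i p) * η (j p)) = 0 := by
        rw [← hMξ, map_sum, map_sum, Finset.sum_mul]
        refine Finset.sum_congr rfl fun l _ => ?_
        rw [map_sum, map_sum, Finset.sum_mul]
        refine Finset.sum_congr rfl fun m _ => ?_
        rw [map_mul, map_mul, map_mul, map_mul, ev_scalars, ← (hξ (i p) _ inf_le_left (hU p)).2 l,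
          ← (hη (j p) _ inf_le_right (hU p)).2 m]
        ring
      exact (mul_eq_zero.1 h4).resolve_right
        (mul_ne_zero (hξ (i p) _ inf_le_left (hU p)).1 (hη (j p) _ inf_le_right (hU p)).1)
end conic

section
variable {C : Scheme.{0}} {x : C ⟶ P2}

theorem exists_mul_germ_eq {V : C.Opens} (hV : IsAffineOpen V) {p : C} (hp : p ∈ V) (a : C.presheaf.stalk p) :
    ∃ f g : Γ(C, V), IsUnit (C.presheaf.germ V p hp g) ∧
      a * C.presheaf.germ V p hp g = C.presheaf.germ V p hp f := by
  let _ := TopCat.Presheaf.algebra_section_stalk C.presheaf (⟨p, hp⟩ : V)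
  have := hV.isLocalization_stalk ⟨p, hp⟩
  obtain ⟨⟨f, g⟩, hfg⟩ := IsLocalization.surj (hV.primeIdealOf ⟨p, hp⟩).asIdeal.primeCompl a
  exact ⟨f, g, IsLocalization.map_units (C.presheaf.stalk p) g, hfg⟩

theorem IsCoords.of_smul {p : C} {L : Type*} [Field L] {φ : C.presheaf.stalk p →+* L} {ζ ξ : Fin 3 → L}
    (hζ : IsCoords φ x ζ) {a : L} (h : ∀ l, ζ l = a * ξ l) : IsCoords φ x ξ := by
  intro j U hU hp
  obtain ⟨h0, h1⟩ := hζ j U hU hp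
  rw [h] at h0
  refine ⟨right_ne_zero_of_mul h0, fun l => mul_left_cancel₀ (left_ne_zero_of_mul h0) ?_⟩
  rw [← h l, ← h1 l, h j]
  ring

end

/-! ### Conics do not lie on lines -/

section linear
variable {C : Scheme.{0}} [IsIntegralCurve C] {t : C ⟶ SpecC} [LocallyOfFiniteType t] {x : C ⟶ P2}

/-- The linear forms vanishing at `ξ` form a plane; `d` completes `c` to a basis of it, so the lines
`c` and `d` meet only in `ξ`. -/
theorem exists_independent {ξ c : Fin 3 → ℂ} {i : Fin 3} (hi : ξ i = 1) (hc : c ≠ 0) (hcξ : ∑ l, c l * ξ l = 0) :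
    ∃ d : Fin 3 → ℂ, ∑ l, d l * ξ l = 0 ∧
      (∀ ζ : Fin 3 → ℂ, ∑ l, c l * ζ l = 0 → ∑ l, d l * ζ l = 0 → ∀ l, ζ l = ζ i * ξ l) ∧
      ∀ e : Fin 3 → ℂ, ∑ l, e l * ξ l = 0 → ∃ a b : ℂ, ∀ l, e l = a * c l + b * d l := by
  obtain ⟨j, hj⟩ : ∃ j, i ≠ j ∧ c j ≠ 0 := by
    by_contra! h
    apply hc
    have h1 : c i = 0 := by
      rw [Finset.sum_eq_single i (fun l _ hl => by rw [h l hl.symm, zero_mul]) (by simp), hi, mul_one] at hcξ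
      exact hcξ
    funext l
    by_cases hl : i = l
    · rw [← hl, h1]; rfl
    · exact h l hl
  obtain ⟨hij, hj⟩ := hj
  obtain ⟨n, hni, hnj, hall, hs⟩ := exists_third hij
  -- This is the form `x_n - ξ n * x_i`; it is independent of `c` because `c j ≠ 0`.
  refine ⟨fun l => if l = i then - ξ n else if l = j then 0 else 1, ?_, ?_, ?_⟩
  · simp only [hs, if_true, hij.symm, hni, hnj, if_false, hi]
    ring
  · intro ζ h1 h2
    simp only [hs, if_true, hij.symm, hni, hnj, if_false, hi] at h1 h2 hcξ
    have hn : ζ n = ζ i * ξ n := by linear_combination h2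
    have hj' : ζ j = ζ i * ξ j := by
      apply mul_left_cancel₀ hj
      linear_combination h1 - ζ i * hcξ - c n * hn
    intro l
    rcases hall l with rfl | rfl | rfl
    · rw [hi, mul_one]
    · exact hj'
    · exact hn
  · intro e he
    simp only [hs, hi] at he hcξ
    refine ⟨e j / c j, e n - e j / c j * c n, fun l => ?_⟩
    rcases hall l with rfl | rfl | rfl
    · simp only [if_true]
      field_simp
      linear_combination c j * he - e j * hcξ
    · simp only [if_true, hij.symm, if_false]
      field_simp
      ring
    · simp only [hni, hnj, if_false]
      ring

theorem eval₂_sub_mem {R : Type*} [CommRing R] (σ : ℂ →+* R) (v : Fin 3 → R) (ξ : Fin 3 → ℂ) {I : Ideal R}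
    (h : ∀ l, v l - σ (ξ l) ∈ I) (F : MvPolynomial (Fin 3) ℂ) : F.eval₂ σ v - σ (F.eval ξ) ∈ I := by
  rw [← Ideal.Quotient.eq_zero_iff_mem, map_sub, sub_eq_zero]
  have h' : ∀ l, Ideal.Quotient.mk I (v l) = Ideal.Quotient.mk I (σ (ξ l)) := fun l =>
    Ideal.Quotient.eq.2 (h l)
  refine (MvPolynomial.hom_eval₂ F σ (Ideal.Quotient.mk I) v).trans ?_
  refine Eq.trans ?_ (MvPolynomial.hom_eval₂ F (RingHom.id ℂ) ((Ideal.Quotient.mk I).comp σ) ξ).symm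
  exact congrArg₂ (fun a b => MvPolynomial.eval₂ a b F) rfl (funext h')

/-- A conic in the projective plane is not contained in a line. -/
theorem IsConic.eq_zero [IsClosedImmersion x] (hx : IsConic x) (hxt : x ≫ P2.str = t) {X : Fin 3 → C.functionField}
    (hX : IsGenericCoords x X) {c : Fin 3 → ℂ} (hc : ∑ l, constK t (c l) * X l = 0) : c = 0 := by
  by_contra hc0
  obtain ⟨p, hp⟩ := (infinite_closedPoints t).nonempty
  replace hp : IsClosed {p} := hp
  obtain ⟨ξ, i, hξ, hi⟩ := exists_isCoords (ev t p hp) x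
  have hpos : ∀ {r : C} (hr : IsClosed {r}) (ζ : Fin 3 → ℂ), IsCoords (ev t r hr) x ζ →
      ∑ l, c l * ζ l = 0 := by
    intro r hr ζ hζ
    obtain ⟨m, hm⟩ := exists_chart x
    have hrm : r ∈ x ⁻¹ᵁ P2.chart (m r) := hm r
    have h1 := hX.toK_sum (t := t) le_rfl (genericPoint_mem hrm) c
    rw [hc, zero_div, map_eq_zero_iff _ (toK_injective _)] at h1
    have h2 := hζ.ev_sum le_rfl hrm c
    rw [h1, map_zero, map_zero, eq_comm, div_eq_zero_iff] at h2
    exact h2.resolve_right (hζ (m r) _ le_rfl hrm).1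
  -- A second line `d` through the image of `p`. Since `C` lies on the line `c`, the section `d` can
  -- vanish only at `p`.
  obtain ⟨d, hd, hdc, hspan⟩ := exists_independent hi hc0 (hpos hp ξ hξ)
  have hchart : ∀ {r : C} (hr : IsClosed {r}) (ζ : Fin 3 → ℂ), IsCoords (ev t r hr) x ζ → ∀ m, ζ m ≠ 0 →
      x r ∈ P2.chart m := by
    intro r hr ζ hζ m hm
    obtain ⟨n, hn⟩ := exists_chart x
    have hrn : r ∈ x ⁻¹ᵁ P2.chart (n r) := hn r
    have h1 := (hζ (n r) _ le_rfl hrn).2 m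
    have h2 : r ∈ C.basicOpen (co x (n r) _ le_rfl m) := by
      by_contra hcon
      rw [← ev_germ_eq_zero t hr hrn] at hcon
      rw [hcon, zero_mul] at h1
      exact hm h1.symm
    rw [basicOpen_co] at h2
    exact h2.2
  have hpi : p ∈ x ⁻¹ᵁ P2.chart i := hchart hp ξ hξ i (by rw [hi]; exact one_ne_zero)
  have hV : IsAffineOpen (x ⁻¹ᵁ P2.chart i) := IsAffineOpen.preimage (P2.isAffineOpen_chart i) x
  obtain ⟨u, hu⟩ : ∃ u, u = ∑ l, scalars t (x ⁻¹ᵁ P2.chart i) (d l) * co x i _ le_rfl l := ⟨_, rfl⟩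
  -- As `c` vanishes on `C`, each difference between a coordinate ratio and its value at `p` is a
  -- constant multiple of `u`. Polynomials in these ratios are all the functions, so those that
  -- vanish at `p` are multiples of `u`.
  have hmem : ∀ f : Γ(C, x ⁻¹ᵁ P2.chart i), p ∉ C.basicOpen f → f ∈ Ideal.span {u} := by
    intro f hf
    obtain ⟨F, rfl⟩ := exists_eval₂_eq hxt i f
    have h1 := eval₂_sub_mem (I := Ideal.span {u}) (scalars t (x ⁻¹ᵁ P2.chart i)) (co x i _ le_rfl) ξ
      (fun l => by
        obtain ⟨a, b, hab⟩ := hspan (fun m => (if m = l then 1 else 0) - if m = i then ξ l else 0)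
          (by simp [sub_mul, hi])
        have h2 : co x i (x ⁻¹ᵁ P2.chart i) le_rfl l - scalars t _ (ξ l) = ∑ m, scalars t (x ⁻¹ᵁ P2.chart i)
            ((if m = l then 1 else 0) - if m = i then ξ l else 0) * co x i _ le_rfl m := by
          simp [sub_mul, co_self, apply_ite (scalars t (x ⁻¹ᵁ P2.chart i))]
        have h3 := hX.toK_sum (t := t) le_rfl (genericPoint_mem hpi) c
        rw [hc, zero_div, map_eq_zero_iff _ (toK_injective _)] at h3
        have h4 : co x i (x ⁻¹ᵁ P2.chart i) le_rfl l - scalars t _ (ξ l) = scalars t _ b * u := by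
          rw [h2, hu, ← add_zero (_ * _), ← mul_zero (scalars t _ a), ← h3, Finset.mul_sum, Finset.mul_sum,
            ← Finset.sum_add_distrib]
          refine Finset.sum_congr rfl fun m _ => ?_
          rw [hab, map_add, map_mul, map_mul]
          ring
        rw [h4]
        exact Ideal.mul_mem_left _ _ (Ideal.mem_span_singleton_self _)) F
    have h5 : F.eval ξ = 0 := by
      rw [← ev_germ_eq_zero t hp hpi] at hf
      rw [← hf]
      refine Eq.symm ((MvPolynomial.hom_eval₂ F _ ((ev t p hp).comp (C.presheaf.germ _ p hpi).hom) _).trans ?_)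
      refine congrArg₂ (fun a b => MvPolynomial.eval₂ a b F) (RingHom.ext fun r => ?_) (funext fun l => ?_)
      · exact ev_scalars t hp hpi r
      · have := (hξ i _ le_rfl hpi).2 l
        rw [hi, mul_one] at this
        exact this
    rwa [h5, map_zero, sub_zero] at h1
  have hup : p ∉ C.basicOpen u := by
    rw [← ev_germ_eq_zero t hp hpi, hu, hξ.ev_sum le_rfl hpi, hd, zero_div]
  have hmax : Ideal.span {C.presheaf.germ _ p hpi u} = IsLocalRing.maximalIdeal (C.presheaf.stalk p) := by
    refine le_antisymm ?_ fun a ha => ?_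
    · rw [Ideal.span_singleton_le_iff_mem, IsLocalRing.mem_maximalIdeal, mem_nonunits_iff]
      rwa [C.mem_basicOpen _ p hpi] at hup
    · obtain ⟨f, g, hg, hfg⟩ := exists_mul_germ_eq hV hpi a
      have hf : p ∉ C.basicOpen f := by
        rw [C.mem_basicOpen f p hpi, ← hfg]
        exact fun h => ha (isUnit_of_mul_isUnit_left h)
      obtain ⟨v, hv⟩ := Ideal.mem_span_singleton'.1 (hmem f hf)
      obtain ⟨w, hw⟩ := hg.exists_right_inv
      refine Ideal.mem_span_singleton'.2 ⟨C.presheaf.germ _ p hpi v * w, ?_⟩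
      rw [mul_right_comm, ← map_mul, hv, ← hfg, mul_assoc, hw, mul_one]
  -- If `u` were zero, the local ring at `p` would be a field, although its dimension is one.
  have hu0 : u ≠ 0 := by
    intro h0
    rw [h0, map_zero, Ideal.span_singleton_zero, eq_comm, ← IsLocalRing.isField_iff_maximalIdeal_eq] at hmax
    have h1 := ringKrullDim_stalk_eq_coheight p
    rw [ringKrullDim_eq_zero_of_isField hmax, coheight_eq_one hp] at h1
    exact absurd h1 (by decide)
  have hG : ∑ l, constK t (d l) * X l ≠ 0 := fun h => by
    have h1 := hX.toK_sum (t := t) le_rfl (genericPoint_mem hpi) d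
    rw [h, zero_div, map_eq_zero_iff _ (toK_injective _), ← hu] at h1
    exact hu0 h1
  obtain ⟨j', hj'⟩ := exists_chart x
  classical
  obtain ⟨j, hjp, hj⟩ : ∃ j : C → Fin 3, j p = i ∧ ∀ r, r ∈ x ⁻¹ᵁ P2.chart (j r) := by
    refine ⟨Function.update j' p i, Function.update_self _ _ _, fun r => ?_⟩
    by_cases h : r = p
    · rw [h, Function.update_self]
      exact hpi
    · rw [Function.update_of_ne h]
      exact hj' r
  -- The section `d` has order one at `p` and order zero elsewhere, so its degree would be one
  -- instead of two.
  have h1 := hx X hX j hj _ hG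
  rw [finsum_eq_single _ p, hjp, ← hX.toK_sum le_rfl (genericPoint_mem hpi), ← hu,
    ord_toK_eq_one hpi (coheight_eq_one hp) hu0 hmax] at h1
  · exact absurd h1 (by decide)
  · intro r hrp
    by_cases hr1 : Order.coheight r = 1
    · have hr := isClosed_of_coheight hr1
      obtain ⟨ζ, -, hζ, -⟩ := exists_isCoords (ev t r hr) x
      rw [← hX.toK_sum le_rfl (genericPoint_mem (hj r))]
      refine ord_toK_eq_zero ?_
      by_contra hcon
      rw [← ev_germ_eq_zero t hr (hj r), hζ.ev_sum le_rfl (hj r), div_eq_zero_iff] at hcon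
      have hζj := (hζ (j r) _ le_rfl (hj r)).1
      have h2 := hdc ζ (hpos hr ζ hζ) (hcon.resolve_right hζj)
      have hζi : ζ i ≠ 0 := fun h => hζj (by rw [h2, h, zero_mul])
      exact hrp (eq_of_isCoords hxt hr hp (hchart hr ζ hζ i hζi) hpi (hζ.of_smul h2) hξ)
    · exact Scheme.ord_eq_zero_of_coheight_neq_one hr1 _
end linear

/-! ### The collineation between the two conics -/

theorem det_ne_zero_of_forall {v : Fin 3 → Fin 3 → ℂ}
    (h : ∀ c : Fin 3 → ℂ, (∀ r, ∑ l, c l * v r l = 0) → c = 0) : (Matrix.of v).det ≠ 0 := by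
  intro h0
  obtain ⟨c, hc, hcv⟩ := Matrix.exists_mulVec_eq_zero_iff.2 h0
  refine hc (h c fun r => ?_)
  have := congrFun hcv r
  refine Eq.trans ?_ this
  exact Finset.sum_congr rfl fun l _ => mul_comm _ _

theorem sum_cross_eq_det (v : Fin 3 → Fin 3 → ℂ) :
    ∑ l, cross (v 0) (v 1) l * v 2 l = (Matrix.of v).det := by
  rw [Matrix.det_fin_three, Fin.sum_univ_three, cross_zero, cross_one, cross_two]
  simp only [Matrix.of_apply]
  ring

section collineation
variable {C : Scheme.{0}} [IsIntegralCurve C] {t : C ⟶ SpecC} [LocallyOfFiniteType t] {x y : C ⟶ P2}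
  [IsClosedImmersion x] [IsClosedImmersion y] {X Y : Fin 3 → C.functionField}

/-- A line through three of the points would meet the conic in more than two points. -/
theorem IsConic.det_ne_zero (hx : IsConic x) (hxt : x ≫ P2.str = t) (hX : IsGenericCoords x X)
    (P : ℕ ↪ closedPoints C) {ξ : ℕ → Fin 3 → ℂ} (hξ : ∀ n, IsCoords (ev t (P n) (P n).2) x (ξ n))
    {a : Fin 3 → ℕ} (ha : Function.Injective a) : (Matrix.of fun r => ξ (a r)).det ≠ 0 := by
  classical
  refine det_ne_zero_of_forall fun c hc => ?_
  by_contra hc0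
  have hinj : Function.Injective fun r => (P (a r)).1 := fun r r' h => ha (P.injective (Subtype.ext h))
  have h := hx.card_le_two (t := t) hX (c := c) (fun h => hc0 (hx.eq_zero hxt hX h))
    (Finset.univ.image fun r => (P (a r)).1) fun p hp => by
      obtain ⟨r, -, rfl⟩ := Finset.mem_image.1 hp
      exact ⟨(P (a r)).2, ξ (a r), hξ _, hc r⟩
  rw [Finset.card_image_of_injective _ hinj] at h
  exact absurd h (by decide)

/-- Two embeddings of a curve as a conic differ by a collineation. -/
theorem exists_collineation (hx : IsConic x) (hy : IsConic y) (hxt : x ≫ P2.str = t) (hyt : y ≫ P2.str = t)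
    (hX : IsGenericCoords x X) (hY : IsGenericCoords y Y) :
    ∃ A B : Matrix (Fin 3) (Fin 3) ℂ, A * B = 1 ∧ ∃ τ : C.functionField, τ ≠ 0 ∧
      ∀ l, X l = τ * ∑ m, constK t (B l m) * Y m := by
  classical
  obtain ⟨P⟩ : Nonempty (ℕ ↪ closedPoints C) := by
    have := (infinite_closedPoints t).to_subtype
    exact ⟨Infinite.natEmbedding _⟩
  choose ξ _ hξ _ using fun n => exists_isCoords (ev t (P n) (P n).2) x
  choose η _ hη _ using fun n => exists_isCoords (ev t (P n) (P n).2) y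
  have hinj : ∀ n ∈ ({2, 3, 4} : Set ℕ), Function.Injective ![0, 1, n] := by
    rintro n (rfl | rfl | rfl) <;> decide
  have hm : ∀ n ∈ ({2, 3, 4} : Set ℕ), ∑ l, cross (ξ 0) (ξ 1) l * ξ n l ≠ 0 := fun n hn h =>
    hx.det_ne_zero hxt hX P hξ (hinj n hn) ((sum_cross_eq_det fun r => ξ (![0, 1, n] r)).symm.trans h)
  have hl : ∀ n ∈ ({2, 3, 4} : Set ℕ), ∑ l, cross (η 0) (η 1) l * η n l ≠ 0 := fun n hn h =>
    hy.det_ne_zero hyt hY P hη (hinj n hn) ((sum_cross_eq_det fun r => η (![0, 1, n] r)).symm.trans h)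
  let E : Matrix (Fin 3) (Fin 3) ℂ := Matrix.of fun r => η (![2, 3, 4] r)
  have hE : IsUnit E.det := isUnit_iff_ne_zero.2 (hy.det_ne_zero hyt hY P hη (by decide))
  -- Let `m` be the linear form of the line through `ξ 0` and `ξ 1`, and `l` that of the line
  -- through `η 0` and `η 1`. The matrix `B` is chosen so that `B (η n)` is `l (η n) / m (ξ n)`
  -- times `ξ n` for `n = 2, 3, 4`.
  let N : Matrix (Fin 3) (Fin 3) ℂ := Matrix.of fun r l => (∑ m, cross (η 0) (η 1) m * η (![2, 3, 4] r) m) /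
    (∑ m, cross (ξ 0) (ξ 1) m * ξ (![2, 3, 4] r) m) * ξ (![2, 3, 4] r) l
  obtain ⟨B, hB⟩ : ∃ B : Matrix (Fin 3) (Fin 3) ℂ, ∀ r l, ∑ m, B l m * E r m = N r l := by
    refine ⟨(E⁻¹ * N).transpose, fun r l => ?_⟩
    have : E * (E⁻¹ * N) = N := by rw [← mul_assoc, Matrix.mul_nonsing_inv _ hE, one_mul]
    conv_rhs => rw [← this, Matrix.mul_apply]
    exact Finset.sum_congr rfl fun m _ => mul_comm _ _
  have hBη : ∀ n ∈ ({2, 3, 4} : Set ℕ), ∀ l, (∑ m, cross (ξ 0) (ξ 1) m * ξ n m) * ∑ m, B l m * η n m =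
      (∑ m, cross (η 0) (η 1) m * η n m) * ξ n l := by
    intro n hn l
    obtain ⟨r, rfl⟩ : ∃ r : Fin 3, n = ![2, 3, 4] r := by
      rcases hn with rfl | rfl | rfl
      exacts [⟨0, rfl⟩, ⟨1, rfl⟩, ⟨2, rfl⟩]
    have h1 := hB r l
    simp only [E, N, Matrix.of_apply] at h1
    rw [h1, ← mul_assoc, mul_div_cancel₀ _ (hm _ hn)]
  -- Each difference of the two sides is a form of bidegree (1,1). It vanishes at the points 0 and 1
  -- because both linear forms do, and at the points 2, 3, 4 by the choice of `B`. Five zeros are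
  -- too many, so it vanishes on `C`.
  have key : ∀ l, X l * ∑ m, constK t (cross (η 0) (η 1) m) * Y m =
      (∑ m, constK t (cross (ξ 0) (ξ 1) m) * X m) * ∑ m, constK t (B l m) * Y m := by
    intro l
    have hexp : ∀ {R : Type} [CommRing R] (σ : ℂ →+* R) (u v : Fin 3 → R),
        ∑ a, ∑ b, σ ((if a = l then cross (η 0) (η 1) b else 0) - cross (ξ 0) (ξ 1) a * B l b) * u a * v b =
        u l * (∑ m, σ (cross (η 0) (η 1) m) * v m) -
          (∑ m, σ (cross (ξ 0) (ξ 1) m) * u m) * ∑ m, σ (B l m) * v m := by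
      intro R _ σ u v
      simp only [map_sub, map_mul, sub_mul, Finset.sum_sub_distrib]
      congr 1
      · rw [Finset.sum_eq_single l (fun a _ ha => by simp [ha]) (by simp), Finset.mul_sum]
        exact Finset.sum_congr rfl fun b _ => by simp; ring
      · rw [Finset.sum_mul_sum]
        exact Finset.sum_congr rfl fun a _ => Finset.sum_congr rfl fun b _ => by ring
    rw [← sub_eq_zero, ← hexp]
    by_contra h0
    have hinj5 : Function.Injective fun n : Fin 5 => (P n).1 := fun n n' h =>
      Fin.val_injective (P.injective (Subtype.ext h))
    have h := card_le_four (M := fun a b => (if a = l then cross (η 0) (η 1) b else 0) -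
      cross (ξ 0) (ξ 1) a * B l b) hx hy hX hY h0 (Finset.univ.image fun n : Fin 5 => (P n).1) fun p hp => by
        obtain ⟨n, -, rfl⟩ := Finset.mem_image.1 hp
        refine ⟨(P n).2, ξ n, η n, hξ n, hη n, ?_⟩
        refine (hexp (RingHom.id ℂ) _ _).trans ?_
        simp only [RingHom.id_apply]
        rw [sub_eq_zero]
        have h0 : ∀ v w : Fin 3 → ℂ, ∑ m, cross v w m * v m = 0 := fun v w => by
          simpa only [mul_comm] using sum_mul_cross_left v w
        have h1 : ∀ v w : Fin 3 → ℂ, ∑ m, cross v w m * w m = 0 := fun v w => by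
          simpa only [mul_comm] using sum_mul_cross_right v w
        fin_cases n
        · exact ((congrArg _ (h0 _ _)).trans (mul_zero _)).trans
            ((congrArg (· * _) (h0 _ _)).trans (zero_mul _)).symm
        · exact ((congrArg _ (h1 _ _)).trans (mul_zero _)).trans
            ((congrArg (· * _) (h1 _ _)).trans (zero_mul _)).symm
        · exact (mul_comm _ _).trans (hBη 2 (by simp) l).symm
        · exact (mul_comm _ _).trans (hBη 3 (by simp) l).symm
        · exact (mul_comm _ _).trans (hBη 4 (by simp) l).symm
    rw [Finset.card_image_of_injective _ hinj5] at h
    exact absurd h (by decide)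
  have hcross : ∀ {v : ℕ → Fin 3 → ℂ}, ∑ l, cross (v 0) (v 1) l * v 2 l ≠ 0 → cross (v 0) (v 1) ≠ 0 :=
    fun h h' => h (by simp [h'])
  have hmX : ∑ m, constK t (cross (ξ 0) (ξ 1) m) * X m ≠ 0 := fun h =>
    hcross (hm 2 (by simp)) (hx.eq_zero hxt hX h)
  have hlY : ∑ m, constK t (cross (η 0) (η 1) m) * Y m ≠ 0 := fun h =>
    hcross (hl 2 (by simp)) (hy.eq_zero hyt hY h)
  obtain ⟨τ, hτ, hX'⟩ : ∃ τ : C.functionField, τ ≠ 0 ∧ ∀ l, X l = τ * ∑ m, constK t (B l m) * Y m :=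
    ⟨_, div_ne_zero hmX hlY, fun l => by rw [div_mul_eq_mul_div, eq_div_iff hlY, key]⟩
  -- A nonzero row vector annihilating `B` would be a linear form that vanishes on the first conic.
  have hdet : IsUnit B.det := by
    rw [isUnit_iff_ne_zero]
    intro h0
    obtain ⟨c, hc, hcB⟩ := Matrix.exists_vecMul_eq_zero_iff.2 h0
    refine hc (hx.eq_zero hxt hX ?_)
    simp only [hX', Finset.mul_sum]
    rw [Finset.sum_comm]
    refine Finset.sum_eq_zero fun m _ => ?_
    have h1 := congrArg (constK t) (congrFun hcB m)
    simp only [Matrix.vecMul, dotProduct, Pi.zero_apply, map_zero, map_sum, map_mul] at h1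
    rw [← mul_zero (τ * Y m), ← h1, Finset.mul_sum]
    exact Finset.sum_congr rfl fun l _ => by ring
  exact ⟨B⁻¹, B, Matrix.nonsing_inv_mul _ hdet, τ, hτ, hX'⟩
end collineation

/-! ### The ideal of a conic and of its graph -/

theorem eq_linear_of_totalDegree_le_one {n : ℕ} {R : Type*} [CommRing R] {g : MvPolynomial (Fin n) R}
    (hg : g.totalDegree ≤ 1) : g = MvPolynomial.C (g.coeff 0) +
      ∑ i, MvPolynomial.C (g.coeff (Finsupp.single i 1)) * MvPolynomial.X i := by
  classical
  ext m
  simp only [MvPolynomial.coeff_add, MvPolynomial.coeff_C, MvPolynomial.coeff_sum,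
    MvPolynomial.coeff_C_mul, MvPolynomial.coeff_X]
  by_cases hm : m = 0
  · subst hm
    simp
  by_cases hm1 : ∃ i, m = Finsupp.single i 1
  · obtain ⟨i, rfl⟩ := hm1
    simp [Finsupp.single_left_inj, eq_comm (a := (0 : Fin n →₀ ℕ))]
  · have h1 : g.coeff m = 0 := by
      refine MvPolynomial.coeff_eq_zero_of_totalDegree_lt (lt_of_le_of_lt hg ?_)
      obtain ⟨i, hi⟩ : ∃ i, m i ≠ 0 := by
        by_contra! h
        exact hm (Finsupp.ext h)
      obtain ⟨m', rfl⟩ := le_iff_exists_add.1 (show Finsupp.single i 1 ≤ m by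
        rw [Finsupp.single_le_iff]
        exact Nat.one_le_iff_ne_zero.2 hi)
      have h2 : m' ≠ 0 := fun h => hm1 ⟨i, by rw [h, add_zero]⟩
      have h3 : m'.degree ≠ 0 := fun h => h2 ((Finsupp.degree_eq_zero_iff m').1 h)
      change 1 < (Finsupp.single i 1 + m').degree
      rw [map_add, Finsupp.degree_single]
      omega
    rw [h1, if_neg (Ne.symm hm), zero_add, Finset.sum_eq_zero]
    intro i _
    rw [if_neg (fun h => hm1 ⟨i, h.symm⟩), mul_zero]

theorem height_le_two (M : PrimeSpectrum (MvPolynomial (Fin 2) ℂ)) : Order.height M ≤ 2 := by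
  have h1 := MvPolynomial.ringKrullDim_of_isNoetherianRing (R := ℂ) (ι := Fin 2)
  rw [ringKrullDim_eq_zero_of_field, zero_add, Nat.card_fin, ringKrullDim] at h1
  have h2 := Order.height_le_krullDim M
  rw [h1] at h2
  exact WithBot.coe_le_coe.1 h2

/-- A prime ideal of `ℂ[x, y]` that contains a polynomial `f ≠ 0` of degree at most two and no linear
polynomial is generated by `f`. -/
theorem dvd_of_map_eq_zero {K : Type*} [Field K] (ψ : MvPolynomial (Fin 2) ℂ →+* K)
    (hψ : ∀ g : MvPolynomial (Fin 2) ℂ, g.totalDegree ≤ 1 → ψ g = 0 → g = 0) {f : MvPolynomial (Fin 2) ℂ}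
    (hf0 : f ≠ 0) (hf : f.totalDegree ≤ 2) (hψf : ψ f = 0) {g : MvPolynomial (Fin 2) ℂ} (hg : ψ g = 0) : f ∣ g := by
  -- One of two factors is killed by `ψ`, so it has degree at least two. It takes up the whole
  -- degree of `f`, and the other factor is constant.
  have hirr : Irreducible f := by
    have key : ∀ a b, f = a * b → ψ a = 0 → IsUnit b := by
      intro a b hab ha
      have ha0 : a ≠ 0 := fun h => hf0 (by rw [hab, h, zero_mul])
      have hb0 : b ≠ 0 := fun h => hf0 (by rw [hab, h, mul_zero])
      have h1 := MvPolynomial.totalDegree_mul_of_isDomain ha0 hb0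
      rw [← hab] at h1
      have h2 : ¬ a.totalDegree ≤ 1 := fun h => ha0 (hψ a h ha)
      have h3 : b.totalDegree = 0 := by omega
      rw [MvPolynomial.totalDegree_eq_zero_iff_eq_C] at h3
      rw [h3] at hb0 ⊢
      exact (isUnit_iff_ne_zero.2 fun h => hb0 (by rw [h, map_zero])).map MvPolynomial.C
    refine ⟨fun hu => (hu.map ψ).ne_zero hψf, fun a b hab => ?_⟩
    rw [hab, map_mul, mul_eq_zero] at hψf
    rcases hψf with h | h
    · exact Or.inr (key a b hab h)
    · exact Or.inl (key b a (hab.trans (mul_comm _ _)) h)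
  have hprime : (Ideal.span {f}).IsPrime := (Ideal.span_singleton_prime hf0).2 hirr.prime
  rw [← Ideal.mem_span_singleton]
  by_contra hcon
  have hP : (RingHom.ker ψ).IsPrime := RingHom.ker_isPrime ψ
  have hlt : Ideal.span {f} < RingHom.ker ψ := by
    refine lt_of_le_of_ne ((Ideal.span_singleton_le_iff_mem _).2 hψf) fun h => hcon ?_
    rw [h]
    exact hg
  -- By the Nullstellensatz a maximal ideal contains a linear polynomial `X 0 - C (z 0)`.
  have hnm : ¬ (RingHom.ker ψ).IsMaximal := by
    intro h
    obtain ⟨z, hz⟩ := MvPolynomial.isMaximal_iff_eq_vanishingIdeal_singleton.1 h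
    have h1 : MvPolynomial.X 0 - MvPolynomial.C (z 0) ∈ RingHom.ker ψ := by
      rw [hz, MvPolynomial.mem_vanishingIdeal_singleton_iff]
      simp
    have h2 := hψ _ ((MvPolynomial.totalDegree_sub _ _).trans (by simp)) h1
    have h3 := congrArg (MvPolynomial.eval fun _ => z 0 + 1) h2
    simp at h3
  -- If `f` did not generate the kernel, the primes `0`, `(f)`, `ker ψ`, `M` would form a strict
  -- chain of length three in a ring of dimension two.
  obtain ⟨M, hM, hle⟩ := Ideal.exists_le_maximal _ hP.ne_top
  have hlt' : RingHom.ker ψ < M := lt_of_le_of_ne hle fun h => hnm (h ▸ hM)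
  have h0 : (⊥ : Ideal (MvPolynomial (Fin 2) ℂ)) < Ideal.span {f} :=
    bot_lt_iff_ne_bot.2 (Ideal.span_singleton_eq_bot.not.2 hf0)
  let p0 : PrimeSpectrum (MvPolynomial (Fin 2) ℂ) := ⟨⊥, Ideal.isPrime_bot⟩
  have h1 := Order.height_add_one_le (show p0 < ⟨_, hprime⟩ from h0)
  have h2 := Order.height_add_one_le (show (⟨_, hprime⟩ : PrimeSpectrum _) < ⟨_, hP⟩ from hlt)
  have h3 := Order.height_add_one_le (show (⟨_, hP⟩ : PrimeSpectrum _) < ⟨M, hM.isPrime⟩ from hlt')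
  have h4 := height_le_two ⟨M, hM.isPrime⟩
  have h5 : (3 : ℕ∞) ≤ 2 := by
    calc (3 : ℕ∞) = 0 + 1 + 1 + 1 := rfl
      _ ≤ Order.height p0 + 1 + 1 + 1 := by gcongr; exact bot_le
      _ ≤ 2 := (add_le_add_left ((add_le_add_left h1 1).trans h2) 1).trans (h3.trans h4)
  exact absurd h5 (by decide)

/-- A polynomial that vanishes on a conic not contained in a line is a multiple of the equation of the conic. -/
theorem eval₂_eq_zero_of_conic {K : Type} [Field K] {κ : ℂ →+* K} {B : Matrix (Fin 3) (Fin 3) ℂ}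
    (hB : B.det ≠ 0) {Y : Fin 3 → K} (hY : ∀ c : Fin 3 → ℂ, ∑ l, κ (c l) * Y l = 0 → c = 0)
    (hYB : ∑ l, Y l * ∑ m, κ (B l m) * Y m = 0) {j : Fin 3} {G : MvPolynomial (Fin 3) ℂ}
    (hG : G.eval₂ κ (fun l => Y l / Y j) = 0) {R : Type} [CommRing R] (σ : ℂ →+* R) {v : Fin 3 → R}
    (hv : v j = 1) (hvB : ∑ l, v l * ∑ m, σ (B l m) * v m = 0) : G.eval₂ σ v = 0 := by
  have hYj : Y j ≠ 0 := by
    intro h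
    have := congrFun (hY (Pi.single j 1) (by
      rw [Finset.sum_eq_single j (fun l _ hl => by simp [hl]) (by simp), h, mul_zero])) j
    simp at this
  obtain ⟨a, haj⟩ : ∃ a, j ≠ a := (exists_ne j).imp fun _ => Ne.symm
  obtain ⟨b, hbj, hba, hall, hs⟩ := exists_third haj
  -- The generic point of the chart `j`, with the coordinates `a` and `b` as the two variables.
  obtain ⟨w, hw⟩ : ∃ w : Fin 3 → MvPolynomial (Fin 2) ℂ, w = fun l =>
    if l = j then 1 else if l = a then MvPolynomial.X 0 else MvPolynomial.X 1 := ⟨_, rfl⟩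
  have hwj : w j = 1 := by simp [hw]
  have hwa : w a = MvPolynomial.X 0 := by simp [hw, haj.symm]
  have hwb : w b = MvPolynomial.X 1 := by simp [hw, hbj, hba]
  have key : ∀ {S : Type} [CommRing S] (τ : ℂ →+* S) (u : Fin 3 → S), u j = 1 → ∀ l,
      (w l).eval₂ τ ![u a, u b] = u l := by
    intro S _ τ u hu l
    rcases hall l with rfl | rfl | rfl
    · rw [hwj, hu, MvPolynomial.eval₂_one]
    · rw [hwa, MvPolynomial.eval₂_X]; rfl
    · rw [hwb, MvPolynomial.eval₂_X]; rfl
  have hwdeg : ∀ l, (w l).totalDegree ≤ 1 := fun l => by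
    rcases hall l with rfl | rfl | rfl
    · rw [hwj, MvPolynomial.totalDegree_one]; exact Nat.zero_le _
    · rw [hwa, MvPolynomial.totalDegree_X]
    · rw [hwb, MvPolynomial.totalDegree_X]
  obtain ⟨f, hf⟩ : ∃ f, f = ∑ l, w l * ∑ m, MvPolynomial.C (B l m) * w m := ⟨_, rfl⟩
  have hfe : ∀ {S : Type} [CommRing S] (τ : ℂ →+* S) (u : Fin 3 → S), u j = 1 →
      f.eval₂ τ ![u a, u b] = ∑ l, u l * ∑ m, τ (B l m) * u m := by
    intro S _ τ u hu
    simp only [hf, MvPolynomial.eval₂_sum, MvPolynomial.eval₂_mul, MvPolynomial.eval₂_C, key τ u hu]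
  have hGe : ∀ {S : Type} [CommRing S] (τ : ℂ →+* S) (u : Fin 3 → S), u j = 1 →
      (G.eval₂ MvPolynomial.C w).eval₂ τ ![u a, u b] = G.eval₂ τ u := by
    intro S _ τ u hu
    refine (MvPolynomial.hom_eval₂ G MvPolynomial.C (MvPolynomial.eval₂Hom τ ![u a, u b]) w).trans ?_
    exact congrArg₂ (fun x y => MvPolynomial.eval₂ x y G) (RingHom.ext fun r => MvPolynomial.eval₂_C _ _ _)
      (funext fun l => key τ u hu l)
  obtain ⟨u, hu⟩ : ∃ u : Fin 3 → K, u = fun l => Y l / Y j := ⟨_, rfl⟩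
  have huj : u j = 1 := by rw [hu]; exact div_self hYj
  rw [← hu] at hG
  -- The dehomogenized equation `f` of the conic divides the dehomogenized `G`, and this
  -- divisibility can be evaluated at `v` in any ring.
  have hdvd : f ∣ G.eval₂ MvPolynomial.C w := by
    refine dvd_of_map_eq_zero (MvPolynomial.eval₂Hom κ ![u a, u b]) ?_ ?_ ?_ ?_ ?_
    · intro g hg h
      rw [eq_linear_of_totalDegree_le_one hg, Fin.sum_univ_two]
      rw [eq_linear_of_totalDegree_le_one hg, Fin.sum_univ_two] at h
      generalize g.coeff 0 = c₀ at h ⊢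
      generalize g.coeff (Finsupp.single 0 1) = c₁ at h ⊢
      generalize g.coeff (Finsupp.single 1 1) = c₂ at h ⊢
      have h1 := hY (fun l => if l = j then c₀ else if l = a then c₁ else c₂) (by
        simp only [hs, if_true, haj.symm, hbj, hba, if_false]
        simp only [MvPolynomial.coe_eval₂Hom, MvPolynomial.eval₂_add, MvPolynomial.eval₂_mul,
          MvPolynomial.eval₂_C, MvPolynomial.eval₂_X, Matrix.cons_val_zero, Matrix.cons_val_one, hu] at h
        field_simp at h
        linear_combination h)
      have h2 := congrFun h1 j
      have h3 := congrFun h1 a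
      have h4 := congrFun h1 b
      simp only [if_true, haj.symm, hbj, hba, if_false, Pi.zero_apply] at h2 h3 h4
      simp [h2, h3, h4]
    · intro h0
      refine hB (det_eq_zero_of_quadratic j fun x hx => ?_)
      have := hfe (RingHom.id ℂ) x hx
      rw [h0, MvPolynomial.eval₂_zero] at this
      exact this.symm
    · rw [hf]
      refine MvPolynomial.totalDegree_finsetSum_le fun l _ => ?_
      refine (MvPolynomial.totalDegree_mul _ _).trans ?_
      refine (add_le_add (hwdeg l) ?_ : _ ≤ 1 + 1)
      refine MvPolynomial.totalDegree_finsetSum_le fun m _ => ?_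
      refine (MvPolynomial.totalDegree_mul _ _).trans ?_
      rw [MvPolynomial.totalDegree_C, zero_add]
      exact hwdeg m
    · refine (hfe κ u huj).trans ?_
      rw [hu, ← mul_zero (1 / Y j ^ 2), ← hYB, Finset.mul_sum]
      refine Finset.sum_congr rfl fun l _ => ?_
      rw [Finset.mul_sum, Finset.mul_sum, Finset.mul_sum]
      refine Finset.sum_congr rfl fun m _ => ?_
      field_simp
    · exact (hGe κ u huj).trans hG
  obtain ⟨e, he⟩ := hdvd
  rw [← hGe σ v hv, he, MvPolynomial.eval₂_mul, hfe σ v hv, hvB, zero_mul]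

theorem mul_comm_of_cross_eq_zero {R : Type*} [CommRing R] {x b : Fin 3 → R} (h : ∀ l, cross x b l = 0)
    (l m : Fin 3) : x l * b m = x m * b l := by
  have h0 := h 0
  have h1 := h 1
  have h2 := h 2
  rw [cross_zero] at h0
  rw [cross_one] at h1
  rw [cross_two] at h2
  fin_cases l <;> fin_cases m <;> simp only [Fin.zero_eta, Fin.mk_one, Fin.reduceFinMk] <;> grind

/-- Put `b = B y`. Modulo `J` the minors give `x l * b i = b l`, and `b i` is a unit because the
`j`-th coordinate of `A b` is `y j = 1`. So `x` is `b / b i`, the incidence equation becomes `y · b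
= 0`, and up to a power of `b i` every element is a polynomial in `y`. For such a polynomial,
vanishing under `Ψ` means divisibility by the equation of the conic. -/
theorem ker_eq_of_conic {K R : Type} [Field K] [CommRing R] {κ : ℂ →+* K} {A B : Matrix (Fin 3) (Fin 3) ℂ}
    (hAB : A * B = 1) {X Y : Fin 3 → K} {τ : K} (hX : ∀ l, X l = τ * ∑ m, κ (B l m) * Y m)
    (hY : ∀ c : Fin 3 → ℂ, ∑ l, κ (c l) * Y l = 0 → c = 0) (hXY : ∑ l, X l * Y l = 0)
    {i j : Fin 3} (hXi : X i ≠ 0) (σ : ℂ →+* R) {x y : Fin 3 → R} (hxi : x i = 1) (hyj : y j = 1)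
    (hgen : ∀ f : R, ∃ F : MvPolynomial (Fin 3 ⊕ Fin 3) ℂ, F.eval₂ σ (Sum.elim x y) = f)
    (Ψ : R →+* K) (hΨσ : ∀ r, Ψ (σ r) = κ r) (hΨx : ∀ l, Ψ (x l) = X l / X i) (hΨy : ∀ l, Ψ (y l) = Y l / Y j) :
    RingHom.ker Ψ = Ideal.span {∑ l, x l * y l} ⊔
      Ideal.span (Set.range (cross x fun l => ∑ m, σ (B l m) * y m)) := by
  obtain ⟨J, hJ⟩ : ∃ J, J = Ideal.span {∑ l, x l * y l} ⊔
      Ideal.span (Set.range (cross x fun l => ∑ m, σ (B l m) * y m)) := ⟨_, rfl⟩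
  have hΨb : ∀ l, Ψ (∑ m, σ (B l m) * y m) = (∑ m, κ (B l m) * Y m) / Y j := fun l => by
    rw [map_sum, Finset.sum_div]
    exact Finset.sum_congr rfl fun m _ => by rw [map_mul, hΨσ, hΨy, mul_div_assoc]
  have hJle : J ≤ RingHom.ker Ψ := by
    rw [hJ, sup_le_iff, Ideal.span_singleton_le_iff_mem, Ideal.span_le, RingHom.mem_ker]
    constructor
    · rw [map_sum, ← zero_div (X i * Y j), ← hXY, Finset.sum_div]
      exact Finset.sum_congr rfl fun l _ => by rw [map_mul, hΨx, hΨy, div_mul_div_comm]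
    · rintro _ ⟨l, rfl⟩
      rw [SetLike.mem_coe, RingHom.mem_ker, map_cross]
      simp only [cross, hΨx, hΨb, hX]
      ring
  rw [← hJ]
  refine le_antisymm (fun f hf => ?_) hJle
  let π := Ideal.Quotient.mk J
  let Ψ' : R ⧸ J →+* K := Ideal.Quotient.lift J Ψ fun a ha => hJle ha
  obtain ⟨b, hb⟩ : ∃ b : Fin 3 → R ⧸ J, b = fun l => ∑ m, π (σ (B l m)) * π (y m) := ⟨_, rfl⟩
  have hxb : ∀ l, π (x l) * b i = b l := by
    have h1 : ∀ l, cross (fun l => π (x l)) b l = 0 := fun l => by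
      have h2 : cross x (fun l => ∑ m, σ (B l m) * y m) l ∈ J := by
        rw [hJ]
        exact Ideal.mem_sup_right (Ideal.subset_span ⟨l, rfl⟩)
      rw [← Ideal.Quotient.eq_zero_iff_mem, map_cross] at h2
      rw [← h2, hb]
      simp only [map_sum, map_mul]
      rfl
    intro l
    have h2 := mul_comm_of_cross_eq_zero h1 l i
    simp only [hxi, map_one, one_mul] at h2
    exact h2
  have hu : IsUnit (b i) := by
    refine IsUnit.of_mul_eq_one_right (∑ l, π (σ (A j l)) * π (x l)) ?_
    have h1 : ∀ m, ∑ l, π (σ (A j l)) * π (σ (B l m)) = π (σ ((1 : Matrix (Fin 3) (Fin 3) ℂ) j m)) := fun m => by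
      rw [← hAB, Matrix.mul_apply, map_sum, map_sum]
      exact Finset.sum_congr rfl fun l _ => by rw [map_mul, map_mul]
    calc (∑ l, π (σ (A j l)) * π (x l)) * b i = ∑ l, π (σ (A j l)) * b l := by
          rw [Finset.sum_mul]
          exact Finset.sum_congr rfl fun l _ => by rw [mul_assoc, hxb]
      _ = ∑ m, (∑ l, π (σ (A j l)) * π (σ (B l m))) * π (y m) := by
          rw [hb]
          simp only [Finset.mul_sum, Finset.sum_mul]
          rw [Finset.sum_comm]
          exact Finset.sum_congr rfl fun l _ => Finset.sum_congr rfl fun m _ => (mul_assoc _ _ _).symm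
      _ = 1 := by
          simp only [h1]
          rw [Finset.sum_eq_single j (fun m _ hm => by rw [Matrix.one_apply_ne hm.symm, map_zero, map_zero, zero_mul])
            (by simp), Matrix.one_apply_eq, hyj, map_one, map_one, mul_one]
  have hyb : ∑ l, π (y l) * b l = 0 := by
    have h1 : ∑ l, x l * y l ∈ J := by
      rw [hJ]
      exact Ideal.mem_sup_left (Ideal.mem_span_singleton_self _)
    rw [← Ideal.Quotient.eq_zero_iff_mem, map_sum] at h1
    rw [← zero_mul (b i), ← h1, Finset.sum_mul]
    exact Finset.sum_congr rfl fun l _ => by rw [← hxb l, map_mul]; ring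
  -- Clearing the denominator `b i` turns a polynomial in `x` and `y` into one in `y` alone.
  have hhom : ∀ F : MvPolynomial (Fin 3 ⊕ Fin 3) ℂ, ∃ (N : ℕ) (G : MvPolynomial (Fin 3) ℂ),
      π (F.eval₂ σ (Sum.elim x y)) * b i ^ N = G.eval₂ (π.comp σ) (fun l => π (y l)) := by
    intro F
    induction F using MvPolynomial.induction_on with
    | C r => exact ⟨0, MvPolynomial.C r, by simp⟩
    | add F F' h h' =>
      obtain ⟨N, G, hG⟩ := h
      obtain ⟨N', G', hG'⟩ := h'
      let H : MvPolynomial (Fin 3) ℂ := ∑ m, MvPolynomial.C (B i m) * MvPolynomial.X m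
      have hH : H.eval₂ (π.comp σ) (fun l => π (y l)) = b i := by
        simp [H, hb]
      refine ⟨N + N', G * H ^ N' + G' * H ^ N, ?_⟩
      rw [MvPolynomial.eval₂_add, MvPolynomial.eval₂_add, MvPolynomial.eval₂_mul, MvPolynomial.eval₂_mul,
        MvPolynomial.eval₂_pow, MvPolynomial.eval₂_pow, hH, ← hG, ← hG', map_add]
      ring
    | mul_X F v h =>
      obtain ⟨N, G, hG⟩ := h
      rcases v with l | l
      · let H : MvPolynomial (Fin 3) ℂ := ∑ m, MvPolynomial.C (B l m) * MvPolynomial.X m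
        have hH : H.eval₂ (π.comp σ) (fun l => π (y l)) = b l := by
          simp [H, hb]
        refine ⟨N + 1, G * H, ?_⟩
        rw [MvPolynomial.eval₂_mul, MvPolynomial.eval₂_mul, MvPolynomial.eval₂_X, hH, ← hG, map_mul,
          Sum.elim_inl, ← hxb l]
        ring
      · refine ⟨N, G * MvPolynomial.X l, ?_⟩
        rw [MvPolynomial.eval₂_mul, MvPolynomial.eval₂_mul, MvPolynomial.eval₂_X, MvPolynomial.eval₂_X, ← hG,
          map_mul, Sum.elim_inr]
        ring
  obtain ⟨F, rfl⟩ := hgen f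
  obtain ⟨N, G, hG⟩ := hhom F
  have hτ : τ ≠ 0 := fun h => hXi (by rw [hX, h, zero_mul])
  have hYB : ∑ l, Y l * ∑ m, κ (B l m) * Y m = 0 := by
    apply mul_left_cancel₀ hτ
    rw [mul_zero, ← hXY, Finset.mul_sum]
    exact Finset.sum_congr rfl fun l _ => by rw [hX]; ring
  have hdet : B.det ≠ 0 := by
    intro h
    have := congrArg Matrix.det hAB
    rw [Matrix.det_mul, h, mul_zero, Matrix.det_one] at this
    exact zero_ne_one this
  have hGK : G.eval₂ κ (fun l => Y l / Y j) = 0 := by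
    have h1 := congrArg Ψ' hG
    rw [map_mul] at h1
    have h2 : Ψ' (π (F.eval₂ σ (Sum.elim x y))) = 0 := hf
    rw [h2, zero_mul] at h1
    refine Eq.trans ?_ ((MvPolynomial.hom_eval₂ G (π.comp σ) Ψ' _).symm.trans h1.symm)
    exact congrArg₂ (fun a b => MvPolynomial.eval₂ a b G) (RingHom.ext fun r => (hΨσ r).symm)
      (funext fun l => (hΨy l).symm)
  have hG0 := eval₂_eq_zero_of_conic hdet hY hYB hGK (π.comp σ) (v := fun l => π (y l))
    (by rw [hyj, map_one]) (by rw [hb] at hyb; exact hyb)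
  rw [← Ideal.Quotient.eq_zero_iff_mem]
  rw [hG0] at hG
  exact (hu.pow N).mul_left_eq_zero.1 hG

/-! ### The ideal of the curve in the flag variety -/

section
variable {C : Scheme.{0}} [IsIntegralCurve C]

/-- No coordinate vanishes identically on either conic, so every chart contains the generic point of
`C`. As `C` is integral, its ideal on a chart is the kernel of evaluation in the function field, to
which `ker_eq_of_conic` applies. -/
theorem ker_eq_flagIdeal_sup_minorIdeal {φ : C ⟶ P2xP2} [IsClosedImmersion φ]
    (hφ : Incident (φ ≫ P2xP2.str) 1 (φ ≫ P2xP2.proj 0) (φ ≫ P2xP2.proj 1))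
    {X Y : Fin 3 → C.functionField} (hX : IsGenericCoords (φ ≫ P2xP2.proj 0) X)
    (hY : IsGenericCoords (φ ≫ P2xP2.proj 1) Y)
    (hX0 : ∀ c : Fin 3 → ℂ, ∑ l, constK (φ ≫ P2xP2.str) (c l) * X l = 0 → c = 0)
    (hY0 : ∀ c : Fin 3 → ℂ, ∑ l, constK (φ ≫ P2xP2.str) (c l) * Y l = 0 → c = 0)
    {A B : Matrix (Fin 3) (Fin 3) ℂ} (hAB : A * B = 1) {τ : C.functionField}
    (hXY : ∀ l, X l = τ * ∑ m, constK (φ ≫ P2xP2.str) (B l m) * Y m) :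
    φ.ker = flagIdeal ⊔ minorIdeal B := by
  refine Scheme.IdealSheafData.ext_of_iSup_eq_top
    (fun j : Fin 2 → Fin 3 => ⟨_, isProd_P2xP2.isAffineOpen_chart j⟩) (iSup_chart P2xP2.proj) fun j => ?_
  have hchart : ∀ {x : C ⟶ P2} {X : Fin 3 → C.functionField}, IsGenericCoords x X →
      (∀ c : Fin 3 → ℂ, ∑ l, constK (φ ≫ P2xP2.str) (c l) * X l = 0 → c = 0) → ∀ i,
      genericPoint C ∈ x ⁻¹ᵁ P2.chart i ∧ X i ≠ 0 := by
    intro x X hX hX0 i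
    have hXi : X i ≠ 0 := fun h => by
      have := congrFun (hX0 (Pi.single i 1) (by
        rw [Finset.sum_eq_single i (fun l _ hl => by simp [hl]) (by simp), h, mul_zero])) i
      simp at this
    obtain ⟨n, hn'⟩ := exists_chart x
    have hn : genericPoint C ∈ x ⁻¹ᵁ P2.chart (n (genericPoint C)) := hn' _
    have h1 : genericPoint C ∈ C.basicOpen (co x (n (genericPoint C)) _ le_rfl i) := by
      rw [C.mem_basicOpen _ _ hn, isUnit_iff_ne_zero]
      intro h
      have h2 := hX.toK_co le_rfl hn i
      rw [show toK _ hn (co x (n (genericPoint C)) _ le_rfl i) = 0 from h, zero_mul] at h2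
      exact hXi h2.symm
    rw [basicOpen_co] at h1
    exact ⟨h1.2, hXi⟩
  obtain ⟨hη0, hXi⟩ := hchart hX hX0 (j 0)
  obtain ⟨hη1, hYj⟩ := hchart hY hY0 (j 1)
  obtain ⟨V, hV⟩ : ∃ V, V = φ ⁻¹ᵁ chart P2xP2.proj j := ⟨_, rfl⟩
  have hη : genericPoint C ∈ V := hV.ge (mem_chart.2 fun a => by
    fin_cases a
    · exact hη0
    · exact hη1)
  have hle : V ≤ φ ⁻¹ᵁ chart P2xP2.proj j := hV.le
  have hsum : ∑ l, X l * Y l = 0 := by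
    have h0 : V ≤ (φ ≫ P2xP2.proj 0) ⁻¹ᵁ P2.chart (j 0) := hle.trans (φ.preimage_mono (chart_le P2xP2.proj j 0))
    have h1 : V ≤ (φ ≫ P2xP2.proj 1) ⁻¹ᵁ P2.chart (j 1) := hle.trans (φ.preimage_mono (chart_le P2xP2.proj j 1))
    have h2 := congrArg (toK V hη) (incident_one hφ h0 h1)
    rw [map_sum, map_zero] at h2
    rw [← mul_zero (X (j 0) * Y (j 1)), ← h2, Finset.mul_sum]
    refine Finset.sum_congr rfl fun l _ => ?_
    rw [← hX.toK_co h0 hη l, ← hY.toK_co h1 hη l, map_mul]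
    ring
  rw [Scheme.Hom.ker_apply, Scheme.IdealSheafData.ideal_sup, Pi.sup_apply]
  have h1 := comap_minorIdeal B (𝟙 P2xP2) ⟨_, isProd_P2xP2.isAffineOpen_chart j⟩ (i := j 0) (j := j 1)
    (chart_le P2xP2.proj j 0) (chart_le P2xP2.proj j 1)
  have h2 : flagIdeal.ideal ⟨_, isProd_P2xP2.isAffineOpen_chart j⟩ =
      Ideal.span {∑ l, coordinate P2xP2.proj j 0 l * coordinate P2xP2.proj j 1 l} := by
    have := isProd_P2xP2.zeroIdeal_chart (isMultihomogeneous_bil 1 0 1) j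
    rw [bil_one] at this
    refine this.trans ?_
    congr 2
    rw [← bil_one]
    exact map_dehomogenize_bil_one (RingHom.id _) 0 1
  have hinj := toK_injective hη
  have h3 : RingHom.ker (φ.app (chart P2xP2.proj j)).hom =
      RingHom.ker ((toK V hη).comp (φ.appLE (chart P2xP2.proj j) V hle).hom) := by
    subst hV
    ext f
    rw [RingHom.mem_ker, RingHom.mem_ker, RingHom.comp_apply, map_eq_zero_iff _ hinj, Scheme.Hom.app_eq_appLE]
  simp only [Scheme.IdealSheafData.comap_id] at h1
  rw [h1, h2]
  refine h3.trans ?_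
  refine (ker_eq_of_conic hAB hXY hY0 hsum hXi (scalars P2xP2.str _) (x := coordinate P2xP2.proj j 0)
    (y := coordinate P2xP2.proj j 1) (coordinate_self _ _ _) (coordinate_self _ _ _) (fun f => ?_) _ (fun r => ?_)
    (fun l => ?_) (fun l => ?_)).trans ?_
  · obtain ⟨F, rfl⟩ := isProd_P2xP2.dehomogenize_surjective j f
    refine ⟨MvPolynomial.rename (fun v : Fin 2 × Fin 3 => if v.1 = 0 then Sum.inl v.2 else Sum.inr v.2) F, ?_⟩
    rw [MvPolynomial.eval₂_rename]
    refine congrArg₂ (fun a b => MvPolynomial.eval₂ a b F) rfl (funext fun v => ?_)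
    obtain ⟨a, l⟩ := v
    fin_cases a <;> rfl
  · rw [RingHom.comp_apply, appLE_scalars, toK_scalars]
  · rw [eq_div_iff hXi, ← hX.toK_co (hle.trans (φ.preimage_mono (chart_le P2xP2.proj j 0))) hη l]
    exact congrArg (fun a => toK V hη a * _) (appLE_co φ _ _ hle l)
  · rw [eq_div_iff hYj, ← hY.toK_co (hle.trans (φ.preimage_mono (chart_le P2xP2.proj j 1))) hη l]
    exact congrArg (fun a => toK V hη a * _) (appLE_co φ _ _ hle l)
  · congr 1
end

/-! ### Conclusion -/

section main
variable {C : Scheme.{0}} [IsIntegralCurve C]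

/-- The hypothesis is applied to the divisor of one coordinate, with an arbitrary numerator `g`.
Coordinates of the other factors are chosen at will, since they enter with exponent zero. -/
theorem IsProd.isConic {k : ℕ} {T : Scheme.{0}} {s : T ⟶ SpecC} {q : Fin k → (T ⟶ P2)} (hq : IsProd s q)
    {φ : C ⟶ T} (a : Fin k)
    (h : ∀ H : T.IdealSheafData, IsDivisorOfMultidegree s q (Pi.single a 1) H → HasDegree H φ 2) :
    IsConic (φ ≫ q a) := by
  intro X hX i hi g hg
  choose Z _ hZ _ using fun b => exists_isCoords (p := genericPoint C) (RingHom.id C.functionField) (φ ≫ q b)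
  choose J hJ using fun b => exists_chart (φ ≫ q b)
  have hF : IsMultihomogeneous (MvPolynomial.X (a, 0) : MvPolynomial (Fin k × Fin 3) ℂ) (Pi.single a 1) :=
    MvPolynomial.isWeightedHomogeneous_X ℂ _ (a, 0)
  obtain ⟨σ, hσ⟩ := hq.exists_rationalSection hF (MvPolynomial.X_ne_zero _) φ
    (X := Function.update Z a X) (J := fun p => Function.update (fun b => J b p) a (i p)) (fun b => by
      by_cases hb : b = a
      · subst hb
        rwa [Function.update_self]
      · rw [Function.update_of_ne hb]
        exact hZ b) (fun p => mem_chart.2 fun b => by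
      by_cases hb : b = a
      · subst hb
        rw [Function.update_self]
        exact hi p
      · rw [Function.update_of_ne hb]
        exact hJ b p) hg
  rw [← (h _ ⟨_, MvPolynomial.X_ne_zero _, hF, rfl⟩).2 σ, RationalSection.degree]
  refine finsum_congr fun p => ?_
  rw [hσ, Finset.prod_eq_single a (fun b _ hb => by rw [Pi.single_eq_of_ne hb, pow_zero])
    (fun h => absurd (Finset.mem_univ a) h), Pi.single_eq_same, pow_one, Function.update_self,
    Function.update_self]

theorem isDivisorOfMultidegree_bil {k : ℕ} {T : Scheme.{0}} (s : T ⟶ SpecC) (q : Fin k → (T ⟶ P2))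
    {M : Matrix (Fin 3) (Fin 3) ℂ} (hM : M ≠ 0) {a b : Fin k} (hab : a ≠ b) {d : Fin k → ℕ}
    (hd : Pi.single a 1 + Pi.single b 1 = d) : IsDivisorOfMultidegree s q d (zeroIdeal s q (bil M a b)) :=
  ⟨_, bil_ne_zero hM hab, hd ▸ isMultihomogeneous_bil M a b, rfl⟩

theorem exists_ker_eq (c : C ⟶ W) [IsClosedImmersion c]
    (h0 : ∀ H : P2xP2.IdealSheafData,
      IsDivisorOfMultidegree P2xP2.str P2xP2.proj ![1, 0] H → HasDegree H (c ≫ W.ι) 2)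
    (h1 : ∀ H : P2xP2.IdealSheafData,
      IsDivisorOfMultidegree P2xP2.str P2xP2.proj ![0, 1] H → HasDegree H (c ≫ W.ι) 2)
    (e0 : IsClosedImmersion (c ≫ W.ι ≫ P2xP2.proj 0)) (e1 : IsClosedImmersion (c ≫ W.ι ≫ P2xP2.proj 1)) :
    ∃ A B : Matrix (Fin 3) (Fin 3) ℂ, A * B = 1 ∧ c.ker = (minorIdeal B).comap W.ι := by
  obtain ⟨φ, hφ⟩ : ∃ φ, φ = c ≫ W.ι := ⟨_, rfl⟩
  have hφc : IsClosedImmersion φ := hφ ▸ inferInstance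
  have hinc : Incident (φ ≫ P2xP2.str) 1 (φ ≫ P2xP2.proj 0) (φ ≫ P2xP2.proj 1) := by
    rw [hφ]
    simpa only [Category.assoc] using W.incident c
  rw [← Category.assoc, ← hφ] at e0 e1
  rw [← hφ] at h0 h1
  have hx : IsConic (φ ≫ P2xP2.proj 0) := isProd_P2xP2.isConic 0 fun H hH => h0 H (by
    rwa [show (![1, 0] : Fin 2 → ℕ) = Pi.single 0 1 by decide])
  have hy : IsConic (φ ≫ P2xP2.proj 1) := isProd_P2xP2.isConic 1 fun H hH => h1 H (by
    rwa [show (![0, 1] : Fin 2 → ℕ) = Pi.single 1 1 by decide])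
  have hxt : (φ ≫ P2xP2.proj 0) ≫ P2.str = φ ≫ P2xP2.str := by
    rw [Category.assoc, isProd_P2xP2.comp_str]
  have hyt : (φ ≫ P2xP2.proj 1) ≫ P2.str = φ ≫ P2xP2.str := by
    rw [Category.assoc, isProd_P2xP2.comp_str]
  have hft : LocallyOfFiniteType (φ ≫ P2xP2.str) := hxt ▸ inferInstance
  obtain ⟨X, -, hX, -⟩ := exists_isCoords (p := genericPoint C) (RingHom.id C.functionField) (φ ≫ P2xP2.proj 0)
  obtain ⟨Y, -, hY, -⟩ := exists_isCoords (p := genericPoint C) (RingHom.id C.functionField) (φ ≫ P2xP2.proj 1)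
  obtain ⟨A, B, hAB, τ, -, hXY⟩ := exists_collineation hx hy hxt hyt hX hY
  refine ⟨A, B, hAB, ?_⟩
  have h2 := ker_eq_flagIdeal_sup_minorIdeal hinc hX hY (fun _ => hx.eq_zero hxt hX)
    (fun _ => hy.eq_zero hyt hY) hAB hXY
  -- The ideal of `C` in `W` is the restriction of its ideal in the product, and restriction to `W`
  -- kills `flagIdeal`.
  rw [← map_comap_isClosedImmersion c.ker W.ι, ← Scheme.Hom.ker_comp, ← hφ, h2,
    (Scheme.IdealSheafData.map_gc W.ι).l_sup, (comap_eq_bot_iff flagIdeal W.ι).2 flagIdeal.ker_subschemeι.ge,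
    bot_sup_eq]

end main

theorem IsBlowup.exists_iso {X Y Z : Scheme.{0}} {π : Y ⟶ X} {ρ : Z ⟶ X} {I : X.IdealSheafData}
    (hπ : IsBlowup π I) (hρ : IsBlowup ρ I) : ∃ e : Y ≅ Z, e.hom ≫ ρ = π := by
  obtain ⟨f, hf, -⟩ := hρ.2 Y π hπ.1
  obtain ⟨g, hg, -⟩ := hπ.2 Z ρ hρ.1
  refine ⟨⟨f, g, (hπ.2 Y π hπ.1).unique ?_ (Category.id_comp π), (hρ.2 Z ρ hρ.1).unique ?_ (Category.id_comp ρ)⟩, hf⟩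
  · rw [Category.assoc, hg, hf]
  · rw [Category.assoc, hf, hg]

end FlagBlowup

end

open FlagBlowup in
theorem mainTheorem7
    (C : Scheme.{0}) [IsIntegralCurve C] (c : C ⟶ W) [IsClosedImmersion c]
    (bidegree_fst : ∀ H : P2xP2.IdealSheafData,
      IsDivisorOfMultidegree P2xP2.str P2xP2.proj ![1, 0] H → HasDegree H (c ≫ W.ι) 2)
    (bidegree_snd : ∀ H : P2xP2.IdealSheafData,
      IsDivisorOfMultidegree P2xP2.str P2xP2.proj ![0, 1] H → HasDegree H (c ≫ W.ι) 2)
    (embedded_fst : IsClosedImmersion (c ≫ W.ι ≫ P2xP2.proj 0))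
    (embedded_snd : IsClosedImmersion (c ≫ W.ι ≫ P2xP2.proj 1)) :
    (∃ (Y : Scheme.{0}) (π : Y ⟶ W), IsBlowup π c.ker) ∧
    ∀ (Y : Scheme.{0}) (π : Y ⟶ W), IsBlowup π c.ker →
      ∃ D₁ D₂ D₃ : P2xP2xP2.IdealSheafData,
        (IsDivisorOfMultidegree P2xP2xP2.str P2xP2xP2.proj ![1, 1, 0] D₁ ∧
          IsDivisorOfMultidegree P2xP2xP2.str P2xP2xP2.proj ![1, 0, 1] D₂ ∧
          IsDivisorOfMultidegree P2xP2xP2.str P2xP2xP2.proj ![0, 1, 1] D₃) ∧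
        (IsNef D₁ ∧ IsNef D₂ ∧ IsNef D₃) ∧
        IsCompleteIntersection D₁ D₂ D₃ ∧
        ∃ e : Y ≅ (D₁ ⊔ D₂ ⊔ D₃).subscheme,
          e.hom ≫ (D₁ ⊔ D₂ ⊔ D₃).subschemeι ≫ P2xP2xP2.str = π ≫ W.ι ≫ P2xP2.str := by
  obtain ⟨A, B, hAB, hker⟩ := exists_ker_eq c bidegree_fst bidegree_snd embedded_fst embedded_snd
  have hB : B ≠ 0 := by
    rintro rfl
    rw [mul_zero] at hAB
    exact zero_ne_one hAB
  have hblow : IsBlowup (blowupMap B) c.ker :=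
    isBlowup_blowupMap hker (hker ▸ isEffectiveCartier_comap_blowupMap hAB)
  refine ⟨⟨_, _, hblow⟩, fun Y π hπ => ?_⟩
  -- Blow-ups are unique up to isomorphism over `W`, so the given one may be compared with
  -- `blowupMap B`.
  obtain ⟨e, he⟩ := hπ.exists_iso hblow
  refine ⟨blowupDivisor B 0, blowupDivisor B 1, blowupDivisor B 2,
    ⟨isDivisorOfMultidegree_bil _ _ one_ne_zero (a := 0) (b := 1) (by decide) (by decide),
      isDivisorOfMultidegree_bil _ _ one_ne_zero (a := 0) (b := 2) (by decide) (by decide),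
      isDivisorOfMultidegree_bil _ _ hB (a := 2) (b := 1) (by decide) (by decide)⟩,
    ⟨isProd_P2xP2xP2.isNef (isMultihomogeneous_bil 1 0 1) (bil_ne_zero one_ne_zero (by decide)),
      isProd_P2xP2xP2.isNef (isMultihomogeneous_bil 1 0 2) (bil_ne_zero one_ne_zero (by decide)),
      isProd_P2xP2xP2.isNef (isMultihomogeneous_bil B 2 1) (bil_ne_zero hB (by decide))⟩,
    isCompleteIntersection_blowupDivisor hAB, e, ?_⟩
  rw [← he, Category.assoc, blowupMap_str]
  rfl
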